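/- **Third order Wronskians HK basis for the discrete Kirchhoff system.** Let $a_1,a_3,b_1,b_3,\epsilon\in\mathbb R$ with $a_1\neq 0$, $b_1\neq b_3$, $\epsilon\neq 0$. For $x=(m,p)=(m_1,m_2,m_3,p_1,p_2,p_3)\in\mathbb R^6$ let $$f(m,p)=\begin{pmatrix}(a_3-a_1)m_2m_3+(b_3-b_1)p_2p_3\\ (a_1-a_3)m_1m_3+(b_1-b_3)p_1p_3\\ 0\\ a_3p_2m_3-a_1p_3m_2\\ a_1p_3m_1-a_3p_1m_3\\ a_1(p_1m_2-p_2m_1)\end{pmatrix}$$ be the Kirchhoff vector field, $\Delta(x;\epsilon)=\det(I-\epsilon f'(x))$, and let $\Phi(x)=\Phi(x;\epsilon)=x+2\epsilon\,(I-\epsilon f'(x))^{-1}f(x)$ (defined where $\Delta(x;\epsilon)\ne0$) be its Kahan–Hirota–Kimura discretization, a birational map with inverse $\Phi(\cdot\,;-\epsilon)$. Write $\widetilde x=\Phi(x)$ and $(m^{(\ell)},p^{(\ell)})=\Phi^\ell(m,p)$. Let $U$ be the set of $x$ whose whole orbit $\Phi^i(x)$, $i\in\mathbb Z$, is defined, with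 $\Delta(\Phi^i(x);\pm\epsilon)\ne 0$ for all $i$. Real functions $\varphi_1,\dots,\varphi_n$ form an *HK basis* if they are linearly independent on $U$ and the null-space $K(x)=\{c\in\mathbb R^n:\sum_j c_j\varphi_j(\Phi^i(x))=0\ \forall i\in\mathbb Z\}$ is non-zero for all $x\in U$. A function $F$ is an *integral of motion* if $F(\Phi(x))=F(x)$ wherever $\Phi(x)$, $F(x)$ and $F(\Phi(x))$ are defined. A property holds *generically* if it holds outside the zero set of a non-zero polynomial on $\mathbb R^6$. Functions are *functionally independent* if generically they are differentiable with linearly independent differentials. Put $$I_0=\frac{\frac{2a_3}{a_1}-1+\epsilon^2a_1(a_3-a_1)(m_1^2+m_2^2)+\epsilon^2a_3(b_3-b_1)(p_1^2+p_2^2)}{1+\epsilon^2a_3(a_1-a_3)m_3^2+\epsilon^2a_1(b_1-b_3)p_3^2},$$ $$J_0=\frac{\frac{2a_3}{a_1}-1-\epsilon^2a_1(a_3-a_1)(m_1\widetilde m_1+m_2\widetilde m_2)-\epsilon^2a_3(b_3-b_1)(p_1\widetilde p_1+p_2\widetilde p_2)}{1-\epsilon^2a_3(a_1-a_3)m_3^2-\epsilon^2a_1(b_1-b_3)p_3\widetilde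 p_3}.$$ Then $U$ is dense in $\mathbb R^6$; the functions $W_i^{(3)}=m_i^{(3)}p_i-m_ip_i^{(3)}$, $i=1,2,3$, form an HK basis for $\Phi$; and there is a rational function $J_1=N/D$ on $\mathbb R^6$ ($N,D$ real polynomials, $D\ne0$) such that 1. for generic $x$, $D(x)\neq0$ and, if $x\in U$, the null-space $K(x)$ of $(W^{(3)}_1,W^{(3)}_2,W^{(3)}_3)$ is one-dimensional, spanned by $(1,1,J_1(x))$; 2. $W^{(3)}_1(x)+W^{(3)}_2(x)+J_1(x)W^{(3)}_3(x)=0$ for every $x$ with $D(x)\neq 0$ such that $\Delta(\Phi^i(x);\epsilon)\ne0$ for $i=0,1,2$; 3. $I_0$, $J_0$, $J_1$ and $m_3$ are integrals of motion of $\Phi$; 4. if moreover $a_1\neq 2a_3$, then $I_0,J_0,J_1,m_3$ are functionally independent. Thus $\Phi$ has as many independent integrals as the Kirchhoff flow, and is integrable in this sense. -/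

import Mathlib

/-! ## Hirota–Kimura bases -/

section HirotaKimura

/-- The null-space `K(x)` at `x` of the functions `φ₁, …, φₘ` along the orbit `i ↦ T i x`, `i ∈ ℤ`:
all `c ∈ ℝᵐ` with `c₁ φ₁(T i x) + … + cₘ φₘ(T i x) = 0` for all `i ∈ ℤ`. -/
def hkNullSpace {X : Type*} (T : ℤ → X → X) {m : ℕ} (φ : Fin m → X → ℝ) (x : X) :
    Submodule ℝ (Fin m → ℝ) where
  carrier := {c | ∀ i : ℤ, ∑ j, c j * φ j (T i x) = 0}
  add_mem' := by
    intro c d hc hd i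
    simp only [Pi.add_apply, add_mul, Finset.sum_add_distrib]
    rw [hc i, hd i, add_zero]
  zero_mem' := by
    intro i
    simp
  smul_mem' := by
    intro r c hc i
    simp only [Pi.smul_apply, smul_eq_mul, mul_assoc, ← Finset.mul_sum]
    rw [hc i, mul_zero]

/-- `φ₁, …, φₘ` is a Hirota–Kimura basis for a birational map with iterates `T i`, `i ∈ ℤ`, where
`U` is the set of points all of whose iterates are defined: the functions are linearly independent
on `U`, and the null-space at every point of `U` is non-trivial. -/
structure IsHKBasis {X : Type*} (T : ℤ → X → X) (U : Set X) {m : ℕ} (φ : Fin m → X → ℝ) :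
    Prop where
  linearIndependent : LinearIndependent ℝ (fun j => U.domRestrict (φ j))
  nontrivial : ∀ x ∈ U, hkNullSpace T φ x ≠ ⊥

end HirotaKimura

/-! ## The Kirchhoff system and its Kahan–Hirota–Kimura discretization -/

/-- The parameters of the Kirchhoff system (with `a₂ = a₁` and `b₂ = b₁`). -/
structure KirchhoffParams where
  a₁ : ℝ
  a₃ : ℝ
  b₁ : ℝ
  b₃ : ℝ

/-- Points `(m₁, m₂, m₃, p₁, p₂, p₃)` of the phase space `ℝ⁶`. -/
abbrev KState : Type := Fin 6 → ℝ

namespace Kirchhoff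

noncomputable section

/-- The right-hand side `f` of the Kirchhoff equations. -/
def field (k : KirchhoffParams) (x : KState) : KState :=
  ![(k.a₃ - k.a₁) * x 1 * x 2 + (k.b₃ - k.b₁) * x 4 * x 5,
    (k.a₁ - k.a₃) * x 0 * x 2 + (k.b₁ - k.b₃) * x 3 * x 5,
    0,
    k.a₃ * x 4 * x 2 - k.a₁ * x 5 * x 1,
    k.a₁ * x 5 * x 0 - k.a₃ * x 3 * x 2,
    k.a₁ * (x 3 * x 1 - x 4 * x 0)]

/-- The Jacobi matrix `f'(x)`. -/
def jacobian (k : KirchhoffParams) (x : KState) : Matrix (Fin 6) (Fin 6) ℝ :=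
  !![0, (k.a₃ - k.a₁) * x 2, (k.a₃ - k.a₁) * x 1, 0, (k.b₃ - k.b₁) * x 5, (k.b₃ - k.b₁) * x 4;
    (k.a₁ - k.a₃) * x 2, 0, (k.a₁ - k.a₃) * x 0, (k.b₁ - k.b₃) * x 5, 0, (k.b₁ - k.b₃) * x 3;
    0, 0, 0, 0, 0, 0;
    0, -k.a₁ * x 5, k.a₃ * x 4, 0, k.a₃ * x 2, -k.a₁ * x 1;
    k.a₁ * x 5, 0, -k.a₃ * x 3, -k.a₃ * x 2, 0, k.a₁ * x 0;
    -k.a₁ * x 4, k.a₁ * x 3, 0, k.a₁ * x 1, -k.a₁ * x 0, 0]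

/-- `Δ(x; ε) = det (I - ε f'(x))`. -/
def delta (k : KirchhoffParams) (ε : ℝ) (x : KState) : ℝ :=
  (1 - ε • jacobian k x).det

/-- The map `Φ(x; ε) = x + 2ε (I - ε f'(x))⁻¹ f(x)`, meaningful where `Δ(x; ε) ≠ 0`. -/
def kahanMap (k : KirchhoffParams) (ε : ℝ) (x : KState) : KState :=
  x + (2 * ε) • Matrix.mulVec (1 - ε • jacobian k x)⁻¹ (field k x)

/-- The discrete Kirchhoff equations relating `x = (m, p)` and `y = (m̃, p̃)`. -/
def IsStep (k : KirchhoffParams) (ε : ℝ) (x y : KState) : Prop :=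
  y 0 - x 0 = ε * (k.a₃ - k.a₁) * (y 1 * x 2 + x 1 * y 2)
      + ε * (k.b₃ - k.b₁) * (y 4 * x 5 + x 4 * y 5) ∧
  y 1 - x 1 = ε * (k.a₁ - k.a₃) * (y 2 * x 0 + x 2 * y 0)
      + ε * (k.b₁ - k.b₃) * (y 5 * x 3 + x 5 * y 3) ∧
  y 2 - x 2 = 0 ∧
  y 3 - x 3 = ε * k.a₃ * (y 2 * x 4 + x 2 * y 4) - ε * k.a₁ * (y 1 * x 5 + x 1 * y 5) ∧
  y 4 - x 4 = ε * k.a₁ * (y 0 * x 5 + x 0 * y 5) - ε * k.a₃ * (y 2 * x 3 + x 2 * y 3) ∧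
  y 5 - x 5 = ε * k.a₁ * (y 1 * x 3 + x 1 * y 3 - y 0 * x 4 - x 0 * y 4)

theorem isStep_iff_mulVec (k : KirchhoffParams) (ε : ℝ) (x y : KState) :
    IsStep k ε x y ↔
      Matrix.mulVec (1 - ε • jacobian k x) (y - x) = (2 * ε) • field k x := by
  rw [Matrix.sub_mulVec, Matrix.one_mulVec, Matrix.smul_mulVec]
  constructor
  · rintro ⟨h0, h1, h2, h3, h4, h5⟩
    funext i
    fin_cases i <;>
      simp [jacobian, field, dotProduct, Fin.sum_univ_succ] <;> linarith
  · intro h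
    have g := fun i => congrFun h i
    have g0 := g 0
    have g1 := g 1
    have g2 := g 2
    have g3 := g 3
    have g4 := g 4
    have g5 := g 5
    clear g h
    simp [jacobian, field, dotProduct, Fin.sum_univ_succ] at g0 g1 g2 g3 g4 g5
    refine ⟨?_, ?_, ?_, ?_, ?_, ?_⟩ <;> linarith

/-- Where `Δ(x; ε) ≠ 0`, the discrete Kirchhoff equations have the unique solution `Φ(x; ε)`. -/
theorem isStep_iff (k : KirchhoffParams) (ε : ℝ) (x y : KState) (h : delta k ε x ≠ 0) :
    IsStep k ε x y ↔ y = kahanMap k ε x := by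
  have hu : IsUnit (1 - ε • jacobian k x).det := isUnit_iff_ne_zero.mpr h
  rw [isStep_iff_mulVec]
  constructor
  · intro e
    have e' := congrArg (Matrix.mulVec (1 - ε • jacobian k x)⁻¹) e
    rw [Matrix.mulVec_mulVec, Matrix.nonsing_inv_mul _ hu, Matrix.one_mulVec,
      Matrix.mulVec_smul] at e'
    rw [kahanMap, ← e']
    abel
  · rintro rfl
    rw [kahanMap, add_sub_cancel_left, Matrix.mulVec_smul, Matrix.mulVec_mulVec,
      Matrix.mul_nonsing_inv _ hu, Matrix.one_mulVec]

/-- The iterates `Φⁱ`, `i ∈ ℤ`, the inverse of `Φ(·; ε)` being `Φ(·; -ε)`. -/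
def iter (k : KirchhoffParams) (ε : ℝ) : ℤ → KState → KState
  | Int.ofNat n => (kahanMap k ε)^[n]
  | Int.negSucc n => (kahanMap k (-ε))^[n + 1]

/-- The points whose whole forward and backward orbit is defined: no point of the orbit is singular
for `Φ(·; ε)` or for its inverse `Φ(·; -ε)`. -/
def orbitDomain (k : KirchhoffParams) (ε : ℝ) : Set KState :=
  {x | ∀ i : ℤ, delta k ε (iter k ε i x) ≠ 0 ∧ delta k (-ε) (iter k ε i x) ≠ 0}

/-- The discrete Wronskians `W⁽ˡ⁾ᵢ = mᵢ⁽ˡ⁾ pᵢ - mᵢ pᵢ⁽ˡ⁾` of order `l`, with `(m⁽ˡ⁾, p⁽ˡ⁾) = Φˡ(m, p)`.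
The index `i : Fin 3` embeds as `i` (component `mᵢ`) and as `i + 3` (component `pᵢ`). -/
def wronskian (k : KirchhoffParams) (ε : ℝ) (l : ℕ) (i : Fin 3) (x : KState) : ℝ :=
  ((kahanMap k ε)^[l] x) (Fin.castAdd 3 i) * x (Fin.natAdd 3 i)
    - x (Fin.castAdd 3 i) * ((kahanMap k ε)^[l] x) (Fin.natAdd 3 i)

/-- The denominator `c₁` of `I₀`. -/
def c₁ (k : KirchhoffParams) (ε : ℝ) (x : KState) : ℝ :=
  1 + ε ^ 2 * k.a₃ * (k.a₁ - k.a₃) * x 2 ^ 2 + ε ^ 2 * k.a₁ * (k.b₁ - k.b₃) * x 5 ^ 2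

/-- The numerator `c₃` of `I₀`. -/
def c₃ (k : KirchhoffParams) (ε : ℝ) (x : KState) : ℝ :=
  2 * k.a₃ / k.a₁ - 1 + ε ^ 2 * k.a₁ * (k.a₃ - k.a₁) * (x 0 ^ 2 + x 1 ^ 2)
    + ε ^ 2 * k.a₃ * (k.b₃ - k.b₁) * (x 3 ^ 2 + x 4 ^ 2)

/-- The quadratic-fractional integral `I₀`. -/
def I₀ (k : KirchhoffParams) (ε : ℝ) (x : KState) : ℝ := c₃ k ε x / c₁ k ε x

/-- The denominator `C₁` of `J₀`. -/
def C₁ (k : KirchhoffParams) (ε : ℝ) (x : KState) : ℝ :=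
  1 - ε ^ 2 * k.a₃ * (k.a₁ - k.a₃) * x 2 ^ 2
    - ε ^ 2 * k.a₁ * (k.b₁ - k.b₃) * (x 5 * kahanMap k ε x 5)

/-- The numerator `C₃` of `J₀`. -/
def C₃ (k : KirchhoffParams) (ε : ℝ) (x : KState) : ℝ :=
  2 * k.a₃ / k.a₁ - 1
    - ε ^ 2 * k.a₁ * (k.a₃ - k.a₁) * (x 0 * kahanMap k ε x 0 + x 1 * kahanMap k ε x 1)
    - ε ^ 2 * k.a₃ * (k.b₃ - k.b₁) * (x 3 * kahanMap k ε x 3 + x 4 * kahanMap k ε x 4)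

/-- The bilinear-fractional integral `J₀`. -/
def J₀ (k : KirchhoffParams) (ε : ℝ) (x : KState) : ℝ := C₃ k ε x / C₁ k ε x

/-- The coordinate function `m₃`. -/
def m₃ (x : KState) : ℝ := x 2

/-- The rational function `N / D`. -/
def ratFun (N D : MvPolynomial (Fin 6) ℝ) (x : KState) : ℝ :=
  MvPolynomial.eval x N / MvPolynomial.eval x D

/-- The function `F`, whose domain of definition is `dom`, is an integral of motion of `Φ(·; ε)`:
`F (Φ x) = F x` wherever `Φ x`, `F x` and `F (Φ x)` are defined. -/
def IsIntegral (k : KirchhoffParams) (ε : ℝ) (dom : Set KState) (F : KState → ℝ) : Prop :=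
  ∀ x ∈ dom, delta k ε x ≠ 0 → kahanMap k ε x ∈ dom → F (kahanMap k ε x) = F x

/-- `P` holds at generic points, that is, outside the zero set of some non-zero polynomial. -/
def Generically (P : KState → Prop) : Prop :=
  ∃ q : MvPolynomial (Fin 6) ℝ, q ≠ 0 ∧ ∀ x, MvPolynomial.eval x q ≠ 0 → P x

/-- Functional independence of (almost everywhere defined, smooth) functions: at generic points
they are differentiable with linearly independent differentials. -/
def FunctionallyIndependent {n : ℕ} (F : Fin n → KState → ℝ) : Prop :=
  Generically fun x =>
    (∀ j, DifferentiableAt ℝ (F j) x) ∧ LinearIndependent ℝ (fun j => fderiv ℝ (F j) x)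

end

end Kirchhoff

/-!
In the complex coordinates `M = m₁ + i m₂`, `P = p₁ + i p₂` one step of the map is linear once
`p̃₃` is known. Solving it shows that the Wronskians of consecutive points satisfy
`W₁ + W₂ = m₃ (p̃₃ - p₃) I₀ = -I₀ W₃` with an integral `I₀`, and those of points two steps apart
`W₁ + W₂ = -J₀ W₃`. Now `W₁ + W₂` is, up to a factor, the imaginary part of a hermitian form on
`ℂ²`. All 3 × 3 minors of the Gram matrix of four consecutive points vanish, so the value of the
form three steps apart is determined by the values one and two steps apart; it is again a multiple
of `p̃₃ - p₃` by an integral, whose imaginary part gives `J₁`. The identities hold at generic points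
and extend by density and continuity.

The null-space is one-dimensional because the determinant of `(W₁, W₃)` at consecutive points is
generically non-zero: otherwise this determinant, divided by `m₃`, would also vanish on the slice
`m₃ = p₃ = 0`. The points of the slice are fixed by the reflection `(m₃, p₃) ↦ (-m₃, -p₃)`, which
conjugates the map to its inverse, and this makes the determinant explicit there. For functional
independence, `J₀` and `J₁` are expressed through `I₀`, `m₃` and two further integrals `redJ` and
`invN`, and the differentials are computed on the same slice.
-/

namespace Kirchhoff

noncomputable section

open MvPolynomial Filter Topology

section Quantities

/-- The area `m₂ p₁ - m₁ p₂` spanned by the planar parts of `p` and `m`. -/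
def area (x : KState) : ℝ := x 1 * x 3 - x 0 * x 4

/-- The symmetric bilinear form with `areaForm x x = 2 * area x`. -/
def areaForm (x y : KState) : ℝ := y 1 * x 3 - y 0 * x 4 + (x 1 * y 3 - x 0 * y 4)

/-- The planar Wronskian `(m̃₁ p₁ - m₁ p̃₁) + (m̃₂ p₂ - m₂ p̃₂)` of `x = (m, p)` and `y = (m̃, p̃)`.
If `m̃₃ = m₃`, the relation `W₁ + W₂ + J W₃ = 0` says that it equals `m₃ (p̃₃ - p₃) J`. -/
def planarWronskian (x y : KState) : ℝ := y 0 * x 3 + y 1 * x 4 - (x 0 * y 3 + x 1 * y 4)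

/-- The quadratic form through which, besides `I₀`, the planar components of `x` enter `sigma`. -/
def quadH (k : KirchhoffParams) (ε : ℝ) (x : KState) : ℝ :=
  ε ^ 2 * k.a₁ * (k.a₁ * (x 0 ^ 2 + x 1 ^ 2) + (k.b₃ - k.b₁) * (x 3 ^ 2 + x 4 ^ 2))

/-- Given `p̃₃`, the step equations are a linear system for the complex numbers `m̃₁ + i m̃₂` and
`p̃₁ + i p̃₂`, with determinant `c₁ + i imDet`. -/
def imDet (k : KirchhoffParams) (ε : ℝ) (x : KState) : ℝ := ε * (2 * k.a₃ - k.a₁) * x 2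

/-- The part even in `ε` of the denominator of the slope `p̃₃ - p₃`, see `IsStep.slope`. -/
def sigma (k : KirchhoffParams) (ε : ℝ) (x : KState) : ℝ :=
  c₁ k ε x + quadH k ε x + ε * k.a₁ * x 2 * imDet k ε x * I₀ k ε x

/-- The part odd in `ε`, up to sign, of the denominator of the slope `p̃₃ - p₃`, see
`IsStep.slope`. -/
def skew (k : KirchhoffParams) (ε : ℝ) (x : KState) : ℝ :=
  2 * ε ^ 3 * k.a₁ ^ 2 * (k.b₃ - k.b₁) * x 5 * area x

/-- The part even in `ε` of `slopeNum`. -/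
def evenSlopeNum (k : KirchhoffParams) (ε : ℝ) (x : KState) : ℝ :=
  ε ^ 2 * k.a₁ ^ 2 * x 2 * (x 0 * x 3 + x 1 * x 4) - x 5 * quadH k ε x

/-- Half the numerator of the slope `p̃₃ - p₃`, see `IsStep.slope`. -/
def slopeNum (k : KirchhoffParams) (ε : ℝ) (x : KState) : ℝ :=
  evenSlopeNum k ε x + ε * k.a₁ * area x * (2 - c₁ k ε x)

/-- Four times the value of `c₁ - 1` at the midpoint of `x` and `y`, provided that `y 2 = x 2`. -/
def mixed (k : KirchhoffParams) (ε : ℝ) (x y : KState) : ℝ :=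
  4 * ε ^ 2 * k.a₃ * (k.a₁ - k.a₃) * x 2 ^ 2
    + ε ^ 2 * k.a₁ * (k.b₁ - k.b₃) * (x 5 + y 5) ^ 2

/-- The polarization of the denominator `c₁` of `I₀`: at `y = Φ x` it is the denominator `C₁` of
`J₀`. -/
def polarC₁ (k : KirchhoffParams) (ε : ℝ) (x y : KState) : ℝ :=
  1 - ε ^ 2 * k.a₃ * (k.a₁ - k.a₃) * x 2 ^ 2 - ε ^ 2 * k.a₁ * (k.b₁ - k.b₃) * (x 5 * y 5)

/-- The polarization of the numerator `c₃` of `I₀`: at `y = Φ x` it is the numerator `C₃` of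
`J₀`. -/
def polarC₃ (k : KirchhoffParams) (ε : ℝ) (x y : KState) : ℝ :=
  2 * k.a₃ / k.a₁ - 1 - ε ^ 2 * k.a₁ * (k.a₃ - k.a₁) * (x 0 * y 0 + x 1 * y 1)
    - ε ^ 2 * k.a₃ * (k.b₃ - k.b₁) * (x 3 * y 3 + x 4 * y 4)

/-- The quadratic polynomial in `p̃₃` to which the mean area of a step is proportional, see
`IsStep.normSq_det_mul_area_add`. -/
def quadF (k : KirchhoffParams) (ε : ℝ) (x y : KState) : ℝ :=
  polarC₁ k ε x y * (2 * c₁ k ε x + 2 * ε * k.a₁ * x 2 * imDet k ε x * I₀ k ε x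
      + 2 * ε ^ 3 * k.a₁ ^ 2 * (k.b₃ - k.b₁) * (x 5 + y 5) * area x)
    + (sigma k ε x + skew k ε x) * mixed k ε x y / 2

/-- Half the numerator of the integral `redJ`. -/
def numJ (k : KirchhoffParams) (ε : ℝ) (x : KState) : ℝ :=
  1 + (ε * k.a₁ * x 2 * I₀ k ε x) ^ 2 + quadH k ε x
    + ε ^ 4 * k.a₁ ^ 3 * (k.b₃ - k.b₁) * area x ^ 2

/-- The denominator of the integral `redJ`: the product of the denominator `C₁` of `J₀` and of the
denominator `sigma - skew` of the slope. -/
def denJ (k : KirchhoffParams) (ε : ℝ) (x : KState) : ℝ :=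
  (2 - c₁ k ε x) * sigma k ε x
    + 2 * ε ^ 2 * k.a₁ * (k.b₃ - k.b₁) * x 5 * evenSlopeNum k ε x

/-- An integral of motion, invariant under `ε ↦ -ε`, to which `J₀` reduces modulo `I₀`, see
`ratJ₀`. -/
def redJ (k : KirchhoffParams) (ε : ℝ) (x : KState) : ℝ := 2 * numJ k ε x / denJ k ε x

/-- The expression of `J₀` through the integrals `I₀` and `redJ`. -/
def ratJ₀ (k : KirchhoffParams) (ε : ℝ) (x : KState) : ℝ :=
  (2 * k.a₃ / k.a₁ - 1) * redJ k ε x - I₀ k ε x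

/-- The factor that relates the slope over two steps to the area at the middle point, see
`IsStep.sub_mul_tau`. -/
def tau (k : KirchhoffParams) (ε : ℝ) (x : KState) : ℝ :=
  (sigma k ε x ^ 2 - skew k ε x ^ 2) / (2 * denJ k ε x)

/-- The integral of motion that, besides `I₀`, `redJ` and `m₃`, determines `J₁`. -/
def invN (k : KirchhoffParams) (ε : ℝ) (x : KState) : ℝ := tau k ε x - redJ k ε x * c₁ k ε x

/-- The points where the coordinates and denominators in the identities for a single step do not
vanish. -/
structure IsRegular (k : KirchhoffParams) (ε : ℝ) (x : KState) : Prop where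
  m₃_ne : x 2 ≠ 0
  p₃_ne : x 5 ≠ 0
  c₁_ne : c₁ k ε x ≠ 0
  denJ_ne : denJ k ε x ≠ 0

variable {k : KirchhoffParams} {ε : ℝ} {x y : KState}

theorem imDet_eq (ha : k.a₁ ≠ 0) (x : KState) :
    imDet k ε x = (2 * k.a₃ / k.a₁ - 1) * (ε * k.a₁ * x 2) := by
  rw [imDet]
  field_simp

theorem planarWronskian_comm (x y : KState) : planarWronskian y x = -planarWronskian x y := by
  simp only [planarWronskian]
  ring

theorem polarC₁_symm (h : y 2 = x 2) : polarC₁ k (-ε) y x = polarC₁ k ε x y := by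
  simp only [polarC₁, h, neg_sq, mul_comm (y 5)]

@[simp]
theorem c₁_neg : c₁ k (-ε) x = c₁ k ε x := by
  simp only [c₁, neg_sq]

@[simp]
theorem I₀_neg : I₀ k (-ε) x = I₀ k ε x := by
  simp only [I₀, c₃, c₁_neg, neg_sq]

@[simp]
theorem quadH_neg : quadH k (-ε) x = quadH k ε x := by
  simp only [quadH, neg_sq]

@[simp]
theorem sigma_neg : sigma k (-ε) x = sigma k ε x := by
  simp only [sigma, imDet, c₁_neg, quadH_neg, I₀_neg]
  ring

@[simp]
theorem skew_neg : skew k (-ε) x = -skew k ε x := by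
  simp only [skew]
  ring

@[simp]
theorem denJ_neg : denJ k (-ε) x = denJ k ε x := by
  simp only [denJ, evenSlopeNum, c₁_neg, sigma_neg, quadH_neg, neg_sq]

@[simp]
theorem redJ_neg : redJ k (-ε) x = redJ k ε x := by
  simp only [redJ, numJ, denJ_neg, quadH_neg, I₀_neg]
  ring

@[simp]
theorem tau_neg : tau k (-ε) x = tau k ε x := by
  simp only [tau, sigma_neg, skew_neg, denJ_neg, neg_sq]

namespace IsRegular

variable (h : IsRegular k ε x)
include h

theorem I₀_mul : I₀ k ε x * c₁ k ε x = c₃ k ε x :=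
  div_mul_cancel₀ _ h.c₁_ne

theorem normSq_det_ne : c₁ k ε x ^ 2 + imDet k ε x ^ 2 ≠ 0 := by
  have := h.c₁_ne
  positivity

theorem neg : IsRegular k (-ε) x :=
  ⟨h.m₃_ne, h.p₃_ne, by rw [c₁_neg]; exact h.c₁_ne, by rw [denJ_neg]; exact h.denJ_ne⟩

end IsRegular

theorem quadF_eq_quadratic :
    quadF k ε x y = (2 - c₁ k ε x) * (2 * c₁ k ε x
          + 2 * ε * k.a₁ * x 2 * imDet k ε x * I₀ k ε x + 2 * skew k ε x)
        + (sigma k ε x + skew k ε x) * mixed k ε x x / 2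
      + (2 * ε ^ 3 * k.a₁ ^ 2 * (k.b₃ - k.b₁) * area x * (2 - c₁ k ε x)
          + 2 * ε ^ 2 * k.a₁ * (k.b₃ - k.b₁) * x 5
            * (c₁ k ε x + ε * k.a₁ * x 2 * imDet k ε x * I₀ k ε x - sigma k ε x)) * (y 5 - x 5)
      - ε ^ 2 * k.a₁ * (k.b₃ - k.b₁) / 2 * (sigma k ε x - skew k ε x) * (y 5 - x 5) ^ 2 := by
  simp only [quadF, polarC₁, mixed, skew, c₁]
  ring

theorem quadF_quadratic_at_slope (ha : k.a₁ ≠ 0) (hI : I₀ k ε x * c₁ k ε x = c₃ k ε x) :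
    ((2 - c₁ k ε x) * (2 * c₁ k ε x
            + 2 * ε * k.a₁ * x 2 * imDet k ε x * I₀ k ε x + 2 * skew k ε x)
          + (sigma k ε x + skew k ε x) * mixed k ε x x / 2) * (sigma k ε x - skew k ε x)
        + 2 * (2 * ε ^ 3 * k.a₁ ^ 2 * (k.b₃ - k.b₁) * area x * (2 - c₁ k ε x)
          + 2 * ε ^ 2 * k.a₁ * (k.b₃ - k.b₁) * x 5
            * (c₁ k ε x + ε * k.a₁ * x 2 * imDet k ε x * I₀ k ε x - sigma k ε x)) * slopeNum k ε x
        - 2 * (ε ^ 2 * k.a₁ * (k.b₃ - k.b₁)) * slopeNum k ε x ^ 2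
      = 2 * (c₁ k ε x ^ 2 + imDet k ε x ^ 2) * numJ k ε x := by
  obtain ⟨a, hk⟩ : ∃ a, k.a₃ = a * k.a₁ := ⟨k.a₃ / k.a₁, by field_simp⟩
  simp only [numJ, c₁, c₃, mixed, sigma, skew, slopeNum, evenSlopeNum, area, quadH, imDet, hk,
    mul_div_assoc, mul_div_cancel_right₀ _ ha] at *
  linear_combination -2 * (ε * k.a₁ * x 2) ^ 2
    * (I₀ k ε x * (1 + ε ^ 2 * (a * k.a₁) * (k.a₁ - a * k.a₁) * x 2 ^ 2
        + ε ^ 2 * k.a₁ * (k.b₁ - k.b₃) * x 5 ^ 2)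
      - (2 * a - 1) - ε ^ 2 * a * k.a₁ ^ 2 * (x 0 ^ 2 + x 1 ^ 2)
      - ε ^ 2 * (a - 1) * k.a₁ * (k.b₃ - k.b₁) * (x 3 ^ 2 + x 4 ^ 2)) * hI

theorem quadF_mul (ha : k.a₁ ≠ 0) (hI : I₀ k ε x * c₁ k ε x = c₃ k ε x)
    (hy : (y 5 - x 5) * (sigma k ε x - skew k ε x) = 2 * slopeNum k ε x) :
    quadF k ε x y * (sigma k ε x - skew k ε x)
      = 2 * (c₁ k ε x ^ 2 + imDet k ε x ^ 2) * numJ k ε x := by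
  rw [← quadF_quadratic_at_slope ha hI, quadF_eq_quadratic]
  linear_combination
    (2 * ε ^ 3 * k.a₁ ^ 2 * (k.b₃ - k.b₁) * area x * (2 - c₁ k ε x)
      + 2 * ε ^ 2 * k.a₁ * (k.b₃ - k.b₁) * x 5
        * (c₁ k ε x + ε * k.a₁ * x 2 * imDet k ε x * I₀ k ε x - sigma k ε x)
      - ε ^ 2 * k.a₁ * (k.b₃ - k.b₁) / 2
        * ((y 5 - x 5) * (sigma k ε x - skew k ε x) + 2 * slopeNum k ε x)) * hy

end Quantities

namespace IsStep

variable {k : KirchhoffParams} {ε : ℝ} {x y : KState}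

theorem m₃_eq (s : IsStep k ε x y) : y 2 = x 2 := sub_eq_zero.mp s.2.2.1

theorem symm (s : IsStep k ε x y) : IsStep k (-ε) y x := by
  obtain ⟨h0, h1, h2, h3, h4, h5⟩ := s
  refine ⟨?_, ?_, ?_, ?_, ?_, ?_⟩
  · linear_combination -h0
  · linear_combination -h1
  · linear_combination -h2
  · linear_combination -h3
  · linear_combination -h4
  · linear_combination -h5

theorem p₃_sub (s : IsStep k ε x y) : y 5 - x 5 = ε * k.a₁ * areaForm x y := by
  obtain ⟨-, -, -, -, -, h5⟩ := s
  rw [h5, areaForm]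
  ring

theorem planarWronskian_mul_c₁ (s : IsStep k ε x y) (ha : k.a₁ ≠ 0) :
    planarWronskian x y * c₁ k ε x = x 2 * (y 5 - x 5) * c₃ k ε x := by
  have hm := s.m₃_eq
  obtain ⟨h0, h1, -, h3, h4, h5⟩ := s
  obtain ⟨a, hk⟩ : ∃ a, k.a₃ = a * k.a₁ := ⟨k.a₃ / k.a₁, by field_simp⟩
  simp only [planarWronskian, c₁, c₃, hk, hm, mul_div_assoc, mul_div_cancel_right₀ _ ha] at *
  linear_combination (x 3 + ε * (a * k.a₁) * x 2 * x 4 - ε * k.a₁ * x 5 * x 1) * h0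
    - (-x 4 + ε * (a * k.a₁) * x 2 * x 3 - ε * k.a₁ * x 5 * x 0) * h1
    - (x 0 + ε * (a * k.a₁ - k.a₁) * x 2 * x 1 + ε * (k.b₃ - k.b₁) * x 5 * x 4) * h3
    + (-x 1 + ε * (a * k.a₁ - k.a₁) * x 2 * x 0 + ε * (k.b₃ - k.b₁) * x 5 * x 3) * h4
    - (2 * a - 1) * x 2 * h5

theorem quadH_sub (s : IsStep k ε x y) :
    quadH k ε x - quadH k ε y = ε ^ 2 * k.a₁ * (k.b₃ - k.b₁) *
      (2 * ε * k.a₁ * (x 5 * area y + y 5 * area x) + (y 5 ^ 2 - x 5 ^ 2)) := by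
  have hm := s.m₃_eq
  obtain ⟨h0, h1, -, h3, h4, h5⟩ := s
  simp only [area, quadH, hm] at *
  linear_combination -(ε * k.a₁) ^ 2 * ((x 0 + y 0) * h0 + (x 1 + y 1) * h1)
    - ε ^ 2 * k.a₁ * (k.b₃ - k.b₁) * ((x 3 + y 3) * h3 + (x 4 + y 4) * h4 + (x 5 + y 5) * h5)

-- Cramer's rule for the linear system with determinant `c₁ + i imDet`, whose right-hand side is
-- `(B₀ + i B₁, B₃ + i B₄)`.
theorem normSq_det_mul_area (s : IsStep k ε x y) :
    (c₁ k ε x ^ 2 + imDet k ε x ^ 2) * area y =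
      let B₀ := x 0 + ε * (k.a₃ - k.a₁) * x 2 * x 1 + ε * (k.b₃ - k.b₁) * y 5 * x 4
      let B₁ := x 1 - ε * (k.a₃ - k.a₁) * x 2 * x 0 - ε * (k.b₃ - k.b₁) * y 5 * x 3
      let B₃ := x 3 + ε * k.a₃ * x 2 * x 4 - ε * k.a₁ * y 5 * x 1
      let B₄ := x 4 - ε * k.a₃ * x 2 * x 3 + ε * k.a₁ * y 5 * x 0
      (B₁ + ε * k.a₃ * x 2 * B₀ - ε * (k.b₃ - k.b₁) * x 5 * B₃)
        * (B₃ - ε * (k.a₃ - k.a₁) * x 2 * B₄ - ε * k.a₁ * x 5 * B₁)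
      - (B₀ - ε * k.a₃ * x 2 * B₁ + ε * (k.b₃ - k.b₁) * x 5 * B₄)
        * (B₄ + ε * (k.a₃ - k.a₁) * x 2 * B₃ + ε * k.a₁ * x 5 * B₀) := by
  have hm := s.m₃_eq
  obtain ⟨h0, h1, -, h3, h4, -⟩ := s
  rw [hm] at h0 h1 h3 h4
  extract_lets B₀ B₁ B₃ B₄
  have hM₁ : c₁ k ε x * y 0 - imDet k ε x * y 1
      = B₀ - ε * k.a₃ * x 2 * B₁ + ε * (k.b₃ - k.b₁) * x 5 * B₄ := by
    simp only [c₁, imDet, B₀, B₁, B₄]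
    linear_combination h0 - ε * k.a₃ * x 2 * h1 + ε * (k.b₃ - k.b₁) * x 5 * h4
  have hM₂ : imDet k ε x * y 0 + c₁ k ε x * y 1
      = B₁ + ε * k.a₃ * x 2 * B₀ - ε * (k.b₃ - k.b₁) * x 5 * B₃ := by
    simp only [c₁, imDet, B₀, B₁, B₃]
    linear_combination h1 + ε * k.a₃ * x 2 * h0 - ε * (k.b₃ - k.b₁) * x 5 * h3
  have hP₁ : c₁ k ε x * y 3 - imDet k ε x * y 4
      = B₃ - ε * (k.a₃ - k.a₁) * x 2 * B₄ - ε * k.a₁ * x 5 * B₁ := by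
    simp only [c₁, imDet, B₃, B₁, B₄]
    linear_combination h3 - ε * (k.a₃ - k.a₁) * x 2 * h4 - ε * k.a₁ * x 5 * h1
  have hP₂ : imDet k ε x * y 3 + c₁ k ε x * y 4
      = B₄ + ε * (k.a₃ - k.a₁) * x 2 * B₃ + ε * k.a₁ * x 5 * B₀ := by
    simp only [c₁, imDet, B₀, B₃, B₄]
    linear_combination h4 + ε * (k.a₃ - k.a₁) * x 2 * h3 + ε * k.a₁ * x 5 * h0
  rw [← hM₁, ← hM₂, ← hP₁, ← hP₂, area]
  ring

theorem polarization (s : IsStep k ε x y) (ha : k.a₁ ≠ 0) :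
    planarWronskian x y * (1 - ε ^ 2 * k.a₁ * (k.b₃ - k.b₁) * (y 5 - x 5) ^ 2 / 4)
      = (2 * k.a₃ / k.a₁ - 1) * x 2 / 2 * (ε * k.a₁ * (area x + area y) + (y 5 - x 5))
        + x 2 * (y 5 - x 5) / 4 *
          (ε ^ 2 * k.a₁ * (k.a₃ - k.a₁) * ((x 0 + y 0) ^ 2 + (x 1 + y 1) ^ 2)
            + ε ^ 2 * k.a₃ * (k.b₃ - k.b₁) * ((x 3 + y 3) ^ 2 + (x 4 + y 4) ^ 2)) := by
  have hm := s.m₃_eq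
  obtain ⟨h0, h1, -, h3, h4, h5⟩ := s
  obtain ⟨a, hk⟩ : ∃ a, k.a₃ = a * k.a₁ := ⟨k.a₃ / k.a₁, by field_simp⟩
  simp only [planarWronskian, area, hk, hm, mul_div_assoc, mul_div_cancel_right₀ _ ha] at *
  linear_combination
    (h0 - (y 5 - x 5) / 2 * (ε * (k.b₃ - k.b₁)) * h4) * (x 3 + y 3) / 2
    + (h1 + (y 5 - x 5) / 2 * (ε * (k.b₃ - k.b₁)) * h3) * (x 4 + y 4) / 2
    - (h3 + (y 5 - x 5) / 2 * (ε * k.a₁) * h1) * (x 0 + y 0) / 2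
    - (h4 - (y 5 - x 5) / 2 * (ε * k.a₁) * h0) * (x 1 + y 1) / 2
    - (2 * a - 1) * x 2 / 2 * h5

section Regular

variable (s : IsStep k ε x y) (ha : k.a₁ ≠ 0) (hx : IsRegular k ε x)
include s ha hx

theorem planarWronskian_eq : planarWronskian x y = x 2 * (y 5 - x 5) * I₀ k ε x := by
  apply mul_right_cancel₀ hx.c₁_ne
  rw [s.planarWronskian_mul_c₁ ha, ← hx.I₀_mul]
  ring

theorem slope : (y 5 - x 5) * (sigma k ε x - skew k ε x) = 2 * slopeNum k ε x := by
  have hω := s.planarWronskian_eq ha hx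
  have hm := s.m₃_eq
  obtain ⟨h0, h1, -, h3, h4, h5⟩ := s
  simp only [planarWronskian, c₁, sigma, skew, slopeNum, evenSlopeNum, area, quadH, imDet,
    hm] at *
  linear_combination ε * k.a₁ * (
    (x 3 + ε * k.a₃ * x 2 * x 4 - ε * k.a₁ * x 5 * x 1) * h1
    + (-x 4 + ε * k.a₃ * x 2 * x 3 - ε * k.a₁ * x 5 * x 0) * h0
    - (x 0 + ε * (k.a₃ - k.a₁) * x 2 * x 1 + ε * (k.b₃ - k.b₁) * x 5 * x 4) * h4
    - (-x 1 + ε * (k.a₃ - k.a₁) * x 2 * x 0 + ε * (k.b₃ - k.b₁) * x 5 * x 3) * h3)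
    - ε * (2 * k.a₃ - k.a₁) * x 2 * (ε * k.a₁) * hω
    + (1 + ε ^ 2 * k.a₃ * (k.a₁ - k.a₃) * x 2 ^ 2 + ε ^ 2 * k.a₁ * (k.b₁ - k.b₃) * x 5 ^ 2) * h5

theorem polarC₁_mul : polarC₁ k ε x y * (sigma k ε x - skew k ε x) = denJ k ε x := by
  have h := s.slope ha hx
  simp only [denJ, polarC₁, skew, slopeNum, c₁] at *
  linear_combination ε ^ 2 * k.a₁ * (k.b₃ - k.b₁) * x 5 * h

theorem polarC₁_ne : polarC₁ k ε x y ≠ 0 :=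
  left_ne_zero_of_mul (s.polarC₁_mul ha hx ▸ hx.denJ_ne)

theorem sigma_sub_skew_ne : sigma k ε x - skew k ε x ≠ 0 :=
  right_ne_zero_of_mul (s.polarC₁_mul ha hx ▸ hx.denJ_ne)

theorem polarC₁_mul_tau : 2 * polarC₁ k ε x y * tau k ε x = sigma k ε x + skew k ε x := by
  have hC := s.polarC₁_ne ha hx
  have hS := s.sigma_sub_skew_ne ha hx
  rw [tau, ← s.polarC₁_mul ha hx]
  field_simp
  ring

theorem redJ_mul :
    redJ k ε x * polarC₁ k ε x y * (sigma k ε x - skew k ε x) = 2 * numJ k ε x := by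
  rw [mul_assoc, s.polarC₁_mul ha hx, redJ, div_mul_cancel₀ _ hx.denJ_ne]

theorem quadF_eq :
    quadF k ε x y = (c₁ k ε x ^ 2 + imDet k ε x ^ 2) * redJ k ε x * polarC₁ k ε x y := by
  have h1 := quadF_mul ha hx.I₀_mul (s.slope ha hx)
  have h2 := s.redJ_mul ha hx
  apply mul_right_cancel₀ (s.sigma_sub_skew_ne ha hx)
  linear_combination h1 - (c₁ k ε x ^ 2 + imDet k ε x ^ 2) * h2

theorem normSq_det_mul_area_add :
    (c₁ k ε x ^ 2 + imDet k ε x ^ 2) * (ε * k.a₁ * (area x + area y) + (y 5 - x 5))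
      = (y 5 - x 5) * quadF k ε x y := by
  have hA := s.normSq_det_mul_area
  have hI := hx.I₀_mul
  have hy := s.slope ha hx
  obtain ⟨a, hk⟩ : ∃ a, k.a₃ = a * k.a₁ := ⟨k.a₃ / k.a₁, by field_simp⟩
  rw [quadF]
  simp only [c₁, c₃, mixed, polarC₁, sigma, skew, slopeNum, evenSlopeNum, area, quadH, imDet, hk,
    mul_div_assoc, mul_div_cancel_right₀ _ ha] at *
  linear_combination ε * k.a₁ * hA
    + (ε ^ 2 * k.a₁ * (k.b₃ - k.b₁) * (y 5 - x 5) ^ 2 / 2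
      + ε ^ 2 * (a * k.a₁) * (k.a₁ - a * k.a₁) * x 2 ^ 2
      + ε ^ 2 * k.a₁ * (k.b₁ - k.b₃) * x 5 ^ 2 - 1) * hy
    - ε ^ 2 * k.a₁ ^ 2 * (2 * a - 1) * x 2 ^ 2 * (y 5 - x 5) * hI

theorem area_add_eq : ε * k.a₁ * (area x + area y) + (y 5 - x 5)
    = redJ k ε x * (y 5 - x 5) * polarC₁ k ε x y := by
  apply mul_left_cancel₀ hx.normSq_det_ne
  rw [s.normSq_det_mul_area_add ha hx, s.quadF_eq ha hx]
  ring

theorem redJ_linear :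
    2 * c₁ k ε x + 2 * ε * k.a₁ * x 2 * imDet k ε x * I₀ k ε x
        + 2 * ε ^ 3 * k.a₁ ^ 2 * (k.b₃ - k.b₁) * (x 5 + y 5) * area x
        + tau k ε x * mixed k ε x y
      = (c₁ k ε x ^ 2 + imDet k ε x ^ 2) * redJ k ε x := by
  have h1 := s.quadF_eq ha hx
  have h2 := s.polarC₁_mul_tau ha hx
  rw [quadF] at h1
  apply mul_right_cancel₀ (s.polarC₁_ne ha hx)
  linear_combination h1 + mixed k ε x y / 2 * h2

end Regular

theorem polarC₁_mul_tau_right (s : IsStep k ε x y) (ha : k.a₁ ≠ 0) (hy : IsRegular k ε y) :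
    2 * polarC₁ k ε x y * tau k ε y = sigma k ε y - skew k ε y := by
  have h := s.symm.polarC₁_mul_tau ha hy.neg
  rwa [polarC₁_symm s.m₃_eq, tau_neg, sigma_neg, skew_neg] at h

section Conservation

variable (s : IsStep k ε x y) (ha : k.a₁ ≠ 0) (hx : IsRegular k ε x) (hy : IsRegular k ε y)
  (hne : y 5 ≠ x 5)
include s ha hx hy hne

theorem I₀_eq : I₀ k ε y = I₀ k ε x := by
  have h1 := s.planarWronskian_eq ha hx
  have h2 := s.symm.planarWronskian_eq ha hy.neg
  rw [planarWronskian_comm, s.m₃_eq, I₀_neg] at h2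
  apply mul_left_cancel₀ (mul_ne_zero hx.m₃_ne (sub_ne_zero.mpr hne))
  linear_combination h1 + h2

theorem redJ_eq : redJ k ε y = redJ k ε x := by
  have h1 := s.area_add_eq ha hx
  have h2 := s.symm.area_add_eq ha hy.neg
  rw [polarC₁_symm s.m₃_eq, redJ_neg] at h2
  apply mul_right_cancel₀ (mul_ne_zero (sub_ne_zero.mpr hne) (s.polarC₁_ne ha hx))
  linear_combination h1 + h2

theorem tau_sub : tau k ε y - tau k ε x = redJ k ε x * (c₁ k ε y - c₁ k ε x) := by
  have h1 := s.polarC₁_mul_tau ha hx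
  have h2 := s.polarC₁_mul_tau_right ha hy
  have h3 := s.quadH_sub
  have h4 := s.area_add_eq ha hx
  have h5 := s.I₀_eq ha hx hy hne
  have h6 := s.m₃_eq
  simp only [sigma, imDet, h5, h6] at h1 h2
  apply mul_left_cancel₀ (s.polarC₁_ne ha hx)
  simp only [c₁, skew, h6] at *
  linear_combination h2 / 2 - h1 / 2 - h3 / 2
    - ε ^ 2 * k.a₁ * (k.b₃ - k.b₁) * (x 5 + y 5) * h4

theorem invN_eq : invN k ε y = invN k ε x := by
  rw [invN, invN, s.redJ_eq ha hx hy hne]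
  linear_combination s.tau_sub ha hx hy hne

theorem ratJ₀_eq : ratJ₀ k ε y = ratJ₀ k ε x := by
  rw [ratJ₀, ratJ₀, s.redJ_eq ha hx hy hne, s.I₀_eq ha hx hy hne]

theorem polarC₃_eq : polarC₃ k ε x y = ratJ₀ k ε x * polarC₁ k ε x y := by
  have h1 := s.polarization ha
  have h2 := s.area_add_eq ha hx
  have hI := hx.I₀_mul
  have hI' := hy.I₀_mul
  rw [s.I₀_eq ha hx hy hne] at hI'
  rw [s.planarWronskian_eq ha hx] at h1
  apply mul_left_cancel₀ (mul_ne_zero hx.m₃_ne (sub_ne_zero.mpr hne))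
  simp only [c₁, c₃, polarC₁, polarC₃, ratJ₀, s.m₃_eq] at *
  linear_combination 2 * h1 + x 2 * (2 * k.a₃ / k.a₁ - 1) * h2
    - x 2 * (y 5 - x 5) / 2 * (hI + hI')

end Conservation

end IsStep

section TwoSteps

variable {k : KirchhoffParams} {ε : ℝ} {x y w : KState}

variable (s : IsStep k ε x y) (t : IsStep k ε y w)
include s t

theorem planarWronskian_two_steps (ha : k.a₁ ≠ 0) :
    ε * k.a₁ * (c₁ k ε y * planarWronskian x w - imDet k ε y * areaForm x w)
      = 2 * ε * k.a₁ * area y * imDet k ε y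
        - (w 5 - x 5) * (ε * k.a₁ * y 2) * (c₃ k ε y - (2 * k.a₃ / k.a₁ - 1)) := by
  have hx := s.m₃_eq.symm
  have hw := t.m₃_eq
  obtain ⟨s0, s1, -, s3, s4, -⟩ := s
  obtain ⟨t0, t1, -, t3, t4, -⟩ := t
  obtain ⟨a, hk⟩ : ∃ a, k.a₃ = a * k.a₁ := ⟨k.a₃ / k.a₁, by field_simp⟩
  simp only [planarWronskian, areaForm, c₁, c₃, imDet, area, hk, hx, hw, mul_div_assoc,
    mul_div_cancel_right₀ _ ha] at *
  linear_combination ε * k.a₁ * (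
      (x 3 + ε * (a * k.a₁) * y 2 * x 4 - ε * k.a₁ * y 5 * x 1) * t0
    - (-x 4 + ε * (a * k.a₁) * y 2 * x 3 - ε * k.a₁ * y 5 * x 0) * t1
    - (x 0 + ε * (a * k.a₁ - k.a₁) * y 2 * x 1 + ε * (k.b₃ - k.b₁) * y 5 * x 4) * t3
    + (-x 1 + ε * (a * k.a₁ - k.a₁) * y 2 * x 0 + ε * (k.b₃ - k.b₁) * y 5 * x 3) * t4
    - (y 0 + ε * (a * k.a₁ - k.a₁) * y 2 * y 1 + ε * (k.b₃ - k.b₁) * w 5 * y 4) * s3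
    - (y 1 - ε * (a * k.a₁ - k.a₁) * y 2 * y 0 - ε * (k.b₃ - k.b₁) * w 5 * y 3) * s4
    + (y 3 + ε * (a * k.a₁) * y 2 * y 4 - ε * k.a₁ * w 5 * y 1) * s0
    + (y 4 - ε * (a * k.a₁) * y 2 * y 3 + ε * k.a₁ * w 5 * y 0) * s1)

theorem areaForm_two_steps :
    ε * k.a₁ * (imDet k ε y * planarWronskian x w + c₁ k ε y * areaForm x w)
      = 2 * ε * k.a₁ * area y * (2 - polarC₁ k ε x w) - (w 5 - x 5) * quadH k ε y := by
  have hx := s.m₃_eq.symm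
  have hw := t.m₃_eq
  obtain ⟨s0, s1, -, s3, s4, -⟩ := s
  obtain ⟨t0, t1, -, t3, t4, -⟩ := t
  simp only [planarWronskian, areaForm, c₁, quadH, polarC₁, imDet, area, hx, hw] at *
  linear_combination ε * k.a₁ * (
      (x 3 + ε * k.a₃ * y 2 * x 4 - ε * k.a₁ * y 5 * x 1) * t1
    + (-x 4 + ε * k.a₃ * y 2 * x 3 - ε * k.a₁ * y 5 * x 0) * t0
    - (x 0 + ε * (k.a₃ - k.a₁) * y 2 * x 1 + ε * (k.b₃ - k.b₁) * y 5 * x 4) * t4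
    - (-x 1 + ε * (k.a₃ - k.a₁) * y 2 * x 0 + ε * (k.b₃ - k.b₁) * y 5 * x 3) * t3
    - (y 1 - ε * (k.a₃ - k.a₁) * y 2 * y 0 - ε * (k.b₃ - k.b₁) * w 5 * y 3) * s3
    + (y 0 + ε * (k.a₃ - k.a₁) * y 2 * y 1 + ε * (k.b₃ - k.b₁) * w 5 * y 4) * s4
    + (y 4 - ε * k.a₃ * y 2 * y 3 + ε * k.a₁ * w 5 * y 0) * s0
    - (y 3 + ε * k.a₃ * y 2 * y 4 - ε * k.a₁ * w 5 * y 1) * s1)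

variable (ha : k.a₁ ≠ 0) (hb : k.b₁ ≠ k.b₃) (hε : ε ≠ 0) (hy : IsRegular k ε y)
include ha hb hε hy

theorem IsStep.sub_mul_tau :
    (w 5 - x 5) * tau k ε y = 2 * ε * k.a₁ * area y := by
  have h1 := s.polarC₁_mul_tau_right ha hy
  have h2 := t.polarC₁_mul_tau ha hy
  have hδ : 2 * ε ^ 2 * k.a₁ * (k.b₃ - k.b₁) * y 5 ≠ 0 := by
    have := hy.p₃_ne
    have := sub_ne_zero.mpr hb.symm
    positivity
  apply mul_left_cancel₀ hδ
  simp only [polarC₁, skew, s.m₃_eq] at h1 h2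
  linear_combination h2 - h1

theorem redJ_mul_normSq_det :
    tau k ε y * (2 - polarC₁ k ε x w) - quadH k ε y + ε * k.a₁ * y 2 * I₀ k ε y * imDet k ε y
        + (1 + tau k ε y) * c₁ k ε y
      = (c₁ k ε y ^ 2 + imDet k ε y ^ 2) * redJ k ε y := by
  have hslope := s.sub_mul_tau t ha hb hε hy
  have hpol := t.polarC₁_mul_tau ha hy
  rw [← t.redJ_linear ha hy]
  simp only [polarC₁, c₁, mixed, sigma, skew, s.m₃_eq] at *
  linear_combination hpol + ε ^ 2 * k.a₁ * (k.b₃ - k.b₁) * w 5 * hslope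

theorem planarWronskian_second_order :
    planarWronskian x w = x 2 * (w 5 - x 5) * ratJ₀ k ε y := by
  have hslope := s.sub_mul_tau t ha hb hε hy
  have hJ := redJ_mul_normSq_det s t ha hb hε hy
  have hwronskian := planarWronskian_two_steps s t ha
  have harea := areaForm_two_steps s t
  have him := imDet_eq (ε := ε) ha y
  apply mul_left_cancel₀ (mul_ne_zero hε ha)
  apply mul_right_cancel₀ hy.normSq_det_ne
  rw [ratJ₀, ← s.m₃_eq]
  linear_combination c₁ k ε y * hwronskian + imDet k ε y * harea
    + (hy.I₀_mul * ε * k.a₁ * y 2 - him) * (w 5 - x 5) * c₁ k ε y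
    - (c₁ k ε y * imDet k ε y + imDet k ε y * (2 - polarC₁ k ε x w)) * hslope
    + (w 5 - x 5) * imDet k ε y * hJ
    + (c₁ k ε y ^ 2 + imDet k ε y ^ 2) * (w 5 - x 5) * redJ k ε y * him

theorem areaForm_second_order :
    ε * k.a₁ * areaForm x w = -(w 5 - x 5) * (1 + invN k ε y) := by
  have hslope := s.sub_mul_tau t ha hb hε hy
  have hJ := redJ_mul_normSq_det s t ha hb hε hy
  have hwronskian := planarWronskian_two_steps s t ha
  have harea := areaForm_two_steps s t
  have him := imDet_eq (ε := ε) ha y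
  apply mul_right_cancel₀ hy.normSq_det_ne
  rw [invN]
  linear_combination c₁ k ε y * harea - imDet k ε y * hwronskian + (w 5 - x 5) * c₁ k ε y * hJ
    - (hy.I₀_mul * ε * k.a₁ * y 2 - him) * (w 5 - x 5) * imDet k ε y
    - (c₁ k ε y * (2 - polarC₁ k ε x w) - imDet k ε y * imDet k ε y) * hslope

end TwoSteps

section HermitianForm

open scoped ComplexConjugate

/-- The hermitian form `i ε a₁ (P' M̄ - M' P̄)` on `ℂ²` in the complex coordinates
`M = m₁ + i m₂`, `P = p₁ + i p₂` of `x` and `M'`, `P'` of `y`. -/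
def hermForm (k : KirchhoffParams) (ε : ℝ) (x y : KState) : ℂ :=
  ⟨ε * k.a₁ * areaForm x y, -(ε * k.a₁ * planarWronskian x y)⟩

/-- The integral by which `hermForm` at `x` and `Φ x` is proportional to `p̃₃ - p₃`, see
`IsStep.hermForm_eq`. -/
def firstConst (k : KirchhoffParams) (ε : ℝ) (x : KState) : ℂ :=
  ⟨1, -(ε * k.a₁ * x 2 * I₀ k ε x)⟩

/-- The analogue of `firstConst` for two steps, see `hermForm_second_order`. -/
def secondConst (k : KirchhoffParams) (ε : ℝ) (x : KState) : ℂ :=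
  ⟨-(1 + invN k ε x), -(ε * k.a₁ * x 2 * ratJ₀ k ε x)⟩

/-- The analogue of `firstConst` for three steps, up to the factor `denJ₁`, see
`hermForm_third_order`. -/
def thirdConst (k : KirchhoffParams) (ε : ℝ) (x : KState) : ℂ :=
  secondConst k ε x ^ 2 * conj (firstConst k ε x) + firstConst k ε x ^ 3
    + firstConst k ε x * secondConst k ε x * (2 - 4 * redJ k ε x - 2 * invN k ε x : ℝ)

/-- The denominator of the integral `J₁`. -/
def denJ₁ (k : KirchhoffParams) (ε : ℝ) (x : KState) : ℝ :=
  Complex.normSq (secondConst k ε x) - Complex.normSq (firstConst k ε x)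

/-- The numerator of the integral `J₁`, see `thirdConst_im`. -/
def numJ₁ (k : KirchhoffParams) (ε : ℝ) (x : KState) : ℝ :=
  I₀ k ε x * (3 - (1 + invN k ε x) ^ 2)
    + (ε * k.a₁ * x 2) ^ 2 * I₀ k ε x * (ratJ₀ k ε x ^ 2 - I₀ k ε x ^ 2)
    - 2 * (1 + invN k ε x) * ratJ₀ k ε x
    + (ratJ₀ k ε x - I₀ k ε x * (1 + invN k ε x)) * (2 - 4 * redJ k ε x - 2 * invN k ε x)

/-- The integral of motion by which the planar Wronskian over three steps is proportional to
`m₃ (p̃₃ - p₃)`, see `planarWronskian_third_order`. -/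
def J₁ (k : KirchhoffParams) (ε : ℝ) (x : KState) : ℝ := numJ₁ k ε x / denJ₁ k ε x

variable {k : KirchhoffParams} {ε : ℝ} {x y w : KState}

theorem conj_hermForm (x y : KState) : conj (hermForm k ε x y) = hermForm k ε y x := by
  apply Complex.ext <;>
    simp only [hermForm, areaForm, planarWronskian, Complex.conj_re, Complex.conj_im] <;> ring

theorem hermForm_self (x : KState) : hermForm k ε x x = (2 * ε * k.a₁ * area x : ℝ) := by
  apply Complex.ext <;>
    simp only [hermForm, areaForm, planarWronskian, area, Complex.ofReal_re, Complex.ofReal_im] <;>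
    ring

/-- The hermitian form lives on `ℂ²`, so every 3 × 3 minor of its Gram matrix vanishes. -/
theorem hermForm_gram_minor (x₀ x₁ x₂ x₃ : KState) :
    hermForm k ε x₀ x₃ * (hermForm k ε x₁ x₁ * hermForm k ε x₂ x₂
        - hermForm k ε x₁ x₂ * hermForm k ε x₂ x₁)
      = hermForm k ε x₀ x₁ * (hermForm k ε x₁ x₃ * hermForm k ε x₂ x₂
          - hermForm k ε x₁ x₂ * hermForm k ε x₂ x₃)
        + hermForm k ε x₀ x₂ * (hermForm k ε x₁ x₁ * hermForm k ε x₂ x₃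
          - hermForm k ε x₁ x₃ * hermForm k ε x₂ x₁) := by
  apply Complex.ext <;>
    simp only [hermForm, areaForm, planarWronskian, Complex.mul_re, Complex.mul_im,
      Complex.sub_re, Complex.sub_im, Complex.add_re, Complex.add_im] <;> ring

theorem denJ₁_eq_invN_redJ (ha : k.a₁ ≠ 0) (x : KState) :
    denJ₁ k ε x = invN k ε x ^ 2 + 2 * invN k ε x + redJ k ε x ^ 2 * imDet k ε x ^ 2
      - 2 * (ε * k.a₁ * x 2) * imDet k ε x * I₀ k ε x * redJ k ε x := by
  simp only [denJ₁, secondConst, firstConst, Complex.normSq_mk, ratJ₀, imDet_eq ha]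
  ring

theorem thirdConst_im (x : KState) :
    (thirdConst k ε x).im = -(ε * k.a₁ * x 2 * numJ₁ k ε x) := by
  simp only [thirdConst, firstConst, secondConst, numJ₁, pow_succ, pow_zero, one_mul,
    Complex.add_im, Complex.mul_im, Complex.mul_re, Complex.conj_re, Complex.conj_im,
    Complex.ofReal_re, Complex.ofReal_im]
  ring

theorem firstConst_secondConst_relation (ha : k.a₁ ≠ 0) (x : KState) :
    firstConst k ε x ^ 2 * conj (secondConst k ε x)
        + conj (firstConst k ε x) ^ 2 * secondConst k ε x
        + firstConst k ε x * conj (firstConst k ε x)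
          * (2 - 4 * redJ k ε x - 2 * invN k ε x : ℝ)
      = (-4 * (redJ k ε x * (1 + (ε * k.a₁ * x 2 * I₀ k ε x) ^ 2
          - imDet k ε x * (ε * k.a₁ * x 2 * I₀ k ε x)) + invN k ε x) : ℝ) := by
  apply Complex.ext <;>
    simp only [firstConst, secondConst, ratJ₀, imDet_eq ha, pow_succ, pow_zero, one_mul,
      Complex.add_im, Complex.add_re, Complex.mul_im, Complex.mul_re, Complex.conj_re,
      Complex.conj_im, Complex.ofReal_re, Complex.ofReal_im] <;>
    ring

theorem IsStep.hermForm_eq (s : IsStep k ε x y) (ha : k.a₁ ≠ 0) (hx : IsRegular k ε x) :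
    hermForm k ε x y = (y 5 - x 5 : ℝ) * firstConst k ε x := by
  apply Complex.ext <;> simp only [hermForm, firstConst, Complex.re_ofReal_mul,
    Complex.im_ofReal_mul]
  · linear_combination -s.p₃_sub
  · linear_combination -(ε * k.a₁) * s.planarWronskian_eq ha hx

theorem hermForm_second_order (s : IsStep k ε x y) (t : IsStep k ε y w) (ha : k.a₁ ≠ 0)
    (hb : k.b₁ ≠ k.b₃) (hε : ε ≠ 0) (hy : IsRegular k ε y) :
    hermForm k ε x w = (w 5 - x 5 : ℝ) * secondConst k ε y := by
  apply Complex.ext <;> simp only [hermForm, secondConst, Complex.re_ofReal_mul,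
    Complex.im_ofReal_mul]
  · linear_combination areaForm_second_order s t ha hb hε hy
  · rw [s.m₃_eq]
    linear_combination -(ε * k.a₁) * planarWronskian_second_order s t ha hb hε hy

namespace IsStep

variable (s : IsStep k ε x y) (ha : k.a₁ ≠ 0) (hx : IsRegular k ε x) (hy : IsRegular k ε y)
  (hne : y 5 ≠ x 5)
include s ha hx hy hne

theorem firstConst_eq : firstConst k ε y = firstConst k ε x := by
  rw [firstConst, firstConst, s.I₀_eq ha hx hy hne, s.m₃_eq]

theorem secondConst_eq : secondConst k ε y = secondConst k ε x := by
  rw [secondConst, secondConst, s.ratJ₀_eq ha hx hy hne, s.invN_eq ha hx hy hne, s.m₃_eq]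

theorem denJ₁_eq : denJ₁ k ε y = denJ₁ k ε x := by
  rw [denJ₁, denJ₁, s.firstConst_eq ha hx hy hne, s.secondConst_eq ha hx hy hne]

theorem J₁_eq : J₁ k ε y = J₁ k ε x := by
  rw [J₁, J₁, numJ₁, numJ₁, s.denJ₁_eq ha hx hy hne, s.I₀_eq ha hx hy hne,
    s.invN_eq ha hx hy hne, s.ratJ₀_eq ha hx hy hne, s.redJ_eq ha hx hy hne, s.m₃_eq]

theorem hermForm_eq_right :
    hermForm k ε x y = (y 5 - x 5 : ℝ) * firstConst k ε y := by
  rw [s.hermForm_eq ha hx, firstConst, firstConst, s.I₀_eq ha hx hy hne, s.m₃_eq]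

theorem area_mul_tau_add :
    2 * ε * k.a₁ * area x * tau k ε y + 2 * ε * k.a₁ * area y * tau k ε x
      = (y 5 - x 5) * (tau k ε x * tau k ε y - denJ₁ k ε x) := by
  have hτ := s.tau_sub ha hx hy hne
  have harea := s.area_add_eq ha hx
  have hlin := s.redJ_linear ha hx
  rw [denJ₁_eq_invN_redJ ha, invN]
  simp only [c₁, polarC₁, mixed, s.m₃_eq] at *
  linear_combination (2 * ε * k.a₁ * area x - (y 5 - x 5) * tau k ε x) * hτ
    + 2 * tau k ε x * harea - (y 5 - x 5) * redJ k ε x * hlin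

theorem area_mul_area :
    -4 * ε ^ 4 * k.a₁ ^ 3 * (k.b₃ - k.b₁) * redJ k ε x * area x * area y
      = 2 * (redJ k ε x * polarC₁ k ε x y - 1) * (tau k ε x * tau k ε y - denJ₁ k ε x)
        - 4 * (redJ k ε x * (1 + (ε * k.a₁ * x 2 * I₀ k ε x) ^ 2
            - imDet k ε x * (ε * k.a₁ * x 2 * I₀ k ε x)) + invN k ε x) := by
  have hτ := s.tau_sub ha hx hy hne
  have harea := s.area_add_eq ha hx
  have hlin := s.redJ_linear ha hx
  have hnum := s.redJ_mul ha hx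
  have hpol := s.polarC₁_mul_tau ha hx
  rw [denJ₁_eq_invN_redJ ha, invN]
  simp only [c₁, polarC₁, mixed, sigma, numJ, skew, s.m₃_eq] at *
  linear_combination (-4 * ε ^ 3 * k.a₁ ^ 2 * (k.b₃ - k.b₁) * redJ k ε x * area x) * harea
    - 2 * (redJ k ε x * (1 - ε ^ 2 * k.a₃ * (k.a₁ - k.a₃) * x 2 ^ 2
      - ε ^ 2 * k.a₁ * (k.b₁ - k.b₃) * (x 5 * y 5)) - 1) * (tau k ε x * hτ + redJ k ε x * hlin)
    - 2 * redJ k ε x * (hnum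
      + (redJ k ε x * (1 - ε ^ 2 * k.a₃ * (k.a₁ - k.a₃) * x 2 ^ 2
      - ε ^ 2 * k.a₁ * (k.b₁ - k.b₃) * (x 5 * y 5)) - 2) * hpol)

theorem tau_add :
    tau k ε x + tau k ε y + 2 * (redJ k ε x * polarC₁ k ε x y - 1)
        + (2 - 4 * redJ k ε x - 2 * invN k ε x)
      = -(redJ k ε x * (ε ^ 2 * k.a₁ * (k.b₃ - k.b₁)) * (y 5 - x 5) ^ 2) := by
  have h := s.tau_sub ha hx hy hne
  simp only [invN, c₁, polarC₁, s.m₃_eq] at *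
  linear_combination h

theorem area_cubic :
    (2 * ε * k.a₁ * area x) ^ 2 * (2 * ε * k.a₁ * area y - (y 5 - x 5) * tau k ε y)
        + (2 * ε * k.a₁ * area y) ^ 2 * (2 * ε * k.a₁ * area x - (y 5 - x 5) * tau k ε x)
        + (y 5 - x 5) * (2 - 4 * redJ k ε x - 2 * invN k ε x)
          * (2 * ε * k.a₁ * area x * (2 * ε * k.a₁ * area y))
      = -4 * (y 5 - x 5) ^ 3 * (redJ k ε x * (1 + (ε * k.a₁ * x 2 * I₀ k ε x) ^ 2
          - imDet k ε x * (ε * k.a₁ * x 2 * I₀ k ε x)) + invN k ε x) := by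
  have hsum := s.area_mul_tau_add ha hx hy hne
  have hprod := s.area_mul_area ha hx hy hne
  have harea := s.area_add_eq ha hx
  have hτ := s.tau_add ha hx hy hne
  linear_combination
    (-(y 5 - x 5) * (2 * ε * k.a₁ * area x + 2 * ε * k.a₁ * area y)) * hsum
    + (y 5 - x 5) ^ 3 * hprod
    + 2 * (2 * ε * k.a₁ * area x * (2 * ε * k.a₁ * area y)
      - (y 5 - x 5) ^ 2 * (tau k ε x * tau k ε y - denJ₁ k ε x)) * harea
    + (y 5 - x 5) * (2 * ε * k.a₁ * area x * (2 * ε * k.a₁ * area y)) * hτ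

end IsStep

end HermitianForm

section ThreeSteps

open scoped ComplexConjugate

theorem gram_elimination {R : Type*} [CommRing R] {H θ θ' ψ ψ' κ d₁ y d₃ τ₁ τ₂ T₁ T₂ : R}
    (hT₁ : (d₁ + y) * τ₁ = T₁) (hT₂ : (y + d₃) * τ₂ = T₂)
    (link : T₁ * τ₂ + T₂ * τ₁ = y * (τ₁ * τ₂ - (ψ * ψ' - θ * θ')))
    (cubic : T₁ ^ 2 * (T₂ - y * τ₂) + T₂ ^ 2 * (T₁ - y * τ₁) + y * κ * (T₁ * T₂)
      = y ^ 3 * (θ ^ 2 * ψ' + θ' ^ 2 * ψ + θ * θ' * κ))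
    (gram : H * (T₁ * T₂ - y * θ * (y * θ'))
      = d₁ * θ * ((y + d₃) * ψ * T₂ - y * θ * (d₃ * θ))
        + (d₁ + y) * ψ * (T₁ * (d₃ * θ) - (y + d₃) * ψ * (y * θ'))) :
    H * (τ₁ * τ₂) * (T₁ * T₂ - y * θ * (y * θ'))
      = -(y * (ψ ^ 2 * θ' + θ ^ 3 + θ * ψ * κ)) * (T₁ * T₂ - y * θ * (y * θ')) := by
  subst hT₁ hT₂
  linear_combination τ₁ * τ₂ * gram + θ * ψ * cubic + y ^ 2 * θ ^ 3 * link

variable {k : KirchhoffParams} {ε : ℝ} {x₀ x₁ x₂ x₃ : KState}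

theorem sub_mul_tau_mul_tau (s₁ : IsStep k ε x₀ x₁) (s₂ : IsStep k ε x₁ x₂)
    (s₃ : IsStep k ε x₂ x₃) (ha : k.a₁ ≠ 0) (hb : k.b₁ ≠ k.b₃) (hε : ε ≠ 0)
    (h₁ : IsRegular k ε x₁) (h₂ : IsRegular k ε x₂) (hne : x₂ 5 ≠ x₁ 5) :
    (x₃ 5 - x₀ 5) * (tau k ε x₁ * tau k ε x₂) = -((x₂ 5 - x₁ 5) * denJ₁ k ε x₁) := by
  linear_combination s₂.area_mul_tau_add ha h₁ h₂ hne + tau k ε x₂ * s₁.sub_mul_tau s₂ ha hb hε h₁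
    + tau k ε x₁ * s₂.sub_mul_tau s₃ ha hb hε h₂

variable (s₁ : IsStep k ε x₀ x₁) (s₂ : IsStep k ε x₁ x₂) (s₃ : IsStep k ε x₂ x₃)
  (ha : k.a₁ ≠ 0) (hb : k.b₁ ≠ k.b₃) (hε : ε ≠ 0)
  (h₀ : IsRegular k ε x₀) (h₁ : IsRegular k ε x₁) (h₂ : IsRegular k ε x₂)
  (hne₁ : x₁ 5 ≠ x₀ 5) (hne₂ : x₂ 5 ≠ x₁ 5)
include s₁ s₂ s₃ ha hb hε h₀ h₁ h₂ hne₁ hne₂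

variable (hden : denJ₁ k ε x₁ ≠ 0)
  (hgram : hermForm k ε x₁ x₁ * hermForm k ε x₂ x₂
    - hermForm k ε x₁ x₂ * hermForm k ε x₂ x₁ ≠ 0)

include hgram in
theorem hermForm_mul_tau_mul_tau :
    hermForm k ε x₀ x₃ * (tau k ε x₁ * tau k ε x₂ : ℝ)
      = -((x₂ 5 - x₁ 5 : ℝ) * thirdConst k ε x₁) := by
  have gram := hermForm_gram_minor (k := k) (ε := ε) x₀ x₁ x₂ x₃
  have hslope₁ : ((x₁ 5 - x₀ 5 + (x₂ 5 - x₁ 5)) * tau k ε x₁ : ℂ) = 2 * ε * k.a₁ * area x₁ := by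
    rw [sub_add_sub_cancel']
    exact mod_cast s₁.sub_mul_tau s₂ ha hb hε h₁
  have hslope₂ : ((x₂ 5 - x₁ 5 + (x₃ 5 - x₂ 5)) * tau k ε x₂ : ℂ) = 2 * ε * k.a₁ * area x₂ := by
    rw [sub_add_sub_cancel']
    exact mod_cast s₂.sub_mul_tau s₃ ha hb hε h₂
  have link : (2 * ε * k.a₁ * area x₁ * tau k ε x₂ + 2 * ε * k.a₁ * area x₂ * tau k ε x₁ : ℂ)
      = (x₂ 5 - x₁ 5) * (tau k ε x₁ * tau k ε x₂ - (secondConst k ε x₁ * conj (secondConst k ε x₁)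
        - firstConst k ε x₁ * conj (firstConst k ε x₁))) := by
    simp only [Complex.mul_conj]
    exact mod_cast s₂.area_mul_tau_add ha h₁ h₂ hne₂
  have cubic := congrArg Complex.ofReal (s₂.area_cubic ha h₁ h₂ hne₂)
  have rel := firstConst_secondConst_relation (ε := ε) ha x₁
  apply mul_right_cancel₀ hgram
  rw [← conj_hermForm x₁ x₂] at gram ⊢
  rw [s₁.hermForm_eq_right ha h₀ h₁ hne₁, s₂.hermForm_eq ha h₁, s₃.hermForm_eq ha h₂,
    hermForm_second_order s₁ s₂ ha hb hε h₁, hermForm_second_order s₂ s₃ ha hb hε h₂,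
    s₂.firstConst_eq ha h₁ h₂ hne₂, s₂.secondConst_eq ha h₁ h₂ hne₂, hermForm_self,
    hermForm_self] at gram
  rw [s₂.hermForm_eq ha h₁, hermForm_self, hermForm_self]
  push_cast [map_mul, map_sub, Complex.conj_ofReal] at gram cubic rel ⊢
  rw [thirdConst]
  push_cast
  refine (gram_elimination (κ := (2 - 4 * redJ k ε x₁ - 2 * invN k ε x₁ : ℂ))
    hslope₁ hslope₂ link ?_ ?_).trans (by ring)
  · linear_combination cubic - (x₂ 5 - x₁ 5 : ℂ) ^ 3 * rel
  · linear_combination gram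

include hden hgram

theorem hermForm_third_order :
    hermForm k ε x₀ x₃ * denJ₁ k ε x₁ = (x₃ 5 - x₀ 5 : ℝ) * thirdConst k ε x₁ := by
  have hslope := sub_mul_tau_mul_tau s₁ s₂ s₃ ha hb hε h₁ h₂ hne₂
  have hτ : tau k ε x₁ * tau k ε x₂ ≠ 0 := by
    refine right_ne_zero_of_mul (a := x₃ 5 - x₀ 5) ?_
    rw [hslope]
    exact neg_ne_zero.mpr (mul_ne_zero (sub_ne_zero.mpr hne₂) hden)
  have hH := hermForm_mul_tau_mul_tau s₁ s₂ s₃ ha hb hε h₀ h₁ h₂ hne₁ hne₂ hgram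
  apply mul_right_cancel₀ (Complex.ofReal_ne_zero.mpr hτ)
  have hslope' := congrArg Complex.ofReal hslope
  push_cast at hslope' hH ⊢
  linear_combination (denJ₁ k ε x₁ : ℂ) * hH - thirdConst k ε x₁ * hslope'

theorem planarWronskian_third_order :
    planarWronskian x₀ x₃ = x₀ 2 * (x₃ 5 - x₀ 5) * J₁ k ε x₀ := by
  have h := congrArg Complex.im
    (hermForm_third_order s₁ s₂ s₃ ha hb hε h₀ h₁ h₂ hne₁ hne₂ hden hgram)
  rw [← s₁.J₁_eq ha h₀ h₁ hne₁, J₁]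
  rw [Complex.im_mul_ofReal, Complex.im_ofReal_mul, thirdConst_im, hermForm, s₁.m₃_eq] at h
  field_simp
  apply mul_left_cancel₀ (mul_ne_zero hε ha)
  linear_combination -h

end ThreeSteps

section Density

variable {R σ : Type*} [CommRing R] [IsDomain R] [TopologicalSpace R] [T1Space R]
  [∀ a : R, (𝓝[≠] a).NeBot]

theorem dense_eval_ne_zero {q : MvPolynomial σ R} (hq : q ≠ 0) :
    Dense {x : σ → R | eval x q ≠ 0} := by
  change Dense {x : σ → R | eval x q = 0}ᶜ
  rw [← interior_eq_empty_iff_dense_compl, Set.eq_empty_iff_forall_notMem]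
  intro x hx
  rw [mem_interior_iff_mem_nhds, nhds_pi, mem_pi'] at hx
  obtain ⟨I, t, ht, hI⟩ := hx
  refine hq (funext_set t (fun i => infinite_of_mem_nhds (x i) (ht i)) fun y hy => ?_)
  rw [map_zero]
  exact hI fun i _ => hy i (Set.mem_univ i)

end Density

section Generic

variable {P Q : KState → Prop}

theorem isOpen_eval_ne_zero (q : MvPolynomial (Fin 6) ℝ) : IsOpen {x : KState | eval x q ≠ 0} :=
  isOpen_ne_fun (continuous_eval q) continuous_const

theorem Generically.mono (h : Generically P) (hPQ : ∀ x, P x → Q x) : Generically Q := by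
  obtain ⟨q, hq, h⟩ := h
  exact ⟨q, hq, fun x hx => hPQ x (h x hx)⟩

theorem Generically.and (hP : Generically P) (hQ : Generically Q) :
    Generically fun x => P x ∧ Q x := by
  obtain ⟨q, hq, hP⟩ := hP
  obtain ⟨r, hr, hQ⟩ := hQ
  refine ⟨q * r, mul_ne_zero hq hr, fun x hx => ?_⟩
  rw [map_mul] at hx
  exact ⟨hP x (left_ne_zero_of_mul hx), hQ x (right_ne_zero_of_mul hx)⟩

theorem Generically.forall {ι : Type*} [Finite ι] {P : ι → KState → Prop}
    (h : ∀ i, Generically (P i)) : Generically fun x => ∀ i, P i x := by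
  cases nonempty_fintype ι
  choose q hq h using h
  refine ⟨∏ i, q i, Finset.prod_ne_zero_iff.mpr fun i _ => hq i, fun x hx i => h i x ?_⟩
  rw [map_prod] at hx
  exact Finset.prod_ne_zero_iff.mp hx i (Finset.mem_univ i)

theorem Generically.eventually (h : Generically P) : Generically fun x => ∀ᶠ y in 𝓝 x, P y := by
  obtain ⟨q, hq, h⟩ := h
  refine ⟨q, hq, fun x hx => ?_⟩
  filter_upwards [(isOpen_eval_ne_zero q).mem_nhds hx] with y hy using h y hy

theorem Generically.dense (h : Generically P) : Dense {x | P x} := by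
  obtain ⟨q, hq, h⟩ := h
  exact (dense_eval_ne_zero hq).mono h

theorem Generically.dense_forall {ι : Type*} [Countable ι] {P : ι → KState → Prop}
    (h : ∀ i, Generically (P i)) : Dense {x | ∀ i, P i x} := by
  choose q hq h using h
  refine (dense_iInter_of_isOpen (fun i => isOpen_eval_ne_zero (q i))
    fun i => dense_eval_ne_zero (hq i)).mono fun x hx i => h i x ?_
  exact Set.mem_iInter.mp hx i

theorem eq_of_dense {X Y : Type*} [TopologicalSpace X] [TopologicalSpace Y] [T2Space Y]
    {s : Set X} (hs : Dense s) {f g : X → Y} {x : X} (hf : ContinuousAt f x)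
    (hg : ContinuousAt g x) (h : ∀ y ∈ s, f y = g y) : f x = g x :=
  tendsto_nhds_unique_of_frequently_eq hf hg
    ((mem_closure_iff_frequently.mp (hs x)).mono h)

theorem Generically.eq_of_continuousAt {Y : Type*} [TopologicalSpace Y] [T2Space Y]
    {f g : KState → Y} (h : Generically fun y => f y = g y) {x : KState} (hf : ContinuousAt f x)
    (hg : ContinuousAt g x) : f x = g x :=
  eq_of_dense h.dense hf hg fun _ hy => hy

end Generic

/-- Functions on the phase space that generically coincide with a quotient of two polynomials. Their
values elsewhere are not restricted, so that they are closed under inversion (with `0⁻¹ = 0`). -/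
@[fun_prop]
def IsRational (f : KState → ℝ) : Prop :=
  ∃ N D : MvPolynomial (Fin 6) ℝ, D ≠ 0 ∧ ∀ x, eval x D ≠ 0 → f x = ratFun N D x

namespace IsRational

variable {f g : KState → ℝ}

theorem eval (N : MvPolynomial (Fin 6) ℝ) : IsRational fun x => MvPolynomial.eval x N :=
  ⟨N, 1, one_ne_zero, fun x _ => by rw [ratFun, map_one, div_one]⟩

@[fun_prop]
theorem const (c : ℝ) : IsRational fun _ => c := by
  simpa only [eval_C] using eval (C c)

@[fun_prop]
theorem coord (i : Fin 6) : IsRational fun x => x i := by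
  simpa only [eval_X] using eval (X i)

theorem congr (hf : IsRational f) (h : Generically fun x => g x = f x) : IsRational g := by
  obtain ⟨N, D, hD, hf⟩ := hf
  obtain ⟨q, hq, h⟩ := h
  refine ⟨N * q, D * q, mul_ne_zero hD hq, fun x hx => ?_⟩
  rw [map_mul] at hx
  rw [h x (right_ne_zero_of_mul hx), hf x (left_ne_zero_of_mul hx), ratFun, ratFun, map_mul,
    map_mul, mul_div_mul_right _ _ (right_ne_zero_of_mul hx)]

@[fun_prop]
theorem add (hf : IsRational f) (hg : IsRational g) : IsRational fun x => f x + g x := by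
  obtain ⟨N, D, hD, h⟩ := hf
  obtain ⟨N', D', hD', h'⟩ := hg
  refine ⟨N * D' + D * N', D * D', mul_ne_zero hD hD', fun x hx => ?_⟩
  rw [map_mul] at hx
  beta_reduce
  rw [h x (left_ne_zero_of_mul hx), h' x (right_ne_zero_of_mul hx), ratFun, ratFun,
    div_add_div _ _ (left_ne_zero_of_mul hx) (right_ne_zero_of_mul hx)]
  simp only [ratFun, map_add, map_mul]

@[fun_prop]
theorem mul (hf : IsRational f) (hg : IsRational g) : IsRational fun x => f x * g x := by
  obtain ⟨N, D, hD, h⟩ := hf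
  obtain ⟨N', D', hD', h'⟩ := hg
  refine ⟨N * N', D * D', mul_ne_zero hD hD', fun x hx => ?_⟩
  rw [map_mul] at hx
  beta_reduce
  rw [h x (left_ne_zero_of_mul hx), h' x (right_ne_zero_of_mul hx), ratFun, ratFun,
    div_mul_div_comm]
  simp only [ratFun, map_mul]

@[fun_prop]
theorem neg (hf : IsRational f) : IsRational fun x => -f x := by
  simpa only [neg_one_mul] using (const (-1)).mul hf

@[fun_prop]
theorem sub (hf : IsRational f) (hg : IsRational g) : IsRational fun x => f x - g x := by
  simpa only [sub_eq_add_neg] using hf.add hg.neg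

theorem generically_eq_zero_or_generically_ne_zero (hf : IsRational f) :
    (Generically fun x => f x = 0) ∨ Generically fun x => f x ≠ 0 := by
  obtain ⟨N, D, hD, h⟩ := hf
  rcases eq_or_ne N 0 with rfl | hN
  · exact Or.inl ⟨D, hD, fun y hy => (h y hy).trans (by rw [ratFun, map_zero, zero_div])⟩
  · refine Or.inr ⟨N * D, mul_ne_zero hN hD, fun y hy => ?_⟩
    rw [map_mul] at hy
    rw [h y (right_ne_zero_of_mul hy)]
    exact div_ne_zero (left_ne_zero_of_mul hy) (right_ne_zero_of_mul hy)

theorem generically_ne_zero (hf : IsRational f) {x : KState} (hc : ContinuousAt f x)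
    (hx : f x ≠ 0) : Generically fun x => f x ≠ 0 :=
  hf.generically_eq_zero_or_generically_ne_zero.resolve_left fun h =>
    hx (h.eq_of_continuousAt hc continuousAt_const)

@[fun_prop]
theorem inv (hf : IsRational f) : IsRational fun x => (f x)⁻¹ := by
  rcases hf.generically_eq_zero_or_generically_ne_zero with h0 | h0
  · exact (const 0).congr (h0.mono fun x hx => by rw [hx, inv_zero])
  · obtain ⟨N, D, hD, h⟩ := hf
    obtain ⟨x, hx, hxD⟩ := (h0.and ⟨D, hD, fun _ hx => hx⟩).dense.nonempty
    have hN : N ≠ 0 := by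
      rintro rfl
      exact hx (by rw [h x hxD, ratFun, map_zero, zero_div])
    exact congr ⟨D, N, hN, fun _ _ => rfl⟩
      (Generically.mono ⟨D, hD, h⟩ fun y hy => by rw [hy, ratFun, inv_div, ratFun])

@[fun_prop]
theorem div (hf : IsRational f) (hg : IsRational g) : IsRational fun x => f x / g x := by
  simpa only [div_eq_mul_inv] using hf.mul hg.inv

@[fun_prop]
theorem pow (hf : IsRational f) (n : ℕ) : IsRational fun x => f x ^ n := by
  induction n with
  | zero => simpa only [pow_zero] using const 1
  | succ n ih => simpa only [pow_succ] using ih.mul hf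

theorem sum {ι : Type*} (s : Finset ι) {f : ι → KState → ℝ} (h : ∀ i, IsRational (f i)) :
    IsRational fun x => ∑ i ∈ s, f i x := by
  classical
  induction s using Finset.induction_on with
  | empty => simpa only [Finset.sum_empty] using const 0
  | insert a s ha ih => simpa only [Finset.sum_insert ha] using (h a).add ih

theorem prod {ι : Type*} (s : Finset ι) {f : ι → KState → ℝ} (h : ∀ i, IsRational (f i)) :
    IsRational fun x => ∏ i ∈ s, f i x := by
  classical
  induction s using Finset.induction_on with
  | empty => simpa only [Finset.prod_empty] using const 1
  | insert a s ha ih => simpa only [Finset.prod_insert ha] using (h a).mul ih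

theorem det {n : Type*} [Fintype n] [DecidableEq n] {A : KState → Matrix n n ℝ}
    (h : ∀ i j, IsRational fun x => A x i j) : IsRational fun x => (A x).det := by
  simp only [Matrix.det_apply']
  exact sum _ fun σ => (const _).mul (prod _ fun i => h _ _)

theorem eval_comp {Φ : KState → KState} (hΦ : ∀ i, IsRational fun x => Φ x i)
    (N : MvPolynomial (Fin 6) ℝ) : IsRational fun x => MvPolynomial.eval (Φ x) N := by
  induction N using MvPolynomial.induction_on with
  | C a => simpa only [eval_C] using const a
  | add p q hp hq => simpa only [map_add] using hp.add hq
  | mul_X p i hp => simpa only [map_mul, eval_X] using hp.mul (hΦ i)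

theorem comp (hf : IsRational f) {Φ : KState → KState} (hΦ : ∀ i, IsRational fun x => Φ x i)
    (hgen : ∀ P : KState → Prop, Generically P → Generically fun x => P (Φ x)) :
    IsRational fun x => f (Φ x) := by
  obtain ⟨N, D, hD, h⟩ := hf
  exact ((eval_comp hΦ N).div (eval_comp hΦ D)).congr (hgen _ ⟨D, hD, h⟩)

end IsRational

section Derivative

theorem differentiable_eval {𝕜 σ : Type*} [NontriviallyNormedField 𝕜] [Finite σ]
    (N : MvPolynomial σ 𝕜) : Differentiable 𝕜 fun x : σ → 𝕜 => eval x N := by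
  cases nonempty_fintype σ
  induction N using MvPolynomial.induction_on with
  | C a => simp only [eval_C, differentiable_const]
  | add p q hp hq => simp only [map_add]; exact hp.add hq
  | mul_X p i hp => simp only [map_mul, eval_X]; exact hp.mul (differentiable_apply i)

theorem fderiv_eval {𝕜 σ : Type*} [NontriviallyNormedField 𝕜] [Fintype σ]
    (N : MvPolynomial σ 𝕜) (x v : σ → 𝕜) :
    fderiv 𝕜 (fun y => eval y N) x v = ∑ i, eval x (pderiv i N) * v i := by
  classical
  induction N using MvPolynomial.induction_on with
  | C a => simp
  | add p q hp hq =>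
    simp only [map_add, add_mul, Finset.sum_add_distrib, ← hp, ← hq]
    rw [fderiv_fun_add (differentiable_eval p x) (differentiable_eval q x)]
    rfl
  | mul_X p i hp =>
    have hproj : fderiv 𝕜 (fun y : σ → 𝕜 => y i) x v = v i := by
      rw [(hasFDerivAt_apply i x).fderiv]; rfl
    simp only [map_mul, eval_X]
    rw [fderiv_fun_mul (differentiable_eval p x) (differentiable_apply i x)]
    simp [hproj, hp, Derivation.leibniz, pderiv_X, Pi.single_apply, add_mul,
      Finset.sum_add_distrib, Finset.mul_sum, mul_assoc, apply_ite]

variable {f : KState → ℝ}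

theorem hasFDerivAt_ratFun (N D : MvPolynomial (Fin 6) ℝ) {x : KState} (hx : eval x D ≠ 0) :
    HasFDerivAt (ratFun N D)
      (eval x N • (-(eval x D ^ 2)⁻¹ • fderiv ℝ (fun y : KState => eval y D) x)
        + (eval x D)⁻¹ • fderiv ℝ (fun y : KState => eval y N) x) x := by
  unfold ratFun
  simp only [div_eq_mul_inv]
  exact (differentiable_eval N x).hasFDerivAt.mul
    ((hasDerivAt_inv hx).comp_hasFDerivAt x (differentiable_eval D x).hasFDerivAt)

theorem IsRational.exists_eventuallyEq (hf : IsRational f) :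
    ∃ N D : MvPolynomial (Fin 6) ℝ, D ≠ 0 ∧
      ∀ x, MvPolynomial.eval x D ≠ 0 → f =ᶠ[𝓝 x] ratFun N D := by
  obtain ⟨N, D, hD, h⟩ := hf
  refine ⟨N, D, hD, fun x hx => ?_⟩
  filter_upwards [(isOpen_eval_ne_zero D).mem_nhds hx] with y hy using h y hy

theorem IsRational.generically_differentiableAt (hf : IsRational f) :
    Generically fun x => DifferentiableAt ℝ f x := by
  obtain ⟨N, D, hD, h⟩ := hf.exists_eventuallyEq
  exact ⟨D, hD, fun x hx =>
    (hasFDerivAt_ratFun N D hx).differentiableAt.congr_of_eventuallyEq (h x hx)⟩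

theorem IsRational.fderiv (hf : IsRational f) (v : KState) :
    IsRational fun x => fderiv ℝ f x v := by
  obtain ⟨N, D, hD, h⟩ := hf.exists_eventuallyEq
  have rat (q : MvPolynomial (Fin 6) ℝ) :
      IsRational fun x => _root_.fderiv ℝ (fun y : KState => MvPolynomial.eval y q) x v := by
    simp only [fderiv_eval]
    exact sum _ fun i => (eval _).mul (const _)
  refine congr (((eval N).mul ((((eval D).pow 2).inv.neg).mul (rat D))).add
    ((eval D).inv.mul (rat N))) ⟨D, hD, fun x hx => ?_⟩
  beta_reduce
  rw [(h x hx).fderiv_eq, (hasFDerivAt_ratFun N D hx).fderiv]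
  rfl

end Derivative

section Independence

theorem linearIndependent_proj_comp_iff_surjective {K E ι : Type*} [Field K] [AddCommGroup E]
    [Module K E] [Finite ι] (L : E →ₗ[K] ι → K) :
    LinearIndependent K (fun i => LinearMap.proj i ∘ₗ L) ↔ Function.Surjective L := by
  classical
  cases nonempty_fintype ι
  rw [Fintype.linearIndependent_iff]
  constructor
  · intro h
    by_contra hL
    obtain ⟨f, hf, hle⟩ := Submodule.exists_le_ker_of_lt_top (LinearMap.range L)
      (lt_top_iff_ne_top.mpr fun e => hL (LinearMap.range_eq_top.mp e))
    refine hf (LinearMap.pi_ext' fun i => LinearMap.ext_ring ?_)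
    have := h (fun i => f (Pi.single i 1)) (LinearMap.ext fun v => ?_) i
    · simpa using this
    · have hv : f (L v) = 0 := hle (LinearMap.mem_range_self L v)
      rw [pi_eq_sum_univ' (L v), map_sum] at hv
      simpa [mul_comm, LinearMap.sum_apply] using hv
  · intro hL c hc i
    obtain ⟨v, hv⟩ := hL (Pi.single i 1)
    simpa [hv, LinearMap.sum_apply, Pi.single_apply] using LinearMap.congr_fun hc v

variable {n : ℕ} {F : Fin n → KState → ℝ}

theorem linearIndependent_fderiv_iff_surjective {x : KState}
    (hF : ∀ i, DifferentiableAt ℝ (F i) x) :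
    LinearIndependent ℝ (fun i => fderiv ℝ (F i) x) ↔
      Function.Surjective (fderiv ℝ (fun y i => F i y) x) := by
  rw [← ContinuousLinearMap.coe_coe, ← linearIndependent_proj_comp_iff_surjective,
    ← LinearMap.linearIndependent_iff_of_injOn (ContinuousLinearMap.coeLM ℝ)
      (ContinuousLinearMap.coe_injective.injOn), fderiv_pi hF]
  rfl

/-- If the differentials of rational functions are independent at one point where the functions are
continuously differentiable, then some minor of their Jacobi matrix does not vanish there, hence
generically. -/
theorem functionallyIndependent_of_linearIndependent (hF : ∀ i, IsRational (F i)) {x : KState}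
    (hx : ∀ i, ContDiffAt ℝ 1 (F i) x) (h : LinearIndependent ℝ fun i => fderiv ℝ (F i) x) :
    FunctionallyIndependent F := by
  rw [linearIndependent_fderiv_iff_surjective fun i => (hx i).differentiableAt one_ne_zero] at h
  choose V hV using fun j : Fin n => h (Pi.single j 1)
  let jac (y : KState) : Matrix (Fin n) (Fin n) ℝ := .of fun i j => fderiv ℝ (F i) y (V j)
  have hjac : jac x = 1 := by
    ext i j
    have := congrFun (hV j) i
    rw [fderiv_pi fun i => (hx i).differentiableAt one_ne_zero] at this
    exact this.trans (by simp [Matrix.one_apply, Pi.single_apply])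
  have hcont : ContinuousAt (fun y => (jac y).det) x := by
    refine ContinuousAt.comp (g := Matrix.det) (continuous_id.matrix_det.continuousAt) ?_
    refine continuousAt_pi.mpr fun i => continuousAt_pi.mpr fun j => ?_
    exact ((hx i).fderiv_right (m := 0) (by simp)).continuousAt.clm_apply continuousAt_const
  have hdet : Generically fun y => (jac y).det ≠ 0 :=
    IsRational.generically_ne_zero (IsRational.det fun i j => (hF i).fderiv (V j)) hcont
      (by rw [hjac, Matrix.det_one]; exact one_ne_zero)
  refine ((Generically.forall fun i => (hF i).generically_differentiableAt).and hdet).mono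
    fun y hy => ⟨hy.1, ?_⟩
  have hrows := Matrix.linearIndependent_rows_of_det_ne_zero hy.2
  refine LinearIndependent.of_comp (LinearMap.pi fun j =>
    (ContinuousLinearMap.apply ℝ ℝ (V j)).toLinearMap) hrows

theorem FunctionallyIndependent.comp (hF : FunctionallyIndependent F) {G : Fin n → KState → ℝ}
    (h : Generically fun x => ∃ (g : (Fin n → ℝ) → Fin n → ℝ)
      (g' : (Fin n → ℝ) →L[ℝ] Fin n → ℝ), HasFDerivAt g g' (fun i => F i x) ∧
        Function.Surjective g' ∧ (fun y i => G i y) =ᶠ[𝓝 x] fun y => g fun i => F i y) :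
    FunctionallyIndependent G := by
  refine (Generically.and hF h).mono ?_
  rintro x ⟨⟨hd, hli⟩, g, g', hg, hsurj, heq⟩
  rw [linearIndependent_fderiv_iff_surjective hd] at hli
  have hG : HasFDerivAt (fun y i => G i y) (g' ∘L fderiv ℝ (fun y i => F i y) x) x :=
    (hg.comp x (differentiableAt_pi.mpr hd).hasFDerivAt).congr_of_eventuallyEq heq
  have hG' := differentiableAt_pi.mp hG.differentiableAt
  refine ⟨hG', (linearIndependent_fderiv_iff_surjective hG').mpr ?_⟩
  rw [hG.fderiv]
  exact hsurj.comp hli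

end Independence

section KahanMap

variable {k : KirchhoffParams} {ε : ℝ}

theorem continuous_field : Continuous (field k) := by
  refine continuous_pi fun i => ?_
  fin_cases i <;> dsimp [field] <;> fun_prop

theorem continuous_one_sub_smul_jacobian : Continuous fun x => 1 - ε • jacobian k x := by
  refine continuous_matrix fun i j => continuous_const.sub (continuous_const.mul ?_)
  fin_cases i <;> fin_cases j <;>
    simp only [jacobian, Matrix.of_apply, Matrix.cons_val, Fin.isValue, Fin.zero_eta, Fin.mk_one,
      Fin.reduceFinMk] <;> fun_prop

theorem continuous_delta : Continuous (delta k ε) :=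
  continuous_one_sub_smul_jacobian.matrix_det

theorem continuousAt_kahanMap {x : KState} (h : delta k ε x ≠ 0) :
    ContinuousAt (kahanMap k ε) x := by
  unfold kahanMap
  simp only [Matrix.inv_def, Ring.inverse_eq_inv', Matrix.smul_mulVec]
  have hinv : ContinuousAt (fun y => (delta k ε y)⁻¹) x := continuous_delta.continuousAt.inv₀ h
  have hadj : Continuous fun y => (1 - ε • jacobian k y).adjugate.mulVec (field k y) :=
    continuous_one_sub_smul_jacobian.matrix_adjugate.matrix_mulVec continuous_field
  exact continuousAt_id.add ((hinv.smul hadj.continuousAt).const_smul (2 * ε))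

theorem isRational_field (i : Fin 6) : IsRational fun x => field k x i := by
  fin_cases i <;> dsimp [field] <;> fun_prop

theorem isRational_one_sub_smul_jacobian (i j : Fin 6) :
    IsRational fun x => (1 - ε • jacobian k x) i j := by
  refine (IsRational.const _).sub ((IsRational.const ε).mul ?_)
  fin_cases i <;> fin_cases j <;>
    simp only [jacobian, Matrix.of_apply, Matrix.cons_val, Fin.isValue, Fin.zero_eta, Fin.mk_one,
      Fin.reduceFinMk] <;> fun_prop

theorem isRational_delta : IsRational (delta k ε) :=
  IsRational.det isRational_one_sub_smul_jacobian

@[fun_prop]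
theorem isRational_kahanMap (i : Fin 6) : IsRational fun x => kahanMap k ε x i := by
  simp only [kahanMap, Pi.add_apply, Pi.smul_apply, smul_eq_mul, Matrix.inv_def,
    Ring.inverse_eq_inv', Matrix.mulVec, dotProduct, Matrix.smul_apply, Matrix.adjugate_apply]
  refine (IsRational.coord i).add ((IsRational.const _).mul (IsRational.sum _ fun j =>
    (isRational_delta.inv.mul (IsRational.det fun l m => ?_)).mul (isRational_field j)))
  rcases eq_or_ne l j with rfl | h
  · simpa only [Matrix.updateRow_self] using IsRational.const _
  · simpa only [Matrix.updateRow_ne h] using isRational_one_sub_smul_jacobian l m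

@[simp]
theorem kahanMap_zero : kahanMap k ε 0 = 0 := by
  have hfield : field k 0 = 0 := by
    funext i
    fin_cases i <;> simp [field]
  rw [kahanMap, hfield, Matrix.mulVec_zero, smul_zero, add_zero]

@[simp]
theorem delta_zero : delta k ε 0 = 1 := by
  have hjac : jacobian k 0 = 0 := by
    ext i j
    fin_cases i <;> fin_cases j <;> simp [jacobian]
  rw [delta, hjac, smul_zero, sub_zero, Matrix.det_one]

theorem isStep_kahanMap {x : KState} (h : delta k ε x ≠ 0) : IsStep k ε x (kahanMap k ε x) :=
  (isStep_iff k ε x _ h).mpr rfl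

theorem kahanMap_neg_kahanMap {x : KState} (h : delta k ε x ≠ 0)
    (h' : delta k (-ε) (kahanMap k ε x) ≠ 0) : kahanMap k (-ε) (kahanMap k ε x) = x :=
  ((isStep_iff k (-ε) _ x h').mp (isStep_kahanMap h).symm).symm

theorem kahanMap_kahanMap_neg {x : KState} (h : delta k (-ε) x ≠ 0)
    (h' : delta k ε (kahanMap k (-ε) x) ≠ 0) : kahanMap k ε (kahanMap k (-ε) x) = x := by
  simpa only [neg_neg] using kahanMap_neg_kahanMap h (by rwa [neg_neg])

theorem kahanMap_apply_two {x : KState} (h : delta k ε x ≠ 0) : kahanMap k ε x 2 = x 2 :=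
  (isStep_kahanMap h).m₃_eq

theorem generically_delta_ne_zero : Generically fun x => delta k ε x ≠ 0 :=
  isRational_delta.generically_ne_zero continuous_delta.continuousAt (x := 0)
    (by rw [delta_zero]; exact one_ne_zero)

theorem eventually_delta_ne_zero (ε' : ℝ) :
    ∀ᶠ y in 𝓝 (0 : KState), delta k ε y ≠ 0 ∧ delta k ε' (kahanMap k ε y) ≠ 0 := by
  have hδ : delta k ε 0 ≠ 0 := by rw [delta_zero]; exact one_ne_zero
  have hδ' : delta k ε' (kahanMap k ε 0) ≠ 0 := by
    rw [kahanMap_zero, delta_zero]; exact one_ne_zero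
  exact (continuous_delta.continuousAt.eventually_ne hδ).and
    ((continuous_delta.continuousAt.comp (continuousAt_kahanMap hδ)).eventually_ne hδ')

theorem Generically.comp_kahanMap {P : KState → Prop} (h : Generically P) :
    Generically fun x => P (kahanMap k ε x) := by
  obtain ⟨q, hq, h⟩ := h
  obtain ⟨y, hqy, hy, hy'⟩ :=
    ((mem_closure_iff_frequently.mp (dense_eval_ne_zero hq 0)).and_eventually
      (eventually_delta_ne_zero (k := k) (ε := -ε) ε)).exists
  have hne : Generically fun x => eval (kahanMap k ε x) q ≠ 0 := by
    refine IsRational.generically_ne_zero (x := kahanMap k (-ε) y)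
      (IsRational.eval_comp isRational_kahanMap q) ?_ ?_
    · exact (MvPolynomial.continuous_eval q).continuousAt.comp (continuousAt_kahanMap hy')
    · rwa [kahanMap_kahanMap_neg hy hy']
  exact hne.mono fun x hx => h _ hx

theorem Generically.comp_iterate_kahanMap {P : KState → Prop} (h : Generically P) (n : ℕ) :
    Generically fun x => P ((kahanMap k ε)^[n] x) := by
  induction n with
  | zero => exact h
  | succ n ih => simpa only [Function.iterate_succ_apply] using ih.comp_kahanMap (k := k) (ε := ε)

theorem IsRational.comp_kahanMap {f : KState → ℝ} (hf : IsRational f) :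
    IsRational fun x => f (kahanMap k ε x) :=
  hf.comp isRational_kahanMap fun _ h => h.comp_kahanMap

theorem continuousAt_iterate_kahanMap {x : KState} {n : ℕ}
    (h : ∀ i < n, delta k ε ((kahanMap k ε)^[i] x) ≠ 0) :
    ContinuousAt ((kahanMap k ε)^[n]) x := by
  induction n with
  | zero => exact continuousAt_id
  | succ n ih =>
    rw [Function.iterate_succ']
    exact (continuousAt_kahanMap (h n n.lt_succ_self)).comp
      (ih fun i hi => h i (hi.trans n.lt_succ_self))

end KahanMap

section Orbits

variable {k : KirchhoffParams} {ε : ℝ} {x : KState}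

theorem iter_ofNat (n : ℕ) : iter k ε (Int.ofNat n) = (kahanMap k ε)^[n] := by rw [iter]

theorem iter_natCast (n : ℕ) : iter k ε n = (kahanMap k ε)^[n] := iter_ofNat n

theorem iter_negSucc (n : ℕ) : iter k ε (Int.negSucc n) = (kahanMap k (-ε))^[n + 1] := by
  rw [iter]

@[simp]
theorem iter_zero : iter k ε 0 x = x := congrFun (iter_natCast 0) x

theorem iter_neg_natCast (n : ℕ) : iter k ε (-n) = (kahanMap k (-ε))^[n] := by
  cases n with
  | zero => rw [Nat.cast_zero, neg_zero, Function.iterate_zero]; exact funext fun _ => iter_zero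
  | succ n => rw [← iter_negSucc, Int.negSucc_eq, Nat.cast_succ]

theorem iter_add_one (hx : x ∈ orbitDomain k ε) (i : ℤ) :
    iter k ε (i + 1) x = kahanMap k ε (iter k ε i x) := by
  obtain ⟨n, rfl | rfl⟩ := i.eq_nat_or_neg
  · rw [← Nat.cast_succ, iter_natCast, iter_natCast, Function.iterate_succ_apply']
  cases n with
  | zero => rw [Nat.cast_zero, neg_zero, zero_add, iter_zero]; rfl
  | succ n =>
    have hstep : iter k ε (-(n + 1 : ℕ)) x = kahanMap k (-ε) (iter k ε (-n) x) := by
      rw [iter_neg_natCast, iter_neg_natCast, Function.iterate_succ_apply']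
    rw [hstep, kahanMap_kahanMap_neg (hx _).2 (hstep ▸ (hx _).1), Nat.cast_succ, neg_add,
      neg_add_cancel_right]

theorem iter_add_natCast (hx : x ∈ orbitDomain k ε) (i : ℤ) (n : ℕ) :
    iter k ε (i + n) x = (kahanMap k ε)^[n] (iter k ε i x) := by
  induction n with
  | zero => rw [Nat.cast_zero, add_zero, Function.iterate_zero_apply]
  | succ n ih =>
    rw [Function.iterate_succ_apply', ← ih, ← iter_add_one hx, Nat.cast_succ, add_assoc]

theorem delta_iterate_ne_zero (hx : x ∈ orbitDomain k ε) (i : ℤ) (n : ℕ) :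
    delta k ε ((kahanMap k ε)^[n] (iter k ε i x)) ≠ 0 := by
  rw [← iter_add_natCast hx]
  exact (hx _).1

theorem continuousAt_iter (hx : x ∈ orbitDomain k ε) (i : ℤ) : ContinuousAt (iter k ε i) x := by
  obtain ⟨n, rfl | rfl⟩ := i.eq_nat_or_neg
  · rw [iter_natCast]
    exact continuousAt_iterate_kahanMap fun i _ => iter_natCast (k := k) (ε := ε) i ▸ (hx i).1
  · rw [iter_neg_natCast]
    exact continuousAt_iterate_kahanMap fun i _ =>
      iter_neg_natCast (k := k) (ε := ε) i ▸ (hx (-i)).2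

theorem Generically.comp_iter {P : KState → Prop} (h : Generically P) (i : ℤ) :
    Generically fun x => P (iter k ε i x) := by
  obtain ⟨n, rfl | rfl⟩ := i.eq_nat_or_neg
  · rw [iter_natCast]
    exact h.comp_iterate_kahanMap n
  · rw [iter_neg_natCast]
    exact h.comp_iterate_kahanMap n

theorem dense_orbitDomain : Dense (orbitDomain k ε) :=
  Generically.dense_forall fun i =>
    (generically_delta_ne_zero.and generically_delta_ne_zero).comp_iter i

theorem dense_orbitDomain_inter {P : KState → Prop} (h : Generically P) :
    Dense {x | x ∈ orbitDomain k ε ∧ ∀ i, P (iter k ε i x)} := by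
  have hgen (i : ℤ) : Generically fun x =>
      (delta k ε (iter k ε i x) ≠ 0 ∧ delta k (-ε) (iter k ε i x) ≠ 0) ∧ P (iter k ε i x) :=
    ((generically_delta_ne_zero.and generically_delta_ne_zero).and h).comp_iter i
  exact (Generically.dense_forall hgen).mono fun x hx => ⟨fun i => (hx i).1, fun i => (hx i).2⟩

end Orbits

section Slice

variable {k : KirchhoffParams} {ε : ℝ} {x y : KState}

theorem IsStep.eq_of_slice (s : IsStep k ε x y) (h₂ : x 2 = 0) (h₅ : x 5 = 0) :
    y = ![x 0 + ε * (k.b₃ - k.b₁) * x 4 * y 5, x 1 - ε * (k.b₃ - k.b₁) * x 3 * y 5, 0,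
      x 3 - ε * k.a₁ * x 1 * y 5, x 4 + ε * k.a₁ * x 0 * y 5, y 5] := by
  have hy₂ : y 2 = 0 := s.m₃_eq.trans h₂
  obtain ⟨h0, h1, -, h3, h4, -⟩ := s
  rw [h₂, h₅, hy₂] at h0 h1 h3 h4
  funext i
  fin_cases i <;>
    simp only [Fin.zero_eta, Fin.mk_one, Fin.reduceFinMk, Matrix.cons_val, Fin.isValue, hy₂] <;>
    linarith

theorem IsStep.p₃_of_slice (s : IsStep k ε x y) (h₂ : x 2 = 0) (h₅ : x 5 = 0) :
    y 5 * (1 + quadH k ε x) = 2 * ε * k.a₁ * area x := by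
  have hy₂ : y 2 = 0 := s.m₃_eq.trans h₂
  obtain ⟨h0, h1, -, h3, h4, h5⟩ := s
  simp only [h₂, h₅, hy₂, quadH, area] at *
  linear_combination h5 + ε * k.a₁ * (x 3 * h1 + x 1 * h3 - x 4 * h0 - x 0 * h4)

theorem jacobian_mulVec (x v : KState) :
    (jacobian k x).mulVec v =
      ![(k.a₃ - k.a₁) * (x 2 * v 1 + x 1 * v 2) + (k.b₃ - k.b₁) * (x 5 * v 4 + x 4 * v 5),
        (k.a₁ - k.a₃) * (x 2 * v 0 + x 0 * v 2) + (k.b₁ - k.b₃) * (x 5 * v 3 + x 3 * v 5),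
        0,
        k.a₃ * (x 4 * v 2 + x 2 * v 4) - k.a₁ * (x 5 * v 1 + x 1 * v 5),
        k.a₁ * (x 5 * v 0 + x 0 * v 5) - k.a₃ * (x 3 * v 2 + x 2 * v 3),
        k.a₁ * (x 3 * v 1 + x 1 * v 3 - x 4 * v 0 - x 0 * v 4)] := by
  funext i
  fin_cases i <;>
    simp only [jacobian, Matrix.mulVec, dotProduct, Fin.sum_univ_six, Matrix.of_apply,
      Matrix.cons_val, Fin.isValue, Fin.zero_eta, Fin.mk_one, Fin.reduceFinMk] <;>
    ring

theorem delta_ne_zero_of_slice (h₂ : x 2 = 0) (h₅ : x 5 = 0) (hH : 1 + quadH k ε x ≠ 0) :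
    delta k ε x ≠ 0 := by
  intro hdet
  obtain ⟨v, hv, hv0⟩ := Matrix.exists_mulVec_eq_zero_iff.mpr hdet
  rw [Matrix.sub_mulVec, Matrix.one_mulVec, Matrix.smul_mulVec, sub_eq_zero, jacobian_mulVec,
    h₂, h₅] at hv0
  have e0 : v 0 = ε * _ := congrFun hv0 0
  have e1 : v 1 = ε * _ := congrFun hv0 1
  have e2 : v 2 = ε * 0 := congrFun hv0 2
  have e3 : v 3 = ε * _ := congrFun hv0 3
  have e4 : v 4 = ε * _ := congrFun hv0 4
  have e5 : v 5 = ε * _ := congrFun hv0 5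
  rw [mul_zero] at e2
  simp only [e2, Matrix.cons_val, zero_mul, mul_zero, zero_add, add_zero, zero_sub, sub_zero]
    at e0 e1 e3 e4 e5
  have h5 : v 5 = 0 := by
    refine (mul_eq_zero.mp ?_).resolve_right hH
    rw [quadH]
    linear_combination e5 + ε * k.a₁ * (x 3 * e1 + x 1 * e3 - x 4 * e0 - x 0 * e4)
  rw [h5, mul_zero, mul_zero, mul_zero] at e0 e1
  rw [h5, mul_zero, mul_zero, neg_zero, mul_zero] at e3
  rw [h5, mul_zero, mul_zero, mul_zero] at e4
  refine hv (funext fun i => ?_)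
  fin_cases i
  exacts [e0, e1, e2, e3, e4, h5]

/-- The (real) determinant of the Gram matrix of `x` and `y` for the hermitian form. -/
def gramDet (k : KirchhoffParams) (ε : ℝ) (x y : KState) : ℝ :=
  (ε * k.a₁) ^ 2 * (4 * area x * area y - areaForm x y ^ 2 - planarWronskian x y ^ 2)

theorem hermForm_mul_sub_mul (x y : KState) :
    hermForm k ε x x * hermForm k ε y y - hermForm k ε x y * hermForm k ε y x
      = (gramDet k ε x y : ℂ) := by
  rw [← conj_hermForm x y, Complex.mul_conj, hermForm_self, hermForm_self, hermForm,
    Complex.normSq_mk, gramDet]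
  push_cast
  ring

theorem IsStep.gramDet_of_slice (s : IsStep k ε x y) (h₂ : x 2 = 0) (h₅ : x 5 = 0) :
    gramDet k ε x y = y 5 ^ 2 *
      (4 * ε ^ 4 * k.a₁ ^ 3 * (k.b₃ - k.b₁) * area x ^ 2 - quadH k ε x ^ 2) := by
  have hp := s.p₃_of_slice h₂ h₅
  have hz := s.p₃_sub
  have hy := s.eq_of_slice h₂ h₅
  have hω : planarWronskian x y = 0 := by
    rw [hy]; simp only [planarWronskian, Matrix.cons_val]; ring
  have hA : ε * k.a₁ * area y = ε * k.a₁ * area x * (1 + ε ^ 2 * k.a₁ * (k.b₃ - k.b₁) * y 5 ^ 2)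
      - y 5 * quadH k ε x := by
    rw [hy]; simp only [area, quadH, Matrix.cons_val]; ring
  rw [h₅, sub_zero] at hz
  rw [gramDet, hω]
  linear_combination 4 * (ε * k.a₁ * area x) * hA + (y 5 + ε * k.a₁ * areaForm x y) * hz
    - (2 * (ε * k.a₁ * area x) - y 5 * quadH k ε x + y 5) * hp

theorem c₁_of_slice (h₂ : x 2 = 0) (h₅ : x 5 = 0) : c₁ k ε x = 1 := by
  rw [c₁, h₂, h₅]; ring

theorem I₀_of_slice (h₂ : x 2 = 0) (h₅ : x 5 = 0) : I₀ k ε x = c₃ k ε x := by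
  rw [I₀, c₁_of_slice h₂ h₅, div_one]

theorem sigma_of_slice (h₂ : x 2 = 0) (h₅ : x 5 = 0) : sigma k ε x = 1 + quadH k ε x := by
  rw [sigma, c₁_of_slice h₂ h₅, h₂]; ring

theorem denJ_of_slice (h₂ : x 2 = 0) (h₅ : x 5 = 0) : denJ k ε x = 1 + quadH k ε x := by
  rw [denJ, c₁_of_slice h₂ h₅, sigma_of_slice h₂ h₅, h₅]; ring

theorem redJ_of_slice (h₂ : x 2 = 0) (h₅ : x 5 = 0) (hH : 1 + quadH k ε x ≠ 0) :
    redJ k ε x = 2 + 2 * ε ^ 4 * k.a₁ ^ 3 * (k.b₃ - k.b₁) * area x ^ 2 / (1 + quadH k ε x) := by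
  rw [redJ, denJ_of_slice h₂ h₅, numJ, h₂]
  field_simp
  ring

theorem invN_of_slice (h₂ : x 2 = 0) (h₅ : x 5 = 0) (hH : 1 + quadH k ε x ≠ 0) :
    invN k ε x = (1 + quadH k ε x) / 2 - redJ k ε x := by
  rw [invN, tau, c₁_of_slice h₂ h₅, denJ_of_slice h₂ h₅, sigma_of_slice h₂ h₅, skew, h₅]
  field_simp
  ring

theorem denJ₁_of_slice (ha : k.a₁ ≠ 0) (h₂ : x 2 = 0) :
    denJ₁ k ε x = invN k ε x ^ 2 + 2 * invN k ε x := by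
  rw [denJ₁_eq_invN_redJ ha, imDet, h₂]; ring

theorem numJ₁_of_slice (h₂ : x 2 = 0) :
    numJ₁ k ε x = I₀ k ε x * (3 - (1 + invN k ε x) ^ 2) - 2 * (1 + invN k ε x) * ratJ₀ k ε x
      + (ratJ₀ k ε x - I₀ k ε x * (1 + invN k ε x)) * (2 - 4 * redJ k ε x - 2 * invN k ε x) := by
  rw [numJ₁, h₂]; ring

end Slice

section Smooth

variable {k : KirchhoffParams} {ε : ℝ} {x y : KState}

@[fun_prop]
theorem contDiff_c₁ {n : WithTop ℕ∞} : ContDiff ℝ n (c₁ k ε) := by unfold c₁; fun_prop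

@[fun_prop]
theorem contDiff_c₃ {n : WithTop ℕ∞} : ContDiff ℝ n (c₃ k ε) := by unfold c₃; fun_prop

theorem contDiff_area {n : WithTop ℕ∞} : ContDiff ℝ n area := by unfold area; fun_prop

theorem contDiff_quadH {n : WithTop ℕ∞} : ContDiff ℝ n (quadH k ε) := by unfold quadH; fun_prop

theorem contDiffAt_I₀ {n : WithTop ℕ∞} (hc : c₁ k ε x ≠ 0) : ContDiffAt ℝ n (I₀ k ε) x := by
  unfold I₀; fun_prop (disch := assumption)

theorem contDiffAt_sigma {n : WithTop ℕ∞} (hc : c₁ k ε x ≠ 0) : ContDiffAt ℝ n (sigma k ε) x := by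
  have hI := contDiffAt_I₀ (n := n) hc
  unfold sigma quadH imDet; fun_prop

theorem contDiffAt_denJ {n : WithTop ℕ∞} (hc : c₁ k ε x ≠ 0) : ContDiffAt ℝ n (denJ k ε) x := by
  have hσ := contDiffAt_sigma (n := n) hc
  unfold denJ evenSlopeNum quadH; fun_prop

theorem contDiffAt_redJ {n : WithTop ℕ∞} (hc : c₁ k ε x ≠ 0) (hd : denJ k ε x ≠ 0) :
    ContDiffAt ℝ n (redJ k ε) x := by
  have hI := contDiffAt_I₀ (n := n) hc
  have hD := contDiffAt_denJ (n := n) hc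
  unfold redJ numJ quadH area; fun_prop (disch := assumption)

theorem contDiffAt_invN {n : WithTop ℕ∞} (hc : c₁ k ε x ≠ 0) (hd : denJ k ε x ≠ 0) :
    ContDiffAt ℝ n (invN k ε) x := by
  have hσ := contDiffAt_sigma (n := n) hc
  have hD := contDiffAt_denJ (n := n) hc
  have hJ := contDiffAt_redJ (n := n) hc hd
  have h2 : 2 * denJ k ε x ≠ 0 := mul_ne_zero two_ne_zero hd
  unfold invN tau skew area; fun_prop (disch := assumption)

theorem contDiffAt_denJ₁ {n : WithTop ℕ∞} (ha : k.a₁ ≠ 0) (hc : c₁ k ε x ≠ 0)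
    (hd : denJ k ε x ≠ 0) : ContDiffAt ℝ n (denJ₁ k ε) x := by
  have hI := contDiffAt_I₀ (n := n) hc
  have hJ := contDiffAt_redJ (n := n) hc hd
  have hN := contDiffAt_invN (n := n) hc hd
  rw [funext (denJ₁_eq_invN_redJ ha)]
  unfold imDet; fun_prop

theorem contDiffAt_J₁ {n : WithTop ℕ∞} (ha : k.a₁ ≠ 0) (hc : c₁ k ε x ≠ 0)
    (hd : denJ k ε x ≠ 0) (hd₁ : denJ₁ k ε x ≠ 0) : ContDiffAt ℝ n (J₁ k ε) x := by
  have hI := contDiffAt_I₀ (n := n) hc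
  have hJ := contDiffAt_redJ (n := n) hc hd
  have hN := contDiffAt_invN (n := n) hc hd
  have hD := contDiffAt_denJ₁ (n := n) ha hc hd
  unfold J₁ numJ₁ ratJ₀; fun_prop (disch := assumption)

end Smooth

section Rational

variable {k : KirchhoffParams} {ε : ℝ}

@[fun_prop]
theorem isRational_c₁ : IsRational (c₁ k ε) := by unfold c₁; fun_prop

@[fun_prop]
theorem isRational_I₀ : IsRational (I₀ k ε) := by unfold I₀ c₃ c₁; fun_prop

@[fun_prop]
theorem isRational_sigma : IsRational (sigma k ε) := by unfold sigma quadH imDet; fun_prop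

@[fun_prop]
theorem isRational_denJ : IsRational (denJ k ε) := by unfold denJ evenSlopeNum quadH; fun_prop

@[fun_prop]
theorem isRational_redJ : IsRational (redJ k ε) := by unfold redJ numJ quadH area; fun_prop

@[fun_prop]
theorem isRational_invN : IsRational (invN k ε) := by unfold invN tau skew area; fun_prop

theorem isRational_denJ₁ (ha : k.a₁ ≠ 0) : IsRational (denJ₁ k ε) := by
  rw [funext (denJ₁_eq_invN_redJ ha)]
  unfold imDet; fun_prop

theorem isRational_J₁ (ha : k.a₁ ≠ 0) : IsRational (J₁ k ε) := by
  have hD := isRational_denJ₁ (ε := ε) ha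
  unfold J₁ numJ₁ ratJ₀; fun_prop

end Rational

section Nondegenerate

variable {k : KirchhoffParams} {ε : ℝ} {x : KState}

/-- The conditions on a point `x` and its image `Φ x` under which the algebraic identities for the
orbit through `x` can be solved for `I₀`, `J₀` and `J₁`. -/
structure IsNondegenerate (k : KirchhoffParams) (ε : ℝ) (x : KState) : Prop where
  delta_ne : delta k ε x ≠ 0
  isRegular : IsRegular k ε x
  p₃_ne : kahanMap k ε x 5 ≠ x 5
  gramDet_ne : gramDet k ε x (kahanMap k ε x) ≠ 0
  denJ₁_ne : denJ₁ k ε x ≠ 0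

theorem generically_coord_ne_zero (i : Fin 6) : Generically fun x => x i ≠ 0 :=
  ⟨X i, X_ne_zero i, fun x hx => by rwa [eval_X] at hx⟩

theorem generically_c₁_ne_zero : Generically fun x => c₁ k ε x ≠ 0 :=
  isRational_c₁.generically_ne_zero (x := 0) (contDiff_c₁ (n := 0)).continuous.continuousAt
    (by rw [c₁_of_slice rfl rfl]; exact one_ne_zero)

theorem quadH_zero : quadH k ε 0 = 0 := by
  simp [quadH]

theorem generically_denJ_ne_zero : Generically fun x => denJ k ε x ≠ 0 := by
  refine isRational_denJ.generically_ne_zero (x := 0) (contDiffAt_denJ (n := 0) ?_).continuousAt ?_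
  · rw [c₁_of_slice rfl rfl]; exact one_ne_zero
  · rw [denJ_of_slice rfl rfl, quadH_zero, add_zero]; exact one_ne_zero

theorem generically_denJ₁_ne_zero (ha : k.a₁ ≠ 0) : Generically fun x => denJ₁ k ε x ≠ 0 := by
  have hH : 1 + quadH k ε 0 = 1 := by rw [quadH_zero, add_zero]
  refine (isRational_denJ₁ ha).generically_ne_zero (x := 0)
    (contDiffAt_denJ₁ (n := 0) ha ?_ ?_).continuousAt ?_
  · rw [c₁_of_slice rfl rfl]; exact one_ne_zero
  · rw [denJ_of_slice rfl rfl, hH]; exact one_ne_zero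
  · rw [denJ₁_of_slice ha rfl, invN_of_slice rfl rfl (by rw [hH]; exact one_ne_zero),
      redJ_of_slice rfl rfl (by rw [hH]; exact one_ne_zero), hH]
    norm_num [area]

theorem exists_slice_gramDet_factor_ne_zero (ha : k.a₁ ≠ 0) (hε : ε ≠ 0) :
    ∃ w : KState, w 2 = 0 ∧ w 5 = 0 ∧ 1 + quadH k ε w ≠ 0 ∧ area w ≠ 0 ∧
      4 * ε ^ 4 * k.a₁ ^ 3 * (k.b₃ - k.b₁) * area w ^ 2 - quadH k ε w ^ 2 ≠ 0 := by
  obtain ⟨B, hB⟩ : ∃ B, k.b₃ - k.b₁ = B * k.a₁ := ⟨(k.b₃ - k.b₁) / k.a₁, by field_simp⟩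
  set r := |B| + 2
  have hrB : |B| < r ^ 2 := by nlinarith [abs_nonneg B]
  let w : KState := ![r / (ε * k.a₁), 0, 0, 0, 1 / (ε * k.a₁), 0]
  have hH : quadH k ε w = r ^ 2 + B := by
    simp only [quadH, hB, w, Matrix.cons_val]; field_simp; ring
  have hA : area w = -(r / (ε * k.a₁) ^ 2) := by
    simp only [area, w, Matrix.cons_val]; field_simp; ring
  refine ⟨w, rfl, rfl, ?_, ?_, ?_⟩
  · rw [hH]; linarith [neg_abs_le B]
  · rw [hA]; exact neg_ne_zero.mpr (div_ne_zero (by positivity) (pow_ne_zero 2 (mul_ne_zero hε ha)))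
  · have hsq : 4 * ε ^ 4 * k.a₁ ^ 3 * (k.b₃ - k.b₁) * area w ^ 2 - quadH k ε w ^ 2
        = -(r ^ 2 - B) ^ 2 := by
      rw [hA, hH, hB]; field_simp; ring
    rw [hsq]
    exact neg_ne_zero.mpr (pow_ne_zero 2 (by linarith [le_abs_self B]))

theorem IsStep.p₃_ne_zero_of_slice {y : KState} (s : IsStep k ε x y) (ha : k.a₁ ≠ 0) (hε : ε ≠ 0)
    (h₂ : x 2 = 0) (h₅ : x 5 = 0) (hA : area x ≠ 0) : y 5 ≠ 0 := by
  refine left_ne_zero_of_mul (b := 1 + quadH k ε x) ?_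
  rw [s.p₃_of_slice h₂ h₅]
  exact mul_ne_zero (mul_ne_zero (mul_ne_zero two_ne_zero hε) ha) hA

theorem continuousAt_kahanMap_apply (h : delta k ε x ≠ 0) (i : Fin 6) :
    ContinuousAt (fun y => kahanMap k ε y i) x :=
  (continuous_apply i).continuousAt.comp (continuousAt_kahanMap h)

theorem generically_p₃_ne (ha : k.a₁ ≠ 0) (hε : ε ≠ 0) :
    Generically fun x => kahanMap k ε x 5 ≠ x 5 := by
  obtain ⟨w, w₂, w₅, hH, hA, -⟩ := exists_slice_gramDet_factor_ne_zero ha hε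
  have hδ := delta_ne_zero_of_slice w₂ w₅ hH
  have hrat : IsRational fun x => kahanMap k ε x 5 - x 5 := by fun_prop
  refine (hrat.generically_ne_zero (x := w) ((continuousAt_kahanMap_apply hδ 5).sub
    (continuousAt_apply 5 w)) ?_).mono fun x hx => sub_ne_zero.mp hx
  rw [w₅, sub_zero]
  exact (isStep_kahanMap hδ).p₃_ne_zero_of_slice ha hε w₂ w₅ hA

theorem isRational_gramDet {Ψ : KState → KState} (hΨ : ∀ i, IsRational fun x => Ψ x i) :
    IsRational fun x => gramDet k ε x (Ψ x) := by
  unfold gramDet areaForm planarWronskian area; fun_prop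

theorem continuous_gramDet : Continuous fun p : KState × KState => gramDet k ε p.1 p.2 := by
  unfold gramDet areaForm planarWronskian area; fun_prop

theorem generically_gramDet_ne_zero (ha : k.a₁ ≠ 0) (hε : ε ≠ 0) :
    Generically fun x => gramDet k ε x (kahanMap k ε x) ≠ 0 := by
  obtain ⟨w, w₂, w₅, hH, hA, hw⟩ := exists_slice_gramDet_factor_ne_zero ha hε
  have hδ := delta_ne_zero_of_slice w₂ w₅ hH
  have hs := isStep_kahanMap hδ
  have hpair : ContinuousAt (fun x => (x, kahanMap k ε x)) w :=
    continuousAt_id.prodMk (continuousAt_kahanMap hδ)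
  have hne : gramDet k ε w (kahanMap k ε w) ≠ 0 := by
    rw [hs.gramDet_of_slice w₂ w₅]
    exact mul_ne_zero (pow_ne_zero 2 (hs.p₃_ne_zero_of_slice ha hε w₂ w₅ hA)) hw
  exact (isRational_gramDet isRational_kahanMap).generically_ne_zero
    (ContinuousAt.comp (f := fun x => (x, kahanMap k ε x)) continuous_gramDet.continuousAt hpair)
    hne

theorem generically_isNondegenerate (ha : k.a₁ ≠ 0) (hε : ε ≠ 0) :
    Generically (IsNondegenerate k ε) := by
  have hreg : Generically (IsRegular k ε) :=
    ((((generically_coord_ne_zero 2).and (generically_coord_ne_zero 5)).and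
      generically_c₁_ne_zero).and generically_denJ_ne_zero).mono
      fun x ⟨⟨⟨h2, h5⟩, hc⟩, hd⟩ => ⟨h2, h5, hc, hd⟩
  exact ((((generically_delta_ne_zero.and hreg).and (generically_p₃_ne ha hε)).and
    (generically_gramDet_ne_zero ha hε)).and (generically_denJ₁_ne_zero ha)).mono
    fun x ⟨⟨⟨⟨hδ, hr⟩, hp⟩, hg⟩, hd⟩ => ⟨hδ, hr, hp, hg, hd⟩

theorem generically_isNondegenerate_iterate (ha : k.a₁ ≠ 0) (hε : ε ≠ 0) :
    Generically fun x => ∀ i : Fin 3, IsNondegenerate k ε ((kahanMap k ε)^[i] x) :=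
  Generically.forall fun i => (generically_isNondegenerate ha hε).comp_iterate_kahanMap i

end Nondegenerate

section Wronskians

variable {k : KirchhoffParams} {ε : ℝ} {x : KState}

theorem wronskian_zero_add_wronskian_one (l : ℕ) :
    wronskian k ε l 0 x + wronskian k ε l 1 x = planarWronskian x ((kahanMap k ε)^[l] x) := by
  change (_ * x 3 - x 0 * _) + (_ * x 4 - x 1 * _) = _
  rw [planarWronskian]
  ring!

theorem wronskian_two {l : ℕ} (h : ((kahanMap k ε)^[l] x) 2 = x 2) :
    wronskian k ε l 2 x = -(x 2 * (((kahanMap k ε)^[l] x) 5 - x 5)) := by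
  change ((kahanMap k ε)^[l] x) 2 * x 5 - x 2 * ((kahanMap k ε)^[l] x) 5 = _
  rw [h]
  ring

theorem iterate_kahanMap_apply_two {l : ℕ} (h : ∀ i < l, delta k ε ((kahanMap k ε)^[i] x) ≠ 0) :
    ((kahanMap k ε)^[l] x) 2 = x 2 := by
  induction l with
  | zero => rfl
  | succ l ih =>
    rw [Function.iterate_succ_apply', kahanMap_apply_two (h l l.lt_succ_self),
      ih fun i hi => h i (hi.trans l.lt_succ_self)]

section Nondegenerate

variable (h : ∀ i : Fin 3, IsNondegenerate k ε ((kahanMap k ε)^[i] x))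
include h

theorem isStep_iterate_kahanMap (i : Fin 3) :
    IsStep k ε ((kahanMap k ε)^[i] x) ((kahanMap k ε)^[i + 1] x) := by
  rw [Function.iterate_succ_apply']
  exact isStep_kahanMap (h i).delta_ne

theorem iterate_kahanMap_three_apply_two : ((kahanMap k ε)^[3] x) 2 = x 2 :=
  iterate_kahanMap_apply_two fun i hi => (h ⟨i, hi⟩).delta_ne

theorem wronskian_relation (ha : k.a₁ ≠ 0) (hb : k.b₁ ≠ k.b₃) (hε : ε ≠ 0) :
    wronskian k ε 3 0 x + wronskian k ε 3 1 x + J₁ k ε x * wronskian k ε 3 2 x = 0 := by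
  have hgram := Complex.ofReal_ne_zero.mpr (h 1).gramDet_ne
  rw [← hermForm_mul_sub_mul] at hgram
  have hω : planarWronskian x ((kahanMap k ε)^[3] x)
      = x 2 * (((kahanMap k ε)^[3] x) 5 - x 5) * J₁ k ε x :=
    planarWronskian_third_order (isStep_iterate_kahanMap h 0) (isStep_iterate_kahanMap h 1)
      (isStep_iterate_kahanMap h 2) ha hb hε (h 0).isRegular (h 1).isRegular (h 2).isRegular
      (h 0).p₃_ne (h 1).p₃_ne (h 1).denJ₁_ne hgram
  rw [wronskian_zero_add_wronskian_one, wronskian_two (iterate_kahanMap_three_apply_two h)]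
  linear_combination hω

theorem wronskian_two_ne_zero (ha : k.a₁ ≠ 0) (hb : k.b₁ ≠ k.b₃) (hε : ε ≠ 0) :
    wronskian k ε 3 2 x ≠ 0 := by
  have hdiff := sub_mul_tau_mul_tau (isStep_iterate_kahanMap h 0) (isStep_iterate_kahanMap h 1)
    (isStep_iterate_kahanMap h 2) ha hb hε (h 1).isRegular (h 2).isRegular (h 1).p₃_ne
  rw [wronskian_two (iterate_kahanMap_three_apply_two h)]
  refine neg_ne_zero.mpr (mul_ne_zero (h 0).isRegular.m₃_ne (left_ne_zero_of_mul
    (hdiff.trans_ne (neg_ne_zero.mpr (mul_ne_zero (sub_ne_zero.mpr (h 1).p₃_ne)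
      (h 1).denJ₁_ne)))))

end Nondegenerate

end Wronskians

section Integrals

variable {k : KirchhoffParams} {ε : ℝ} {x : KState}

theorem continuousAt_J₀ (h : delta k ε x ≠ 0) (hC : C₁ k ε x ≠ 0) :
    ContinuousAt (J₀ k ε) x := by
  have hx (i : Fin 6) : ContinuousAt (fun y : KState => y i) x := continuousAt_apply i x
  have hΦ := continuousAt_kahanMap_apply h
  refine ContinuousAt.div₀ ?_ ?_ hC
  · exact (continuousAt_const.sub
      (continuousAt_const.mul (((hx 0).mul (hΦ 0)).add ((hx 1).mul (hΦ 1))))).sub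
        (continuousAt_const.mul (((hx 3).mul (hΦ 3)).add ((hx 4).mul (hΦ 4))))
  · exact (continuousAt_const.sub (continuousAt_const.mul ((hx 2).pow 2))).sub
      (continuousAt_const.mul ((hx 5).mul (hΦ 5)))

theorem continuousAt_wronskian {l : ℕ} (h : ∀ i < l, delta k ε ((kahanMap k ε)^[i] x) ≠ 0)
    (j : Fin 3) : ContinuousAt (wronskian k ε l j) x := by
  have hx (i : Fin 6) : ContinuousAt (fun y : KState => y i) x := continuousAt_apply i x
  have hΦ (i : Fin 6) : ContinuousAt (fun y => (kahanMap k ε)^[l] y i) x :=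
    (continuous_apply i).continuousAt.comp (continuousAt_iterate_kahanMap h)
  exact ((hΦ _).mul (hx _)).sub ((hx _).mul (hΦ _))

theorem continuousAt_ratFun {N D : MvPolynomial (Fin 6) ℝ} (h : eval x D ≠ 0) :
    ContinuousAt (ratFun N D) x :=
  (hasFDerivAt_ratFun N D h).continuousAt

theorem isIntegral_of_generically {dom : Set KState} {F : KState → ℝ}
    (hF : ∀ x ∈ dom, ContinuousAt F x) (h : Generically fun x => F (kahanMap k ε x) = F x) :
    IsIntegral k ε dom F := fun x hx hd hx' =>
  h.eq_of_continuousAt (f := fun y => F (kahanMap k ε y))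
    (ContinuousAt.comp (f := kahanMap k ε) (hF _ hx') (continuousAt_kahanMap hd)) (hF x hx)

theorem generically_isNondegenerate_and_kahanMap (ha : k.a₁ ≠ 0) (hε : ε ≠ 0) :
    Generically fun x => IsNondegenerate k ε x ∧ IsNondegenerate k ε (kahanMap k ε x) :=
  (generically_isNondegenerate ha hε).and (generically_isNondegenerate ha hε).comp_kahanMap

theorem isIntegral_I₀ (ha : k.a₁ ≠ 0) (hε : ε ≠ 0) :
    IsIntegral k ε {x | c₁ k ε x ≠ 0} (I₀ k ε) :=
  isIntegral_of_generically (fun _ hx => (contDiffAt_I₀ (n := 0) hx).continuousAt)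
    ((generically_isNondegenerate_and_kahanMap ha hε).mono fun _ h =>
      (isStep_kahanMap h.1.delta_ne).I₀_eq ha h.1.isRegular h.2.isRegular h.1.p₃_ne)

theorem J₀_eq_ratJ₀ (ha : k.a₁ ≠ 0) (h : IsNondegenerate k ε x)
    (h' : IsRegular k ε (kahanMap k ε x)) : J₀ k ε x = ratJ₀ k ε x := by
  have s := isStep_kahanMap h.delta_ne
  exact (div_eq_iff (s.polarC₁_ne ha h.isRegular)).mpr (s.polarC₃_eq ha h.isRegular h' h.p₃_ne)

theorem generically_J₀_eq_ratJ₀ (ha : k.a₁ ≠ 0) (hε : ε ≠ 0) :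
    Generically fun x => J₀ k ε x = ratJ₀ k ε x :=
  (generically_isNondegenerate_and_kahanMap ha hε).mono fun _ h => J₀_eq_ratJ₀ ha h.1 h.2.isRegular

theorem isIntegral_J₀ (ha : k.a₁ ≠ 0) (hε : ε ≠ 0) :
    IsIntegral k ε {x | delta k ε x ≠ 0 ∧ C₁ k ε x ≠ 0} (J₀ k ε) := by
  have hJ₀ := generically_J₀_eq_ratJ₀ (k := k) ha hε
  refine isIntegral_of_generically (fun x hx => continuousAt_J₀ hx.1 hx.2)
    (((generically_isNondegenerate_and_kahanMap ha hε).and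
      (hJ₀.and (hJ₀.comp_kahanMap (k := k) (ε := ε)))).mono fun x ⟨h, hx, hΦx⟩ => ?_)
  rw [hx, hΦx, (isStep_kahanMap h.1.delta_ne).ratJ₀_eq ha h.1.isRegular h.2.isRegular h.1.p₃_ne]

theorem isIntegral_m₃ : IsIntegral k ε Set.univ m₃ := fun _ _ hd _ => kahanMap_apply_two hd

variable {N D : MvPolynomial (Fin 6) ℝ}

theorem isIntegral_ratFun (ha : k.a₁ ≠ 0) (hε : ε ≠ 0)
    (hJ : Generically fun x => J₁ k ε x = ratFun N D x) :
    IsIntegral k ε {x | eval x D ≠ 0} (ratFun N D) := by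
  refine isIntegral_of_generically (fun x hx => continuousAt_ratFun hx)
    (((generically_isNondegenerate_and_kahanMap ha hε).and
      (hJ.and (hJ.comp_kahanMap (k := k) (ε := ε)))).mono fun x ⟨h, hx, hΦx⟩ => ?_)
  rw [← hx, ← hΦx,
    (isStep_kahanMap h.1.delta_ne).J₁_eq ha h.1.isRegular h.2.isRegular h.1.p₃_ne]

theorem wronskian_relation_ratFun (ha : k.a₁ ≠ 0) (hb : k.b₁ ≠ k.b₃) (hε : ε ≠ 0)
    (hJ : Generically fun x => J₁ k ε x = ratFun N D x) (hD : eval x D ≠ 0)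
    (h : ∀ i < 3, delta k ε ((kahanMap k ε)^[i] x) ≠ 0) :
    wronskian k ε 3 0 x + wronskian k ε 3 1 x + ratFun N D x * wronskian k ε 3 2 x = 0 := by
  have hW := continuousAt_wronskian h
  refine Generically.eq_of_continuousAt (f := fun x => wronskian k ε 3 0 x + wronskian k ε 3 1 x
    + ratFun N D x * wronskian k ε 3 2 x) (g := fun _ => 0) ?_
    (((hW 0).add (hW 1)).add ((continuousAt_ratFun hD).mul (hW 2))) continuousAt_const
  refine ((generically_isNondegenerate_iterate ha hε).and hJ).mono fun y ⟨hy, hJy⟩ => ?_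
  rw [← hJy, wronskian_relation hy ha hb hε]

end Integrals

section NullSpace

variable {k : KirchhoffParams} {ε : ℝ} {x : KState}

theorem continuousAt_wronskian_iter (hx : x ∈ orbitDomain k ε) (l : ℕ) (i : ℤ) (j : Fin 3) :
    ContinuousAt (fun y => wronskian k ε l j (iter k ε i y)) x :=
  ContinuousAt.comp (f := iter k ε i)
    (continuousAt_wronskian (fun n _ => delta_iterate_ne_zero hx i n) j) (continuousAt_iter hx i)

theorem J₁_iter (ha : k.a₁ ≠ 0) (hx : x ∈ orbitDomain k ε)
    (h : ∀ i, IsNondegenerate k ε (iter k ε i x)) (i : ℤ) : J₁ k ε (iter k ε i x) = J₁ k ε x := by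
  have hstep (n : ℤ) : J₁ k ε (iter k ε (n + 1) x) = J₁ k ε (iter k ε n x) := by
    have hn := (h (n + 1)).isRegular
    rw [iter_add_one hx] at hn ⊢
    exact (isStep_kahanMap (h n).delta_ne).J₁_eq ha (h n).isRegular hn (h n).p₃_ne
  induction i using Int.induction_on with
  | zero => rw [iter_zero]
  | succ n ih => rw [hstep, ih]
  | pred n ih => rw [← ih, ← hstep, sub_add_cancel]

theorem wronskian_proportional (ha : k.a₁ ≠ 0) (hb : k.b₁ ≠ k.b₃) (hε : ε ≠ 0)
    (hx : x ∈ orbitDomain k ε) (i j : ℤ) :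
    (wronskian k ε 3 0 (iter k ε i x) + wronskian k ε 3 1 (iter k ε i x))
        * wronskian k ε 3 2 (iter k ε j x)
      = (wronskian k ε 3 0 (iter k ε j x) + wronskian k ε 3 1 (iter k ε j x))
        * wronskian k ε 3 2 (iter k ε i x) := by
  have hW := continuousAt_wronskian_iter hx 3
  refine eq_of_dense (dense_orbitDomain_inter (k := k) (ε := ε)
      (generically_isNondegenerate_iterate ha hε))
    (f := fun y => (wronskian k ε 3 0 (iter k ε i y) + wronskian k ε 3 1 (iter k ε i y))
        * wronskian k ε 3 2 (iter k ε j y))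
    (g := fun y => (wronskian k ε 3 0 (iter k ε j y) + wronskian k ε 3 1 (iter k ε j y))
        * wronskian k ε 3 2 (iter k ε i y))
    (((hW i 0).add (hW i 1)).mul (hW j 2)) (((hW j 0).add (hW j 1)).mul (hW i 2)) ?_
  rintro y ⟨hy, hnondeg⟩
  have hJ := J₁_iter ha hy fun n => hnondeg n 0
  have hi := wronskian_relation (hnondeg i) ha hb hε
  have hj := wronskian_relation (hnondeg j) ha hb hε
  rw [hJ] at hi hj
  linear_combination wronskian k ε 3 2 (iter k ε j y) * hi
    - wronskian k ε 3 2 (iter k ε i y) * hj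

theorem mem_nullSpace {l : ℕ} {c : Fin 3 → ℝ} :
    c ∈ hkNullSpace (iter k ε) (wronskian k ε l) x ↔
      ∀ i : ℤ, c 0 * wronskian k ε l 0 (iter k ε i x) + c 1 * wronskian k ε l 1 (iter k ε i x)
        + c 2 * wronskian k ε l 2 (iter k ε i x) = 0 := by
  change (∀ i : ℤ, ∑ j, c j * wronskian k ε l j (iter k ε i x) = 0) ↔ _
  simp only [Fin.sum_univ_three]

theorem one_one_mem_nullSpace (ha : k.a₁ ≠ 0) (hb : k.b₁ ≠ k.b₃) (hε : ε ≠ 0)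
    (hx : x ∈ orbitDomain k ε) {j : ℤ} (hj : wronskian k ε 3 2 (iter k ε j x) ≠ 0) {J : ℝ}
    (hJ : wronskian k ε 3 0 (iter k ε j x) + wronskian k ε 3 1 (iter k ε j x)
      + J * wronskian k ε 3 2 (iter k ε j x) = 0) :
    ![1, 1, J] ∈ hkNullSpace (iter k ε) (wronskian k ε 3) x := by
  refine mem_nullSpace.mpr fun i => mul_right_cancel₀ hj ?_
  simp only [Matrix.cons_val, one_mul, zero_mul]
  linear_combination wronskian_proportional ha hb hε hx i j
    + wronskian k ε 3 2 (iter k ε i x) * hJ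

theorem nullSpace_ne_bot (ha : k.a₁ ≠ 0) (hb : k.b₁ ≠ k.b₃) (hε : ε ≠ 0)
    (hx : x ∈ orbitDomain k ε) : hkNullSpace (iter k ε) (wronskian k ε 3) x ≠ ⊥ := by
  rw [Submodule.ne_bot_iff]
  by_cases! h : ∀ i, wronskian k ε 3 2 (iter k ε i x) = 0
  · refine ⟨![0, 0, 1], mem_nullSpace.mpr fun i => ?_, fun e => one_ne_zero (congrFun e 2)⟩
    simp only [Matrix.cons_val, zero_mul, h i, mul_zero, add_zero]
  · obtain ⟨j, hj⟩ := h
    exact ⟨![1, 1, -(wronskian k ε 3 0 (iter k ε j x) + wronskian k ε 3 1 (iter k ε j x))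
      / wronskian k ε 3 2 (iter k ε j x)], one_one_mem_nullSpace ha hb hε hx hj
        (by rw [div_mul_cancel₀ _ hj, add_neg_cancel]), fun e => one_ne_zero (congrFun e 0)⟩

/-- The determinant of `(W⁽³⁾₁, W⁽³⁾₃)` at `x` and `Φ x`: where it does not vanish, the null-space
of the third order Wronskians is at most one-dimensional. -/
def wronskianDet (k : KirchhoffParams) (ε : ℝ) (x : KState) : ℝ :=
  wronskian k ε 3 0 x * wronskian k ε 3 2 (kahanMap k ε x)
    - wronskian k ε 3 2 x * wronskian k ε 3 0 (kahanMap k ε x)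

theorem eq_smul_of_two_relations {K : Type*} [Field K] {A B C A' B' C' J : K} {c : Fin 3 → K}
    (hdet : A * C' - C * A' ≠ 0) (hC : C ≠ 0) (r : A + B + J * C = 0) (r' : A' + B' + J * C' = 0)
    (h : c 0 * A + c 1 * B + c 2 * C = 0) (h' : c 0 * A' + c 1 * B' + c 2 * C' = 0) :
    c 1 • ![1, 1, J] = c := by
  have h₀ : c 0 = c 1 := by
    refine sub_eq_zero.mp (mul_right_cancel₀ hdet ?_)
    linear_combination C' * (h - c 1 * r) - C * (h' - c 1 * r')
  have h₂ : c 2 = c 1 * J := by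
    refine sub_eq_zero.mp (mul_right_cancel₀ hC ?_)
    linear_combination h - c 1 * r - A * h₀
  ext i
  fin_cases i
  · exact (mul_one _).trans h₀.symm
  · exact mul_one _
  · exact h₂.symm

theorem nullSpace_eq_span (ha : k.a₁ ≠ 0) (hb : k.b₁ ≠ k.b₃) (hε : ε ≠ 0)
    (hx : x ∈ orbitDomain k ε) (h : ∀ i : Fin 3, IsNondegenerate k ε ((kahanMap k ε)^[i] x))
    (hdet : wronskianDet k ε x ≠ 0) :
    hkNullSpace (iter k ε) (wronskian k ε 3) x = Submodule.span ℝ {![1, 1, J₁ k ε x]} := by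
  have hW := wronskian_two_ne_zero h ha hb hε
  have hrel := wronskian_relation h ha hb hε
  have hmem : ![1, 1, J₁ k ε x] ∈ hkNullSpace (iter k ε) (wronskian k ε 3) x :=
    one_one_mem_nullSpace ha hb hε hx (j := 0) (by rwa [iter_zero]) (by rwa [iter_zero])
  refine le_antisymm (fun c hc => Submodule.mem_span_singleton.mpr ⟨c 1, ?_⟩)
    ((Submodule.span_singleton_le_iff_mem _ _).mpr hmem)
  have hiter : iter k ε 1 x = kahanMap k ε x := congrFun (iter_natCast 1) x
  rw [mem_nullSpace] at hc hmem
  have hrel' := hmem 1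
  have hc₀ := hc 0
  have hc₁ := hc 1
  simp only [Matrix.cons_val, one_mul] at hrel'
  rw [iter_zero] at hc₀
  rw [hiter] at hc₁ hrel'
  exact eq_smul_of_two_relations hdet hW hrel hrel' hc₀ hc₁

end NullSpace

section Reflection

variable {k : KirchhoffParams} {ε : ℝ} {x y : KState}

/-- The reflection `(m₃, p₃) ↦ (-m₃, -p₃)`, a reversing symmetry of the discrete Kirchhoff system:
it conjugates `Φ(·; ε)` to its inverse `Φ(·; -ε)`. -/
def reflect (x : KState) : KState := ![x 0, x 1, -x 2, x 3, x 4, -x 5]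

theorem IsStep.reflect (s : IsStep k ε x y) : IsStep k (-ε) (reflect x) (reflect y) := by
  obtain ⟨h₀, h₁, h₂, h₃, h₄, h₅⟩ := s
  simp only [IsStep, Kirchhoff.reflect, Matrix.cons_val]
  refine ⟨?_, ?_, ?_, ?_, ?_, ?_⟩ <;> linarith

theorem kahanMap_reflect (h : delta k ε x ≠ 0) (h' : delta k (-ε) (reflect x) ≠ 0) :
    kahanMap k (-ε) (reflect x) = reflect (kahanMap k ε x) :=
  ((isStep_iff k (-ε) _ _ h').mp (isStep_kahanMap h).reflect).symm

theorem reflect_of_slice (h₂ : x 2 = 0) (h₅ : x 5 = 0) : reflect x = x := by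
  funext i
  fin_cases i <;> simp only [reflect, Matrix.cons_val, Fin.zero_eta, Fin.mk_one, Fin.reduceFinMk,
    Fin.isValue, h₂, h₅, neg_zero]

end Reflection

section WronskianDet

variable {k : KirchhoffParams} {ε : ℝ}

theorem isRational_iterate_kahanMap (n : ℕ) (i : Fin 6) :
    IsRational fun x => (kahanMap k ε)^[n] x i := by
  induction n with
  | zero => exact .coord i
  | succ n ih => exact ih.comp_kahanMap (k := k) (ε := ε)

theorem isRational_wronskian (l : ℕ) (i : Fin 3) : IsRational (wronskian k ε l i) :=
  ((isRational_iterate_kahanMap l _).mul (.coord _)).sub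
    ((IsRational.coord _).mul (isRational_iterate_kahanMap l _))

theorem isRational_wronskianDet : IsRational (wronskianDet k ε) :=
  ((isRational_wronskian 3 0).mul ((isRational_wronskian 3 2).comp_kahanMap)).sub
    ((isRational_wronskian 3 2).mul ((isRational_wronskian 3 0).comp_kahanMap))

/-- The value of `wronskianDet / m₃` at `u`, in terms of the points `u`, `v = Φ u`, `p = Φ³ u` and
`q = Φ⁴ u` of its orbit. -/
def fivePoint (u v p q : KState) : ℝ :=
  (p 0 * u 3 - u 0 * p 3) * (v 5 - q 5) - (u 5 - p 5) * (q 0 * v 3 - v 0 * q 3)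

theorem continuous_fivePoint :
    Continuous fun z : KState × KState × KState × KState =>
      fivePoint z.1 z.2.1 z.2.2.1 z.2.2.2 := by
  unfold fivePoint
  fun_prop

theorem fivePoint_reflect (p q : KState) :
    fivePoint (reflect q) (reflect p) p q = 2 * (p 5 + q 5) * (q 0 * p 3 - p 0 * q 3) := by
  simp only [fivePoint, reflect, Matrix.cons_val]
  ring

theorem wronskianDet_eq_mul_fivePoint {u v y p q : KState} (hu : delta k ε u ≠ 0)
    (hv : delta k ε v ≠ 0) (hy : delta k ε y ≠ 0) (hp : delta k ε p ≠ 0)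
    (huv : kahanMap k ε u = v) (hvy : kahanMap k ε v = y) (hyp : kahanMap k ε y = p)
    (hpq : kahanMap k ε p = q) : wronskianDet k ε u = u 2 * fivePoint u v p q := by
  have iterate_three (x : KState) :
      (kahanMap k ε)^[3] x = kahanMap k ε (kahanMap k ε (kahanMap k ε x)) := rfl
  have v₂ : v 2 = u 2 := huv ▸ kahanMap_apply_two hu
  have p₂ : p 2 = u 2 := by
    rw [← hyp, kahanMap_apply_two hy, ← hvy, kahanMap_apply_two hv, v₂]
  have q₂ : q 2 = v 2 := by rw [← hpq, kahanMap_apply_two hp, p₂, v₂]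
  have hu₃ : (kahanMap k ε)^[3] u = p := by rw [iterate_three, huv, hvy, hyp]
  have hv₃ : (kahanMap k ε)^[3] v = q := by rw [iterate_three, hvy, hyp, hpq]
  have hW₀ (x : KState) : wronskian k ε 3 0 x
      = ((kahanMap k ε)^[3] x) 0 * x 3 - x 0 * ((kahanMap k ε)^[3] x) 3 := rfl
  rw [wronskianDet, huv, wronskian_two (by rw [hv₃, q₂]), wronskian_two (by rw [hu₃, p₂]), hW₀, hW₀,
    hu₃, hv₃, v₂, fivePoint]
  ring

theorem continuousAt_fivePoint {y : KState}
    (h₁ : delta k ε y ≠ 0) (h₂ : delta k ε (kahanMap k ε y) ≠ 0) (h₃ : delta k (-ε) y ≠ 0)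
    (h₄ : delta k (-ε) (kahanMap k (-ε) y) ≠ 0) :
    ContinuousAt (fun y => fivePoint (kahanMap k (-ε) (kahanMap k (-ε) y))
      (kahanMap k (-ε) y) (kahanMap k ε y) (kahanMap k ε (kahanMap k ε y))) y := by
  have c₁ := continuousAt_kahanMap h₁
  have c₂ : ContinuousAt (fun y => kahanMap k ε (kahanMap k ε y)) y :=
    ContinuousAt.comp (f := kahanMap k ε) (continuousAt_kahanMap h₂) c₁
  have c₃ := continuousAt_kahanMap h₃
  have c₄ : ContinuousAt (fun y => kahanMap k (-ε) (kahanMap k (-ε) y)) y :=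
    ContinuousAt.comp (f := kahanMap k (-ε)) (continuousAt_kahanMap h₄) c₃
  exact ContinuousAt.comp (f := fun y => (kahanMap k (-ε) (kahanMap k (-ε) y), kahanMap k (-ε) y,
    kahanMap k ε y, kahanMap k ε (kahanMap k ε y))) continuous_fivePoint.continuousAt
      (c₄.prodMk (c₃.prodMk (c₁.prodMk c₂)))

theorem generically_fivePoint_eq_zero (hdet : Generically fun x => wronskianDet k ε x = 0) :
    Generically fun y => fivePoint (kahanMap k (-ε) (kahanMap k (-ε) y)) (kahanMap k (-ε) y)
      (kahanMap k ε y) (kahanMap k ε (kahanMap k ε y)) = 0 := by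
  have hδ := generically_delta_ne_zero (k := k) (ε := ε)
  have hδ' := generically_delta_ne_zero (k := k) (ε := -ε)
  have hu := (generically_coord_ne_zero 2).and (hδ.and hdet)
  refine (((hδ'.and (hδ'.comp_kahanMap (k := k) (ε := -ε))).and
    (hδ.and ((hδ.comp_kahanMap (k := k) (ε := ε)).and (hδ.comp_kahanMap (k := k) (ε := -ε))))).and
    ((hu.comp_kahanMap (k := k) (ε := -ε)).comp_kahanMap (k := k) (ε := -ε))).mono ?_
  intro y ⟨⟨⟨h₁, h₂⟩, hy, hp, hv⟩, hu₂, hu, hu₀⟩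
  have hfive := wronskianDet_eq_mul_fivePoint hu hv hy hp (kahanMap_kahanMap_neg h₂ hu)
    (kahanMap_kahanMap_neg h₁ hv) rfl rfl
  exact (mul_eq_zero.mp (hfive.symm.trans hu₀)).resolve_left hu₂

theorem fivePoint_eq_zero (hdet : Generically fun x => wronskianDet k ε x = 0) {y : KState}
    (h₁ : delta k ε y ≠ 0) (h₂ : delta k ε (kahanMap k ε y) ≠ 0) (h₃ : delta k (-ε) y ≠ 0)
    (h₄ : delta k (-ε) (kahanMap k (-ε) y) ≠ 0) :
    fivePoint (kahanMap k (-ε) (kahanMap k (-ε) y)) (kahanMap k (-ε) y) (kahanMap k ε y)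
      (kahanMap k ε (kahanMap k ε y)) = 0 :=
  (generically_fivePoint_eq_zero hdet).eq_of_continuousAt
    (f := fun y => fivePoint (kahanMap k (-ε) (kahanMap k (-ε) y)) (kahanMap k (-ε) y)
      (kahanMap k ε y) (kahanMap k ε (kahanMap k ε y))) (g := fun _ => 0)
    (continuousAt_fivePoint h₁ h₂ h₃ h₄) continuousAt_const

end WronskianDet

section ZeroLevel

variable {k : KirchhoffParams} {ε : ℝ} {x y : KState}

theorem IsStep.eqs_of_m₃_eq_zero (s : IsStep k ε x y) (h₂ : x 2 = 0) :
    y 0 * (1 - ε ^ 2 * k.a₁ * (k.b₃ - k.b₁) * x 5 ^ 2)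
        = x 0 * (1 + ε ^ 2 * k.a₁ * (k.b₃ - k.b₁) * x 5 * y 5)
          + ε * (k.b₃ - k.b₁) * (x 5 + y 5) * x 4 ∧
      y 1 * (1 - ε ^ 2 * k.a₁ * (k.b₃ - k.b₁) * x 5 ^ 2)
        = x 1 * (1 + ε ^ 2 * k.a₁ * (k.b₃ - k.b₁) * x 5 * y 5)
          - ε * (k.b₃ - k.b₁) * (x 5 + y 5) * x 3 ∧
      y 3 * (1 - ε ^ 2 * k.a₁ * (k.b₃ - k.b₁) * x 5 ^ 2)
        = x 3 * (1 + ε ^ 2 * k.a₁ * (k.b₃ - k.b₁) * x 5 * y 5)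
          - ε * k.a₁ * (x 5 + y 5) * x 1 ∧
      y 4 * (1 - ε ^ 2 * k.a₁ * (k.b₃ - k.b₁) * x 5 ^ 2)
        = x 4 * (1 + ε ^ 2 * k.a₁ * (k.b₃ - k.b₁) * x 5 * y 5)
          + ε * k.a₁ * (x 5 + y 5) * x 0 := by
  have hy₂ := s.m₃_eq.trans h₂
  obtain ⟨h0, h1, -, h3, h4, -⟩ := s
  rw [hy₂, h₂] at h0 h1 h3 h4
  refine ⟨?_, ?_, ?_, ?_⟩
  · linear_combination h0 + ε * (k.b₃ - k.b₁) * x 5 * h4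
  · linear_combination h1 - ε * (k.b₃ - k.b₁) * x 5 * h3
  · linear_combination h3 - ε * k.a₁ * x 5 * h1
  · linear_combination h4 + ε * k.a₁ * x 5 * h0

theorem IsStep.mul_sub_mul_of_m₃_eq_zero (s : IsStep k ε x y) (h₂ : x 2 = 0) :
    (y 0 * x 3 - x 0 * y 3) * (1 - ε ^ 2 * k.a₁ * (k.b₃ - k.b₁) * x 5 ^ 2)
      = (x 5 + y 5) * ε * ((k.b₃ - k.b₁) * x 3 * x 4 + k.a₁ * x 0 * x 1) := by
  obtain ⟨h0, -, h3, -⟩ := s.eqs_of_m₃_eq_zero h₂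
  linear_combination x 3 * h0 - x 0 * h3

theorem IsStep.p₃_eq_of_add_eq_zero (s : IsStep k ε x y) (h₂ : x 2 = 0)
    (hne : 1 - ε ^ 2 * k.a₁ * (k.b₃ - k.b₁) * x 5 ^ 2 ≠ 0) (h : x 5 + y 5 = 0) :
    x 5 = -(ε * k.a₁ * area x) := by
  obtain ⟨h0, h1, h3, h4⟩ := s.eqs_of_m₃_eq_zero h₂
  obtain ⟨-, -, -, -, -, h5⟩ := s
  have hy₅ : y 5 = -x 5 := by linarith
  rw [h, hy₅] at h0 h1 h3 h4
  have e0 : y 0 = x 0 := mul_right_cancel₀ hne (by linear_combination h0)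
  have e1 : y 1 = x 1 := mul_right_cancel₀ hne (by linear_combination h1)
  have e3 : y 3 = x 3 := mul_right_cancel₀ hne (by linear_combination h3)
  have e4 : y 4 = x 4 := mul_right_cancel₀ hne (by linear_combination h4)
  rw [e0, e1, e3, e4, hy₅] at h5
  rw [area]
  linear_combination -h5 / 2

variable {p q : KState}

theorem IsStep.area_of_slice (s : IsStep k ε x p) (h₂ : x 2 = 0) (h₅ : x 5 = 0) :
    ε * k.a₁ * area p = ε * k.a₁ * area x * (1 + ε ^ 2 * k.a₁ * (k.b₃ - k.b₁) * p 5 ^ 2)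
      - p 5 * quadH k ε x := by
  rw [s.eq_of_slice h₂ h₅]
  simp only [area, quadH, Matrix.cons_val]
  ring

theorem IsStep.mul_add_mul_of_slice (s : IsStep k ε x p) (h₂ : x 2 = 0) (h₅ : x 5 = 0) :
    (k.b₃ - k.b₁) * p 3 * p 4 + k.a₁ * p 0 * p 1
      = ((k.b₃ - k.b₁) * x 3 * x 4 + k.a₁ * x 0 * x 1)
        * (1 - ε ^ 2 * k.a₁ * (k.b₃ - k.b₁) * p 5 ^ 2) := by
  rw [s.eq_of_slice h₂ h₅]
  simp only [Matrix.cons_val]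
  ring

theorem IsStep.add_p₃_ne_zero_of_slice (s : IsStep k ε x p) (s' : IsStep k ε p q)
    (ha : k.a₁ ≠ 0) (hε : ε ≠ 0) (h₂ : x 2 = 0) (h₅ : x 5 = 0) (hA : area x ≠ 0)
    (hp : 1 - ε ^ 2 * k.a₁ * (k.b₃ - k.b₁) * p 5 ^ 2 ≠ 0)
    (hH : 2 * (1 - quadH k ε x)
      + (1 + quadH k ε x) * (1 + ε ^ 2 * k.a₁ * (k.b₃ - k.b₁) * p 5 ^ 2) ≠ 0) :
    p 5 + q 5 ≠ 0 := fun h => by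
  have harea := s.area_of_slice h₂ h₅
  rw [← neg_eq_iff_eq_neg.mpr (s'.p₃_eq_of_add_eq_zero (s.m₃_eq.trans h₂) hp h)] at harea
  refine mul_ne_zero (s.p₃_ne_zero_of_slice ha hε h₂ h₅ hA) hH ?_
  linear_combination -2 * harea
    + (1 + ε ^ 2 * k.a₁ * (k.b₃ - k.b₁) * p 5 ^ 2) * s.p₃_of_slice h₂ h₅

theorem IsStep.fivePoint_reflect_ne_zero_of_slice (s : IsStep k ε x p) (s' : IsStep k ε p q)
    (ha : k.a₁ ≠ 0) (hε : ε ≠ 0) (h₂ : x 2 = 0) (h₅ : x 5 = 0) (hA : area x ≠ 0)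
    (hx : (k.b₃ - k.b₁) * x 3 * x 4 + k.a₁ * x 0 * x 1 ≠ 0)
    (hp : 1 - ε ^ 2 * k.a₁ * (k.b₃ - k.b₁) * p 5 ^ 2 ≠ 0)
    (hH : 2 * (1 - quadH k ε x)
      + (1 + quadH k ε x) * (1 + ε ^ 2 * k.a₁ * (k.b₃ - k.b₁) * p 5 ^ 2) ≠ 0) :
    fivePoint (Kirchhoff.reflect q) (Kirchhoff.reflect p) p q ≠ 0 := by
  have hsum := s.add_p₃_ne_zero_of_slice s' ha hε h₂ h₅ hA hp hH
  have hmul : (q 0 * p 3 - p 0 * q 3)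
      = (p 5 + q 5) * ε * ((k.b₃ - k.b₁) * x 3 * x 4 + k.a₁ * x 0 * x 1) := by
    refine mul_right_cancel₀ hp ?_
    rw [s'.mul_sub_mul_of_m₃_eq_zero (s.m₃_eq.trans h₂), s.mul_add_mul_of_slice h₂ h₅]
    ring
  rw [fivePoint_reflect, hmul]
  exact mul_ne_zero (mul_ne_zero two_ne_zero hsum) (mul_ne_zero (mul_ne_zero hsum hε) hx)

end ZeroLevel

section Nonvanishing

variable {k : KirchhoffParams} {ε : ℝ}

theorem eventually_factors_ne_zero :
    ∀ᶠ y in 𝓝 (0 : KState),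
      1 - ε ^ 2 * k.a₁ * (k.b₃ - k.b₁) * kahanMap k ε y 5 ^ 2 ≠ 0 ∧
      2 * (1 - quadH k ε y)
        + (1 + quadH k ε y) * (1 + ε ^ 2 * k.a₁ * (k.b₃ - k.b₁) * kahanMap k ε y 5 ^ 2) ≠ 0 := by
  have hδ : delta k ε 0 ≠ 0 := by rw [delta_zero]; exact one_ne_zero
  have hΦ : Tendsto (fun y => kahanMap k ε y 5) (𝓝 0) (𝓝 0) := by
    simpa only [ContinuousAt, kahanMap_zero, Pi.zero_apply] using continuousAt_kahanMap_apply hδ 5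
  have hH : Tendsto (quadH k ε) (𝓝 0) (𝓝 0) := by
    have hc : Continuous (quadH k ε) := by unfold quadH; fun_prop
    simpa only [quadH_zero] using hc.tendsto 0
  have hs : Tendsto (fun y => ε ^ 2 * k.a₁ * (k.b₃ - k.b₁) * kahanMap k ε y 5 ^ 2) (𝓝 0)
      (𝓝 (ε ^ 2 * k.a₁ * (k.b₃ - k.b₁) * 0 ^ 2)) := (hΦ.pow 2).const_mul _
  exact ((hs.const_sub 1).eventually_ne (by norm_num)).and
    ((((hH.const_sub 1).const_mul 2).add ((hH.const_add 1).mul (hs.const_add 1))).eventually_ne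
      (by norm_num))

theorem fivePoint_reflect_eq_zero_of_slice (hdet : Generically fun x => wronskianDet k ε x = 0)
    {y : KState} (hy₂ : y 2 = 0) (hy₅ : y 5 = 0) (h₁ : delta k ε y ≠ 0)
    (h₂ : delta k ε (kahanMap k ε y) ≠ 0) (h₃ : delta k (-ε) y ≠ 0)
    (h₄ : delta k (-ε) (kahanMap k (-ε) y) ≠ 0) :
    fivePoint (reflect (kahanMap k ε (kahanMap k ε y))) (reflect (kahanMap k ε y))
      (kahanMap k ε y) (kahanMap k ε (kahanMap k ε y)) = 0 := by
  have hr : reflect y = y := reflect_of_slice hy₂ hy₅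
  have r₁ : kahanMap k (-ε) y = reflect (kahanMap k ε y) := by
    simpa only [hr] using kahanMap_reflect h₁ (by rwa [hr])
  have hfive := fivePoint_eq_zero hdet h₁ h₂ h₃ h₄
  rw [r₁] at h₄ hfive
  rwa [kahanMap_reflect h₂ h₄] at hfive

theorem generically_wronskianDet_ne_zero (ha : k.a₁ ≠ 0) (hb : k.b₁ ≠ k.b₃) (hε : ε ≠ 0) :
    Generically fun x => wronskianDet k ε x ≠ 0 := by
  refine isRational_wronskianDet.generically_eq_zero_or_generically_ne_zero.resolve_left
    fun hdet => ?_
  have hray : Tendsto (fun η : ℝ => η • (![1, 0, 0, 1, 1, 0] : KState)) (𝓝[≠] 0) (𝓝 0) := by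
    have hc : Continuous fun η : ℝ => η • (![1, 0, 0, 1, 1, 0] : KState) := by fun_prop
    simpa only [zero_smul] using (hc.tendsto 0).mono_left nhdsWithin_le_nhds
  obtain ⟨η, ⟨⟨h₁, h₂⟩, ⟨h₃, h₄⟩, h₅, h₆⟩, hη⟩ := ((hray.eventually
    ((eventually_delta_ne_zero (k := k) ε).and
      ((eventually_delta_ne_zero (k := k) (-ε)).and eventually_factors_ne_zero))).and
    self_mem_nhdsWithin).exists
  have hη : η ≠ 0 := hη
  set y : KState := η • ![1, 0, 0, 1, 1, 0] with hy
  have hy' : y = ![η, 0, 0, η, η, 0] := by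
    simp only [hy, Matrix.smul_cons, Matrix.smul_empty, smul_eq_mul, mul_one, mul_zero]
  have hy₂ : y 2 = 0 := by rw [hy']; rfl
  have hy₅ : y 5 = 0 := by rw [hy']; rfl
  refine (isStep_kahanMap h₁).fivePoint_reflect_ne_zero_of_slice (isStep_kahanMap h₂) ha hε hy₂ hy₅
    ?_ ?_ h₅ h₆ (fivePoint_reflect_eq_zero_of_slice hdet hy₂ hy₅ h₁ h₂ h₃ h₄)
  · simp only [hy', area, Matrix.cons_val]
    simpa only [zero_mul, zero_sub, neg_ne_zero] using mul_ne_zero hη hη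
  · simp only [hy', Matrix.cons_val, mul_zero, add_zero]
    exact mul_ne_zero (mul_ne_zero (sub_ne_zero.mpr hb.symm) hη) hη

end Nonvanishing

section HKBasis

variable {k : KirchhoffParams} {ε : ℝ} {x : KState}

theorem iter_kahanMap (hx : x ∈ orbitDomain k ε) (i : ℤ) :
    iter k ε i (kahanMap k ε x) = iter k ε (i + 1) x := by
  have hx₀ := (hx 0).1
  have hx₁ := (hx 1).2
  have hiter : iter k ε 1 x = kahanMap k ε x := congrFun (iter_natCast 1) x
  rw [iter_zero] at hx₀
  rw [hiter] at hx₁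
  cases i with
  | ofNat n =>
    have hn := iter_natCast (k := k) (ε := ε) (n + 1)
    rw [Nat.cast_succ] at hn
    rw [iter_ofNat, Int.ofNat_eq_natCast, hn, Function.iterate_succ_apply]
  | negSucc n =>
    rw [iter_negSucc, Int.negSucc_eq, neg_add, neg_add_cancel_right, iter_neg_natCast,
      Function.iterate_succ_apply, kahanMap_neg_kahanMap hx₀ hx₁]

theorem mapsTo_kahanMap : Set.MapsTo (kahanMap k ε) (orbitDomain k ε) (orbitDomain k ε) :=
  fun x hx i => by
    rw [iter_kahanMap hx]
    exact hx (i + 1)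

theorem iter_neg (i : ℤ) : iter k (-ε) i = iter k ε (-i) := by
  obtain ⟨n, rfl | rfl⟩ := i.eq_nat_or_neg
  · rw [iter_natCast, iter_neg_natCast]
  · rw [iter_neg_natCast, neg_neg, neg_neg, iter_natCast]

theorem orbitDomain_neg : orbitDomain k (-ε) = orbitDomain k ε := by
  ext x
  refine (Equiv.neg ℤ).forall_congr fun i => ?_
  rw [iter_neg, neg_neg, and_comm, Equiv.neg_apply]

theorem mapsTo_iter (i : ℤ) : Set.MapsTo (iter k ε i) (orbitDomain k ε) (orbitDomain k ε) := by
  obtain ⟨n, rfl | rfl⟩ := i.eq_nat_or_neg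
  · rw [iter_natCast]
    exact mapsTo_kahanMap.iterate n
  · rw [iter_neg_natCast, ← orbitDomain_neg]
    exact mapsTo_kahanMap.iterate n

section PlanarSlice

variable (h₂ : x 2 = 0) (h₅ : x 5 = 0) (hA : area x = 0) (hH : 1 + quadH k ε x ≠ 0)
include h₂ h₅ hA hH

theorem redJ_of_area_eq_zero : redJ k ε x = 2 := by
  rw [redJ_of_slice h₂ h₅ hH, hA]
  ring

theorem invN_of_area_eq_zero : invN k ε x = (quadH k ε x - 3) / 2 := by
  rw [invN_of_slice h₂ h₅ hH, redJ_of_area_eq_zero h₂ h₅ hA hH]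
  ring

theorem denJ₁_of_area_eq_zero (ha : k.a₁ ≠ 0) :
    denJ₁ k ε x = (1 + quadH k ε x) * (quadH k ε x - 3) / 4 := by
  rw [denJ₁_of_slice ha h₂, invN_of_area_eq_zero h₂ h₅ hA hH]
  ring

theorem J₁_of_area_eq_zero (ha : k.a₁ ≠ 0) (hH₃ : quadH k ε x - 3 ≠ 0) :
    J₁ k ε x = (2 * k.a₃ / k.a₁ - 1)
      + (c₃ k ε x - (2 * k.a₃ / k.a₁ - 1)) * (quadH k ε x + 13) / (quadH k ε x - 3) := by
  rw [J₁, numJ₁_of_slice h₂, denJ₁_of_area_eq_zero h₂ h₅ hA hH ha, ratJ₀,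
    invN_of_area_eq_zero h₂ h₅ hA hH, redJ_of_area_eq_zero h₂ h₅ hA hH, I₀_of_slice h₂ h₅]
  field_simp
  ring

theorem continuousAt_J₁_of_area_eq_zero (ha : k.a₁ ≠ 0) (hH₃ : quadH k ε x - 3 ≠ 0) :
    ContinuousAt (J₁ k ε) x := by
  refine (contDiffAt_J₁ (n := 0) ha ?_ ?_ ?_).continuousAt
  · rw [c₁_of_slice h₂ h₅]; exact one_ne_zero
  · rwa [denJ_of_slice h₂ h₅]
  · rw [denJ₁_of_area_eq_zero h₂ h₅ hA hH ha]
    exact div_ne_zero (mul_ne_zero hH hH₃) four_ne_zero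

end PlanarSlice

theorem exists_ne_zero_abs_mul_sq_lt_one (β : ℝ) : ∃ t ≠ 0, |β * t ^ 2| < 1 := by
  have hpos : 0 < 1 + |β| := by positivity
  refine ⟨(1 + |β|)⁻¹, inv_ne_zero hpos.ne', ?_⟩
  rw [abs_mul, abs_pow, abs_inv, abs_of_pos hpos, inv_pow, ← div_eq_mul_inv,
    div_lt_one (pow_pos hpos 2)]
  nlinarith [abs_nonneg β]

theorem exists_slice_c₃_ne (ha : k.a₁ ≠ 0) (hb : k.b₁ ≠ k.b₃) (hε : ε ≠ 0) :
    ∃ w : KState, w 2 = 0 ∧ w 5 = 0 ∧ area w = 0 ∧ |quadH k ε w| < 1 ∧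
      c₃ k ε w - (2 * k.a₃ / k.a₁ - 1) ≠ 0 := by
  by_cases h : k.a₃ = k.a₁
  · obtain ⟨t, ht, hsmall⟩ := exists_ne_zero_abs_mul_sq_lt_one (ε ^ 2 * k.a₁ * (k.b₃ - k.b₁))
    refine ⟨![0, 0, 0, t, 0, 0], rfl, rfl, ?_, ?_, ?_⟩
    · simp only [area, Matrix.cons_val]
      ring
    · convert hsmall using 2
      simp only [quadH, Matrix.cons_val]
      ring
    · have hne : ε ^ 2 * k.a₃ * (k.b₃ - k.b₁) * t ^ 2 ≠ 0 := by
        rw [h]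
        exact mul_ne_zero (mul_ne_zero (mul_ne_zero (pow_ne_zero 2 hε) ha)
          (sub_ne_zero.mpr hb.symm)) (pow_ne_zero 2 ht)
      convert hne using 1
      simp only [c₃, Matrix.cons_val]
      ring
  · obtain ⟨s, hs, hsmall⟩ := exists_ne_zero_abs_mul_sq_lt_one (ε ^ 2 * k.a₁ * k.a₁)
    refine ⟨![s, 0, 0, 0, 0, 0], rfl, rfl, ?_, ?_, ?_⟩
    · simp only [area, Matrix.cons_val]
      ring
    · convert hsmall using 2
      simp only [quadH, Matrix.cons_val]
      ring
    · have hne : ε ^ 2 * k.a₁ * (k.a₃ - k.a₁) * s ^ 2 ≠ 0 :=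
        mul_ne_zero (mul_ne_zero (mul_ne_zero (pow_ne_zero 2 hε) ha) (sub_ne_zero.mpr h))
          (pow_ne_zero 2 hs)
      convert hne using 1
      simp only [c₃, Matrix.cons_val]
      ring

theorem not_dense_J₁_eq (ha : k.a₁ ≠ 0) (hb : k.b₁ ≠ k.b₃) (hε : ε ≠ 0) (r : ℝ) :
    ¬ Dense {x | J₁ k ε x = r} := by
  intro h
  have hval {y : KState} (h₂ : y 2 = 0) (h₅ : y 5 = 0) (hA : area y = 0)
      (hH : 1 + quadH k ε y ≠ 0) (hH₃ : quadH k ε y - 3 ≠ 0) :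
      (2 * k.a₃ / k.a₁ - 1)
        + (c₃ k ε y - (2 * k.a₃ / k.a₁ - 1)) * (quadH k ε y + 13) / (quadH k ε y - 3) = r := by
    rw [← J₁_of_area_eq_zero h₂ h₅ hA hH ha hH₃]
    exact eq_of_dense h (continuousAt_J₁_of_area_eq_zero h₂ h₅ hA hH ha hH₃)
      continuousAt_const fun _ hz => hz
  have hr : 2 * k.a₃ / k.a₁ - 1 = r := by
    have hc₀ : c₃ k ε 0 = 2 * k.a₃ / k.a₁ - 1 := by simp only [c₃, Pi.zero_apply]; ring
    have hval₀ := hval (y := 0) rfl rfl (by rw [area]; exact sub_self _)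
      (by rw [quadH_zero]; norm_num) (by rw [quadH_zero]; norm_num)
    rwa [hc₀, sub_self, zero_mul, zero_div, add_zero] at hval₀
  obtain ⟨w, hw₂, hw₅, hA, hH, hc₃⟩ := exists_slice_c₃_ne ha hb hε
  obtain ⟨hlo, hhi⟩ := abs_lt.mp hH
  have hw₃ : quadH k ε w - 3 ≠ 0 := by linarith
  have hvalw := hval hw₂ hw₅ hA (by linarith) hw₃
  rw [← hr, add_eq_left] at hvalw
  exact div_ne_zero (mul_ne_zero hc₃ (by linarith)) hw₃ hvalw

theorem generically_nullSpace_eq_span (ha : k.a₁ ≠ 0) (hb : k.b₁ ≠ k.b₃) (hε : ε ≠ 0) :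
    Generically fun x => x ∈ orbitDomain k ε →
      hkNullSpace (iter k ε) (wronskian k ε 3) x = Submodule.span ℝ {![1, 1, J₁ k ε x]} :=
  ((generically_isNondegenerate_iterate ha hε).and (generically_wronskianDet_ne_zero ha hb hε)).mono
    fun _ h hx => nullSpace_eq_span ha hb hε hx h.1 h.2

theorem linearIndependent_wronskian (ha : k.a₁ ≠ 0) (hb : k.b₁ ≠ k.b₃) (hε : ε ≠ 0) :
    LinearIndependent ℝ (fun j => (orbitDomain k ε).domRestrict (wronskian k ε 3 j)) := by
  rw [Fintype.linearIndependent_iff]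
  intro g hg
  have hmem {x : KState} (hx : x ∈ orbitDomain k ε) :
      g ∈ hkNullSpace (iter k ε) (wronskian k ε 3) x := fun i => by
    have hgi := congrFun hg ⟨iter k ε i x, mapsTo_iter i hx⟩
    rwa [Finset.sum_apply] at hgi
  have hdense : Dense {x | ∃ r : ℝ, r • ![1, 1, J₁ k ε x] = g} := by
    refine (dense_orbitDomain_inter (k := k) (ε := ε)
      (generically_nullSpace_eq_span ha hb hε)).mono ?_
    rintro x ⟨hx, hspan⟩
    have hspan₀ := hspan 0
    rw [iter_zero] at hspan₀
    exact Submodule.mem_span_singleton.mp (hspan₀ hx ▸ hmem hx)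
  obtain ⟨x, r, rfl⟩ := hdense.nonempty
  by_cases hr : r = 0
  · rw [hr, zero_smul]
    exact fun _ => rfl
  · refine (not_dense_J₁_eq ha hb hε (J₁ k ε x) (hdense.mono fun y hy => ?_)).elim
    obtain ⟨s, hs⟩ := hy
    have hsr : s = r := by simpa using congrFun hs 0
    subst hsr
    exact mul_left_cancel₀ hr (congrFun hs 2)

end HKBasis

section LineDerivative

variable {E : Type*} [NormedAddCommGroup E] [NormedSpace ℝ E] {F G : E → ℝ} {x v : E}

theorem fderiv_apply_eq_of_line_eq (hF : DifferentiableAt ℝ F x) (hG : DifferentiableAt ℝ G x)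
    (h : ∀ᶠ s : ℝ in 𝓝 0, F (x + s • v) = G (x + s • v)) : fderiv ℝ F x v = fderiv ℝ G x v :=
  HasDerivAt.unique (hF.hasFDerivAt.hasLineDerivAt v)
    (HasDerivAt.congr_of_eventuallyEq (hG.hasFDerivAt.hasLineDerivAt v) h)

theorem fderiv_apply_eq_of_quadratic (hF : DifferentiableAt ℝ F x) {c q : ℝ}
    (h : ∀ s : ℝ, F (x + s • v) = F x + s * c + s ^ 2 * q) : fderiv ℝ F x v = c := by
  have hpoly : HasDerivAt (fun s : ℝ => F x + s * c + s ^ 2 * q) c 0 :=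
    ((((hasDerivAt_id (0 : ℝ)).mul_const c).const_add (F x)).add
      ((hasDerivAt_pow 2 (0 : ℝ)).mul_const q)).congr_deriv (by simp)
  exact (hF.hasFDerivAt.hasLineDerivAt v).unique (hpoly.congr_of_eventuallyEq (.of_forall h))

end LineDerivative

section SliceDifferentials

variable {k : KirchhoffParams} {ε : ℝ} {x v : KState}

theorem fderiv_c₃ : fderiv ℝ (c₃ k ε) x v =
    2 * ε ^ 2 * (k.a₁ * (k.a₃ - k.a₁) * (x 0 * v 0 + x 1 * v 1)
      + k.a₃ * (k.b₃ - k.b₁) * (x 3 * v 3 + x 4 * v 4)) := by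
  refine fderiv_apply_eq_of_quadratic (q := ε ^ 2 * (k.a₁ * (k.a₃ - k.a₁) * (v 0 ^ 2 + v 1 ^ 2)
    + k.a₃ * (k.b₃ - k.b₁) * (v 3 ^ 2 + v 4 ^ 2)))
    (contDiff_c₃ (n := 1).differentiable one_ne_zero x) fun s => ?_
  simp only [c₃, Pi.add_apply, Pi.smul_apply, smul_eq_mul]
  ring

theorem fderiv_quadH : fderiv ℝ (quadH k ε) x v =
    2 * ε ^ 2 * k.a₁ * (k.a₁ * (x 0 * v 0 + x 1 * v 1)
      + (k.b₃ - k.b₁) * (x 3 * v 3 + x 4 * v 4)) := by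
  refine fderiv_apply_eq_of_quadratic (q := ε ^ 2 * k.a₁ * (k.a₁ * (v 0 ^ 2 + v 1 ^ 2)
    + (k.b₃ - k.b₁) * (v 3 ^ 2 + v 4 ^ 2)))
    (contDiff_quadH (n := 1).differentiable one_ne_zero x) fun s => ?_
  simp only [quadH, Pi.add_apply, Pi.smul_apply, smul_eq_mul]
  ring

theorem fderiv_area : fderiv ℝ area x v = x 1 * v 3 + v 1 * x 3 - x 0 * v 4 - v 0 * x 4 := by
  refine fderiv_apply_eq_of_quadratic (q := v 1 * v 3 - v 0 * v 4)
    (contDiff_area (n := 1).differentiable one_ne_zero x) fun s => ?_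
  simp only [area, Pi.add_apply, Pi.smul_apply, smul_eq_mul]
  ring

theorem contDiff_m₃ {n : WithTop ℕ∞} : ContDiff ℝ n m₃ := by unfold m₃; fun_prop

theorem fderiv_m₃ : fderiv ℝ m₃ x v = v 2 :=
  fderiv_apply_eq_of_quadratic (q := 0) (contDiff_m₃ (n := 1).differentiable one_ne_zero x)
    fun s => by simp only [m₃, Pi.add_apply, Pi.smul_apply, smul_eq_mul, mul_zero, add_zero]

theorem contDiffAt_I₀_of_slice {n : WithTop ℕ∞} (h₂ : x 2 = 0) (h₅ : x 5 = 0) :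
    ContDiffAt ℝ n (I₀ k ε) x :=
  contDiffAt_I₀ (by rw [c₁_of_slice h₂ h₅]; exact one_ne_zero)

theorem contDiffAt_redJ_of_slice {n : WithTop ℕ∞} (h₂ : x 2 = 0) (h₅ : x 5 = 0)
    (hH : 1 + quadH k ε x ≠ 0) : ContDiffAt ℝ n (redJ k ε) x :=
  contDiffAt_redJ (by rw [c₁_of_slice h₂ h₅]; exact one_ne_zero) (by rwa [denJ_of_slice h₂ h₅])

theorem contDiffAt_invN_of_slice {n : WithTop ℕ∞} (h₂ : x 2 = 0) (h₅ : x 5 = 0)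
    (hH : 1 + quadH k ε x ≠ 0) : ContDiffAt ℝ n (invN k ε) x :=
  contDiffAt_invN (by rw [c₁_of_slice h₂ h₅]; exact one_ne_zero) (by rwa [denJ_of_slice h₂ h₅])

section Tangent

variable (h₂ : x 2 = 0) (h₅ : x 5 = 0) (hv₂ : v 2 = 0) (hv₅ : v 5 = 0)
include h₂ h₅ hv₂ hv₅

theorem fderiv_apply_eq_of_slice {F G : KState → ℝ} (hF : DifferentiableAt ℝ F x)
    (hG : DifferentiableAt ℝ G x) (h : ∀ᶠ y in 𝓝 x, y 2 = 0 → y 5 = 0 → F y = G y) :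
    fderiv ℝ F x v = fderiv ℝ G x v := by
  refine fderiv_apply_eq_of_line_eq hF hG ?_
  have hline : Tendsto (fun s : ℝ => x + s • v) (𝓝 0) (𝓝 x) :=
    Continuous.tendsto' (by fun_prop) _ _ (by rw [zero_smul, add_zero])
  filter_upwards [hline.eventually h] with s hs
  exact hs (by simp [h₂, hv₂]) (by simp [h₅, hv₅])

theorem fderiv_I₀_of_slice : fderiv ℝ (I₀ k ε) x v = fderiv ℝ (c₃ k ε) x v :=
  fderiv_apply_eq_of_slice h₂ h₅ hv₂ hv₅
    ((contDiffAt_I₀_of_slice (n := 1) h₂ h₅).differentiableAt one_ne_zero)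
    (contDiff_c₃ (n := 1).differentiable one_ne_zero x) (.of_forall fun _ => I₀_of_slice)

variable (hH : 1 + quadH k ε x ≠ 0)
include hH

theorem fderiv_redJ_of_slice :
    (1 + quadH k ε x) * fderiv ℝ (redJ k ε) x v + (redJ k ε x - 2) * fderiv ℝ (quadH k ε) x v
      = 4 * ε ^ 4 * k.a₁ ^ 3 * (k.b₃ - k.b₁) * area x * fderiv ℝ area x v := by
  have hJ := ((contDiffAt_redJ_of_slice (n := 1) h₂ h₅ hH).differentiableAt one_ne_zero).hasFDerivAt
  have hQ := (contDiff_quadH (k := k) (ε := ε) (n := 1).differentiable one_ne_zero x).hasFDerivAt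
  have hA := (contDiff_area (n := 1).differentiable one_ne_zero x).hasFDerivAt
  have hF := (hJ.sub_const 2).fun_mul (hQ.const_add 1)
  have hG := (hA.fun_mul hA).const_mul (2 * ε ^ 4 * k.a₁ ^ 3 * (k.b₃ - k.b₁))
  have heq := fderiv_apply_eq_of_slice h₂ h₅ hv₂ hv₅ hF.differentiableAt hG.differentiableAt <| by
    filter_upwards [(hQ.continuousAt.const_add 1).eventually_ne hH] with y hy hy₂ hy₅
    rw [redJ_of_slice hy₂ hy₅ hy]
    field_simp
    ring
  rw [hF.fderiv, hG.fderiv] at heq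
  simp only [add_apply, smul_apply, smul_eq_mul] at heq
  linear_combination heq

theorem fderiv_redJ_add_fderiv_invN_of_slice :
    fderiv ℝ (redJ k ε) x v + fderiv ℝ (invN k ε) x v = fderiv ℝ (quadH k ε) x v / 2 := by
  have hJ := (contDiffAt_redJ_of_slice (n := 1) h₂ h₅ hH).differentiableAt one_ne_zero
  have hN := (contDiffAt_invN_of_slice (n := 1) h₂ h₅ hH).differentiableAt one_ne_zero
  have hQ := (contDiff_quadH (k := k) (ε := ε) (n := 1).differentiable one_ne_zero x).hasFDerivAt
  have hF := hJ.hasFDerivAt.add hN.hasFDerivAt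
  have hG := (hQ.const_add 1).mul_const (1 / 2)
  have heq := fderiv_apply_eq_of_slice h₂ h₅ hv₂ hv₅ hF.differentiableAt hG.differentiableAt <| by
    filter_upwards [(hQ.continuousAt.const_add 1).eventually_ne hH] with y hy hy₂ hy₅
    rw [Pi.add_apply, invN_of_slice hy₂ hy₅ hy]
    ring
  rw [hF.fderiv, hG.fderiv] at heq
  simp only [add_apply, smul_apply, smul_eq_mul] at heq
  linear_combination heq

end Tangent

theorem fderiv_redJ_rotation_ne_zero (ha : k.a₁ ≠ 0) (hb : k.b₁ ≠ k.b₃) (hε : ε ≠ 0)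
    (h₂ : x 2 = 0) (h₅ : x 5 = 0) (hH : 1 + quadH k ε x ≠ 0) (hA : area x ≠ 0)
    (hmp : x 0 * x 3 + x 1 * x 4 ≠ 0) :
    fderiv ℝ (redJ k ε) x ![0, 0, 0, -x 4, x 3, 0] ≠ 0 := by
  have h := fderiv_redJ_of_slice h₂ h₅ (v := ![0, 0, 0, -x 4, x 3, 0]) rfl rfl hH
  rw [fderiv_quadH, fderiv_area] at h
  simp only [Matrix.cons_val] at h
  have hne : 4 * ε ^ 4 * k.a₁ ^ 3 * (k.b₃ - k.b₁) * area x * (x 0 * x 3 + x 1 * x 4) ≠ 0 := by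
    have := sub_ne_zero.mpr hb.symm
    positivity
  intro h0
  rw [h0] at h
  exact hne (by linear_combination h)

theorem sq_add_sq_ne_zero_of_inner_ne_zero {r s t u : ℝ} (h : r * t + s * u ≠ 0) :
    r ^ 2 + s ^ 2 ≠ 0 ∧ t ^ 2 + u ^ 2 ≠ 0 := by
  refine not_or.mp fun h0 => h ?_
  have hcs : (r * t + s * u) ^ 2 + (r * u - s * t) ^ 2 = 0 := by
    rcases h0 with h0 | h0
    · linear_combination (t ^ 2 + u ^ 2) * h0
    · linear_combination (r ^ 2 + s ^ 2) * h0
  exact (pow_eq_zero_iff two_ne_zero).mp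
    ((add_eq_zero_iff_of_nonneg (sq_nonneg _) (sq_nonneg _)).mp hcs).1

theorem eq_zero_of_forall_slice_tangent (ha : k.a₁ ≠ 0) (hb : k.b₁ ≠ k.b₃) (hε : ε ≠ 0)
    (h₂ : x 2 = 0) (h₅ : x 5 = 0) (hH : 1 + quadH k ε x ≠ 0) (hA : area x ≠ 0)
    (hmp : x 0 * x 3 + x 1 * x 4 ≠ 0) {r s t : ℝ}
    (h : ∀ v : KState, v 2 = 0 → v 5 = 0 → r * fderiv ℝ (I₀ k ε) x v
      + s * fderiv ℝ (redJ k ε) x v + t * fderiv ℝ (invN k ε) x v = 0) :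
    r = 0 ∧ s = 0 ∧ t = 0 := by
  have hv (v : KState) (hv₂ : v 2 = 0) (hv₅ : v 5 = 0) :
      r * fderiv ℝ (c₃ k ε) x v + (s - t) * fderiv ℝ (redJ k ε) x v
        + t * (fderiv ℝ (quadH k ε) x v / 2) = 0 := by
    linear_combination h v hv₂ hv₅ - r * fderiv_I₀_of_slice h₂ h₅ hv₂ hv₅
      - t * fderiv_redJ_add_fderiv_invN_of_slice h₂ h₅ hv₂ hv₅ hH
  have hst : s = t := by
    have hrot := hv ![0, 0, 0, -x 4, x 3, 0] rfl rfl
    rw [fderiv_c₃, fderiv_quadH] at hrot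
    simp only [Matrix.cons_val] at hrot
    exact sub_eq_zero.mp <| (mul_eq_zero.mp (by linear_combination hrot)).resolve_right
      (fderiv_redJ_rotation_ne_zero ha hb hε h₂ h₅ hH hA hmp)
  obtain ⟨hmm, hpp⟩ := sq_add_sq_ne_zero_of_inner_ne_zero hmp
  have hm : 2 * (k.a₃ - k.a₁) * r + k.a₁ * t = 0 := by
    have hrad := hv ![x 0, x 1, 0, 0, 0, 0] rfl rfl
    rw [fderiv_c₃, fderiv_quadH, hst] at hrad
    simp only [Matrix.cons_val] at hrad
    exact (mul_eq_zero.mp (by linear_combination hrad)).resolve_left <|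
      mul_ne_zero (mul_ne_zero (pow_ne_zero 2 hε) ha) hmm
  have hp : 2 * k.a₃ * r + k.a₁ * t = 0 := by
    have hrad := hv ![0, 0, 0, x 3, x 4, 0] rfl rfl
    rw [fderiv_c₃, fderiv_quadH, hst] at hrad
    simp only [Matrix.cons_val] at hrad
    exact (mul_eq_zero.mp (by linear_combination hrad)).resolve_left <|
      mul_ne_zero (mul_ne_zero (pow_ne_zero 2 hε) (sub_ne_zero.mpr hb.symm)) hpp
  have hr : r = 0 := (mul_eq_zero.mp (by linear_combination (hp - hm) / 2)).resolve_left ha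
  have ht : t = 0 := (mul_eq_zero.mp (by linear_combination hp - 2 * k.a₃ * hr)).resolve_left ha
  exact ⟨hr, hst.trans ht, ht⟩

theorem linearIndependent_fderiv_of_slice (ha : k.a₁ ≠ 0) (hb : k.b₁ ≠ k.b₃) (hε : ε ≠ 0)
    (h₂ : x 2 = 0) (h₅ : x 5 = 0) (hH : 1 + quadH k ε x ≠ 0) (hA : area x ≠ 0)
    (hmp : x 0 * x 3 + x 1 * x 4 ≠ 0) :
    LinearIndependent ℝ fun i => fderiv ℝ (![I₀ k ε, redJ k ε, invN k ε, m₃] i) x := by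
  rw [Fintype.linearIndependent_iff]
  intro g hg
  have hrel (v : KState) : g 0 * fderiv ℝ (I₀ k ε) x v + g 1 * fderiv ℝ (redJ k ε) x v
      + g 2 * fderiv ℝ (invN k ε) x v + g 3 * v 2 = 0 := by
    have := congrArg (fun L => L v) hg
    rw [Fin.sum_univ_four] at this
    rwa [← fderiv_m₃ (x := x) (v := v)]
  obtain ⟨h₀, h₁, h₂⟩ := eq_zero_of_forall_slice_tangent ha hb hε h₂ h₅ hH hA hmp
    (r := g 0) (s := g 1) (t := g 2) fun v hv₂ _ => by linear_combination hrel v - g 3 * hv₂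
  have h₃ : g 3 = 0 := by
    have := hrel (Pi.single 2 1)
    rwa [h₀, h₁, h₂, zero_mul, zero_mul, zero_mul, zero_add, zero_add, zero_add,
      Pi.single_eq_same, mul_one] at this
  intro i
  fin_cases i
  exacts [h₀, h₁, h₂, h₃]

theorem exists_slice_area_ne_zero (ha : k.a₁ ≠ 0) (hε : ε ≠ 0) :
    ∃ w : KState, w 2 = 0 ∧ w 5 = 0 ∧ 1 + quadH k ε w ≠ 0 ∧ area w ≠ 0 ∧
      w 0 * w 3 + w 1 * w 4 ≠ 0 := by
  suffices ∃ r : ℝ, r ≠ 0 ∧ 1 + quadH k ε ![r, 0, 0, 1, 1, 0] ≠ 0 by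
    obtain ⟨r, hr, hH⟩ := this
    refine ⟨_, rfl, rfl, hH, ?_, ?_⟩ <;> simpa [area] using hr
  by_contra! h
  have h₁ := h 1 one_ne_zero
  have h₂ := h 2 two_ne_zero
  simp only [quadH, Matrix.cons_val] at h₁ h₂
  have : ε ^ 2 * k.a₁ ^ 2 = 0 := by linear_combination (h₂ - h₁) / 3
  exact mul_ne_zero (pow_ne_zero 2 hε) (pow_ne_zero 2 ha) this

theorem functionallyIndependent_redJ_invN (ha : k.a₁ ≠ 0) (hb : k.b₁ ≠ k.b₃) (hε : ε ≠ 0) :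
    FunctionallyIndependent ![I₀ k ε, redJ k ε, invN k ε, m₃] := by
  obtain ⟨w, h₂, h₅, hH, hA, hmp⟩ := exists_slice_area_ne_zero (k := k) ha hε
  refine functionallyIndependent_of_linearIndependent (x := w) ?_ ?_
    (linearIndependent_fderiv_of_slice ha hb hε h₂ h₅ hH hA hmp)
  · exact Fin.forall_fin_succ.mpr ⟨isRational_I₀, Fin.forall_fin_succ.mpr ⟨isRational_redJ,
      Fin.forall_fin_succ.mpr ⟨isRational_invN, Fin.forall_fin_one.mpr (.coord 2)⟩⟩⟩
  · exact Fin.forall_fin_succ.mpr ⟨contDiffAt_I₀_of_slice h₂ h₅, Fin.forall_fin_succ.mpr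
      ⟨contDiffAt_redJ_of_slice h₂ h₅ hH, Fin.forall_fin_succ.mpr
      ⟨contDiffAt_invN_of_slice h₂ h₅ hH, Fin.forall_fin_one.mpr contDiff_m₃.contDiffAt⟩⟩⟩

end SliceDifferentials

section Elimination

variable {k : KirchhoffParams} {ε : ℝ} {v : Fin 4 → ℝ} {x : KState}

/-- The numerator `numJ₁` as a polynomial in `v = (I₀, redJ, invN, m₃)`. -/
def numJ₁Of (k : KirchhoffParams) (ε : ℝ) (v : Fin 4 → ℝ) : ℝ :=
  v 0 * (3 - (1 + v 2) ^ 2)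
    + (ε * k.a₁ * v 3) ^ 2 * v 0 * (((2 * k.a₃ / k.a₁ - 1) * v 1 - v 0) ^ 2 - v 0 ^ 2)
    - 2 * (1 + v 2) * ((2 * k.a₃ / k.a₁ - 1) * v 1 - v 0)
    + ((2 * k.a₃ / k.a₁ - 1) * v 1 - v 0 - v 0 * (1 + v 2)) * (2 - 4 * v 1 - 2 * v 2)

/-- The denominator `denJ₁` as a polynomial in `v = (I₀, redJ, invN, m₃)`. -/
def denJ₁Of (k : KirchhoffParams) (ε : ℝ) (v : Fin 4 → ℝ) : ℝ :=
  v 2 ^ 2 + 2 * v 2 + v 1 ^ 2 * (ε * (2 * k.a₃ - k.a₁) * v 3) ^ 2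
    - 2 * (ε * k.a₁ * v 3) * (ε * (2 * k.a₃ - k.a₁) * v 3) * v 0 * v 1

/-- The numerator of the derivative of `J₁ = numJ₁Of v / denJ₁Of v` with respect to `v 2 = invN`. -/
def derivNumJ₁Of (k : KirchhoffParams) (ε : ℝ) (v : Fin 4 → ℝ) : ℝ :=
  (-2 * v 0 - 4 * ((2 * k.a₃ / k.a₁ - 1) * v 1 - v 0) + 4 * v 0 * v 1 + 2 * v 0 * v 2)
    * denJ₁Of k ε v - numJ₁Of k ε v * (2 * v 2 + 2)

theorem denJ₁_eq_denJ₁Of (ha : k.a₁ ≠ 0) :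
    denJ₁ k ε x = denJ₁Of k ε fun i => ![I₀ k ε, redJ k ε, invN k ε, m₃] i x :=
  denJ₁_eq_invN_redJ ha x

theorem J₁_eq_numJ₁Of_div_denJ₁Of (ha : k.a₁ ≠ 0) :
    J₁ k ε x = numJ₁Of k ε (fun i => ![I₀ k ε, redJ k ε, invN k ε, m₃] i x)
      / denJ₁Of k ε fun i => ![I₀ k ε, redJ k ε, invN k ε, m₃] i x := by
  rw [J₁, denJ₁_eq_denJ₁Of ha]
  rfl

theorem differentiable_numJ₁Of : Differentiable ℝ (numJ₁Of k ε) := by unfold numJ₁Of; fun_prop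

theorem differentiable_denJ₁Of : Differentiable ℝ (denJ₁Of k ε) := by unfold denJ₁Of; fun_prop

theorem fderiv_numJ₁Of : fderiv ℝ (numJ₁Of k ε) v (Pi.single 2 1) =
    -2 * v 0 - 4 * ((2 * k.a₃ / k.a₁ - 1) * v 1 - v 0) + 4 * v 0 * v 1 + 2 * v 0 * v 2 := by
  refine fderiv_apply_eq_of_quadratic (q := v 0) differentiable_numJ₁Of.differentiableAt fun s => ?_
  simp only [numJ₁Of, Pi.add_apply, Pi.smul_apply, smul_eq_mul, ne_eq, Fin.reduceEq,
    not_false_eq_true, Pi.single_eq_of_ne, Pi.single_eq_same]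
  ring

theorem fderiv_denJ₁Of : fderiv ℝ (denJ₁Of k ε) v (Pi.single 2 1) = 2 * v 2 + 2 := by
  refine fderiv_apply_eq_of_quadratic (q := 1) differentiable_denJ₁Of.differentiableAt fun s => ?_
  simp only [denJ₁Of, Pi.add_apply, Pi.smul_apply, smul_eq_mul, ne_eq, Fin.reduceEq,
    not_false_eq_true, Pi.single_eq_of_ne, Pi.single_eq_same]
  ring

theorem surjective_pi_of_apply_single_ne_zero {b : ℝ} (hb : b ≠ 0) {L : (Fin 4 → ℝ) →L[ℝ] ℝ}
    (hL : L (Pi.single 2 1) ≠ 0) :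
    Function.Surjective (ContinuousLinearMap.pi
      ![.proj 0, b • .proj 1 - .proj 0, L, .proj 3] : (Fin 4 → ℝ) →L[ℝ] Fin 4 → ℝ) := by
  intro w
  have hval (s : ℝ) : L ![w 0, (w 0 + w 1) / b, s, w 3] =
      L ![w 0, (w 0 + w 1) / b, 0, w 3] + s * L (Pi.single 2 1) := by
    rw [← smul_eq_mul, ← map_smul, ← map_add]
    congr 1
    ext i
    fin_cases i <;> simp
  refine ⟨![w 0, (w 0 + w 1) / b,
    (w 2 - L ![w 0, (w 0 + w 1) / b, 0, w 3]) / L (Pi.single 2 1), w 3], ?_⟩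
  ext i
  fin_cases i
  · rfl
  · change b * ((w 0 + w 1) / b) - w 0 = w 1
    rw [mul_div_cancel₀ _ hb, add_sub_cancel_left]
  · change L _ = w 2
    rw [hval, div_mul_cancel₀ _ hL, add_sub_cancel]
  · rfl

theorem derivNumJ₁Of_of_area_eq_zero (h₂ : x 2 = 0) (h₅ : x 5 = 0) (hA : area x = 0)
    (hH : 1 + quadH k ε x ≠ 0) :
    derivNumJ₁Of k ε (fun i => ![I₀ k ε, redJ k ε, invN k ε, m₃] i x)
      = -2 * (c₃ k ε x - (2 * k.a₃ / k.a₁ - 1)) * (1 + quadH k ε x) ^ 2 := by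
  simp only [derivNumJ₁Of, numJ₁Of, denJ₁Of, Matrix.cons_val, m₃, h₂, I₀_of_slice h₂ h₅,
    redJ_of_area_eq_zero h₂ h₅ hA hH, invN_of_area_eq_zero h₂ h₅ hA hH]
  ring

theorem generically_derivNumJ₁Of_ne_zero (ha : k.a₁ ≠ 0) (hb : k.b₁ ≠ k.b₃) (hε : ε ≠ 0) :
    Generically fun x =>
      derivNumJ₁Of k ε (fun i => ![I₀ k ε, redJ k ε, invN k ε, m₃] i x) ≠ 0 := by
  obtain ⟨w, h₂, h₅, hA, hH, hc₃⟩ := exists_slice_c₃_ne ha hb hε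
  have hH' : 1 + quadH k ε w ≠ 0 := by linarith [(abs_lt.mp hH).1]
  have hI := (contDiffAt_I₀_of_slice (k := k) (ε := ε) (n := 0) h₂ h₅).continuousAt
  have hJ := (contDiffAt_redJ_of_slice (n := 0) h₂ h₅ hH').continuousAt
  have hN := (contDiffAt_invN_of_slice (n := 0) h₂ h₅ hH').continuousAt
  refine IsRational.generically_ne_zero (x := w) ?_ ?_ ?_
  · simp only [derivNumJ₁Of, numJ₁Of, denJ₁Of, Matrix.cons_val, m₃]
    fun_prop
  · have hm := (contDiff_m₃ (n := 0)).continuous.continuousAt (x := w)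
    simp only [derivNumJ₁Of, numJ₁Of, denJ₁Of, Matrix.cons_val]
    fun_prop
  · rw [derivNumJ₁Of_of_area_eq_zero h₂ h₅ hA hH']
    exact mul_ne_zero (mul_ne_zero (by norm_num) hc₃) (pow_ne_zero 2 hH')

section Quotient

variable {E : Type*} [NormedAddCommGroup E] [NormedSpace ℝ E] {F G : E → ℝ} {x v : E}

theorem differentiableAt_div (hF : DifferentiableAt ℝ F x) (hG : DifferentiableAt ℝ G x)
    (hx : G x ≠ 0) : DifferentiableAt ℝ (fun y => F y / G y) x := by
  simpa only [div_eq_mul_inv] using hF.fun_mul (hG.fun_inv hx)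

theorem fderiv_div_apply (hF : DifferentiableAt ℝ F x) (hG : DifferentiableAt ℝ G x)
    (hx : G x ≠ 0) : fderiv ℝ (fun y => F y / G y) x v
      = (fderiv ℝ F x v * G x - F x * fderiv ℝ G x v) / G x ^ 2 := by
  have hline := HasDerivAt.fun_div (hF.hasFDerivAt.hasLineDerivAt v)
    (hG.hasFDerivAt.hasLineDerivAt v) (by rwa [zero_smul, add_zero])
  simp only [zero_smul, add_zero] at hline
  exact ((differentiableAt_div hF hG hx).hasFDerivAt.hasLineDerivAt v).unique hline

end Quotient

/-- The integrals `(I₀, ratJ₀, J₁, m₃)` as functions of `v = (I₀, redJ, invN, m₃)`. -/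
def integralsOf (k : KirchhoffParams) (ε : ℝ) (v : Fin 4 → ℝ) : Fin 4 → ℝ :=
  ![v 0, (2 * k.a₃ / k.a₁ - 1) * v 1 - v 0, numJ₁Of k ε v / denJ₁Of k ε v, v 3]

theorem exists_surjective_hasFDerivAt_integralsOf (hb : 2 * k.a₃ / k.a₁ - 1 ≠ 0)
    (hden : denJ₁Of k ε v ≠ 0) (hcrit : derivNumJ₁Of k ε v ≠ 0) :
    ∃ g' : (Fin 4 → ℝ) →L[ℝ] Fin 4 → ℝ,
      HasFDerivAt (integralsOf k ε) g' v ∧ Function.Surjective g' := by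
  have hnum := differentiable_numJ₁Of (k := k) (ε := ε) v
  have hden' := differentiable_denJ₁Of (k := k) (ε := ε) v
  refine ⟨.pi ![.proj 0, (2 * k.a₃ / k.a₁ - 1) • .proj 1 - .proj 0,
    fderiv ℝ (fun u => numJ₁Of k ε u / denJ₁Of k ε u) v, .proj 3],
    hasFDerivAt_pi'' ?_, surjective_pi_of_apply_single_ne_zero hb ?_⟩
  · exact Fin.forall_fin_succ.mpr ⟨hasFDerivAt_apply 0 v, Fin.forall_fin_succ.mpr
      ⟨((hasFDerivAt_apply 1 v).const_mul _).sub (hasFDerivAt_apply 0 v), Fin.forall_fin_succ.mpr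
        ⟨(differentiableAt_div hnum hden' hden).hasFDerivAt,
          Fin.forall_fin_one.mpr (hasFDerivAt_apply 3 v)⟩⟩⟩
  · rw [fderiv_div_apply hnum hden' hden, fderiv_numJ₁Of, fderiv_denJ₁Of]
    exact div_ne_zero hcrit (pow_ne_zero 2 hden)

theorem functionallyIndependent_integrals (ha : k.a₁ ≠ 0) (hb : k.b₁ ≠ k.b₃) (hε : ε ≠ 0)
    (h : k.a₁ ≠ 2 * k.a₃) {N D : MvPolynomial (Fin 6) ℝ}
    (hJ₁ : Generically fun x => J₁ k ε x = ratFun N D x) :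
    FunctionallyIndependent ![I₀ k ε, J₀ k ε, ratFun N D, m₃] := by
  have hb' : 2 * k.a₃ / k.a₁ - 1 ≠ 0 := by
    rw [div_sub_one ha]
    exact div_ne_zero (sub_ne_zero.mpr h.symm) ha
  refine (functionallyIndependent_redJ_invN ha hb hε).comp ?_
  refine ((((generically_J₀_eq_ratJ₀ ha hε).and hJ₁).eventually.and
    (generically_denJ₁_ne_zero (ε := ε) ha)).and
    (generically_derivNumJ₁Of_ne_zero ha hb hε)).mono ?_
  rintro x ⟨⟨heq, hden⟩, hcrit⟩
  rw [denJ₁_eq_denJ₁Of ha] at hden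
  obtain ⟨g', hg, hsurj⟩ := exists_surjective_hasFDerivAt_integralsOf hb' hden hcrit
  refine ⟨integralsOf k ε, g', hg, hsurj, heq.mono fun y hy => ?_⟩
  ext i
  fin_cases i
  exacts [rfl, hy.1, hy.2.symm.trans (J₁_eq_numJ₁Of_div_denJ₁Of ha), rfl]

end Elimination

end

end Kirchhoff

theorem mainTheorem9 (k : KirchhoffParams) (ε : ℝ)
    (ha : k.a₁ ≠ 0) (hb : k.b₁ ≠ k.b₃) (hε : ε ≠ 0) :
    -- the third order Wronskians form an HK basis
    Dense (Kirchhoff.orbitDomain k ε) ∧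
    IsHKBasis (Kirchhoff.iter k ε) (Kirchhoff.orbitDomain k ε) (Kirchhoff.wronskian k ε 3) ∧
    -- the rational function `J₁ = N / D`
    ∃ N D : MvPolynomial (Fin 6) ℝ, D ≠ 0 ∧
      -- generically the null-space is one-dimensional, spanned by `(1, 1, J₁)`
      Kirchhoff.Generically (fun x => MvPolynomial.eval x D ≠ 0 ∧
        (x ∈ Kirchhoff.orbitDomain k ε →
          Module.finrank ℝ
            (hkNullSpace (Kirchhoff.iter k ε) (Kirchhoff.wronskian k ε 3) x) = 1 ∧
          hkNullSpace (Kirchhoff.iter k ε) (Kirchhoff.wronskian k ε 3) x =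
            Submodule.span ℝ {![1, 1, Kirchhoff.ratFun N D x]})) ∧
      -- the relation with coefficients `1, 1, J₁`, wherever it is defined
      (∀ x : KState, MvPolynomial.eval x D ≠ 0 →
        (∀ i < 3, Kirchhoff.delta k ε ((Kirchhoff.kahanMap k ε)^[i] x) ≠ 0) →
          Kirchhoff.wronskian k ε 3 0 x + Kirchhoff.wronskian k ε 3 1 x
            + Kirchhoff.ratFun N D x * Kirchhoff.wronskian k ε 3 2 x = 0) ∧
      -- `I₀`, `J₀`, `J₁`, `m₃` are integrals of motion
      Kirchhoff.IsIntegral k ε {x | Kirchhoff.c₁ k ε x ≠ 0} (Kirchhoff.I₀ k ε) ∧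
      Kirchhoff.IsIntegral k ε {x | Kirchhoff.delta k ε x ≠ 0 ∧ Kirchhoff.C₁ k ε x ≠ 0}
        (Kirchhoff.J₀ k ε) ∧
      Kirchhoff.IsIntegral k ε {x | MvPolynomial.eval x D ≠ 0} (Kirchhoff.ratFun N D) ∧
      Kirchhoff.IsIntegral k ε Set.univ Kirchhoff.m₃ ∧
      -- they are functionally independent
      (k.a₁ ≠ 2 * k.a₃ →
        Kirchhoff.FunctionallyIndependent
          ![Kirchhoff.I₀ k ε, Kirchhoff.J₀ k ε, Kirchhoff.ratFun N D, Kirchhoff.m₃]) := by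
  obtain ⟨N, D, hD, hJ₁⟩ := Kirchhoff.isRational_J₁ (ε := ε) ha
  have hD' : Kirchhoff.Generically fun x => MvPolynomial.eval x D ≠ 0 := ⟨D, hD, fun _ hx => hx⟩
  have hJ : Kirchhoff.Generically fun x => Kirchhoff.J₁ k ε x = Kirchhoff.ratFun N D x :=
    ⟨D, hD, hJ₁⟩
  refine ⟨Kirchhoff.dense_orbitDomain,
    ⟨Kirchhoff.linearIndependent_wronskian ha hb hε,
      fun x hx => Kirchhoff.nullSpace_ne_bot ha hb hε hx⟩,
    N, D, hD, ?_, fun x hx hd => Kirchhoff.wronskian_relation_ratFun ha hb hε hJ hx hd,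
    Kirchhoff.isIntegral_I₀ ha hε, Kirchhoff.isIntegral_J₀ ha hε,
    Kirchhoff.isIntegral_ratFun ha hε hJ, Kirchhoff.isIntegral_m₃,
    fun h => Kirchhoff.functionallyIndependent_integrals ha hb hε h hJ⟩
  apply ((Kirchhoff.generically_nullSpace_eq_span ha hb hε).and (hJ.and hD')).mono
  rintro x ⟨hspan, hJx, hDx⟩
  refine ⟨hDx, fun hU => ?_⟩
  rw [← hJx, hspan hU]
  exact ⟨finrank_span_singleton fun e => one_ne_zero (congrFun e 0), rfl⟩
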